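/- Let $p\in\mathbb R\setminus\{0\}$, let $N=(n_{ij})_{i,j\in\{0,1\}}\in SL(2,\mathbb Z)$ have eigenvalues $e^{p}$ and $e^{-p}$, with eigenvectors $(x_0,x_1)^T$ for $e^p$ and $(y_0,y_1)^T$ for $e^{-p}$, and put $z_2=x_1y_0-x_0y_1$ (which is nonzero). Let $G(p)$ be $\mathbb R^5$ with coordinates $(x,y,z,u,t)$ and the product $$(x,y,z,u,t)(x',y',z',u',t')=(x+e^{pu}x',\,y+e^{-pu}y',\,z+z'+xe^{-pu}y'+tu',\,u+u',\,t+t'),$$ and let $K$ be $\mathbb R^3$ with coordinates $(x,y,u)$ and the product $(x,y,u)(x',y',u')=(x+e^{pu}x',y+e^{-pu}y',u+u')$. Let $H$ be the Heisenberg group $\mathbb R^3$ with product $(x,y,z)(x',y',z')=(x+x',y+y',z+z'+xy')$ and automorphisms $\psi(u)(x,y,z)=(e^{pu}x,e^{-pu}y,z)$. Put $h_0=(x_0,y_0,z_0)$, $h_1=(x_1,y_1,z_1)$, $h_2=(0,0,z_2)$ in $H$, where $z_0,z_1\in\mathbb R$ are such that, for some integers $r,s$, $$\psi(1)(h_0)=h_0^{n_{00}}h_1^{n_{01}}h_2^{r},\qquad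 \psi(1)(h_1)=h_0^{n_{10}}h_1^{n_{11}}h_2^{s}$$ (such $z_0,z_1$ exist). Let $\Gamma_N\subset H$ be the subgroup generated by $h_0,h_1$, and define the discrete subgroups $$\Gamma(p)=\{(x,y,z,u,t)\in G(p): (x,y,z)\in\Gamma_N,\ u\in\mathbb Z,\ t\in z_2\mathbb Z\},$$ $$\Gamma_K=\{(x,y,u)\in K: (x,y)\in\mathbb Z(x_0,y_0)+\mathbb Z(x_1,y_1),\ u\in\mathbb Z\}.$$ Let $\widehat{G(p)}$ and $\hat K$ be the quotient manifolds of $G(p)$ and $K$ by the left translations of $\Gamma(p)$ and $\Gamma_K$, and let $S^1=\mathbb R/z_2\mathbb Z$. Let $\hat\eta$ and $\hat\xi$ on $\widehat{G(p)}$ be induced by the left-invariant form $\eta=dz-x\,dy-t\,du$ and the left-invariant vector field $\xi=\partial/\partial z$; let $\widehat{\alpha_K},\widehat{\beta_K},\widehat{\theta_K}$ on $\hat K$ be induced by $\alpha_K=e^{-pu}dx$, $\beta_K=e^{pu}dy$, $\theta_K=du$; and let $\hat\omega$ be the length element of $S^1$, induced by $dt$ on $\mathbb R$. Theorem. (1)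 $G(p)$ and $K$ are solvable, $\widehat{G(p)}$ and $\hat K$ are compact Hausdorff manifolds, and the forms and vector fields above descend to the quotients. (2) $\hat\eta$ is a contact form with Reeb vector field $\hat\xi$, and it is regular: every point of $\widehat{G(p)}$ has a cubical coordinate neighbourhood in which $\hat\xi$ is a coordinate vector field and which each integral curve of $\hat\xi$ crosses at most once. (3) The flow of $\hat\xi$ is a smooth action of $S^1=\mathbb R/z_2\mathbb Z$ on $\widehat{G(p)}$, and the map $\hat\pi:\widehat{G(p)}\to\hat K\times S^1$ induced by $(x,y,z,u,t)\mapsto((x,y,u),t)$ is a smooth principal $S^1$-bundle for this action; the fibres of $\hat\pi$ are exactly the orbits of $\hat\xi$, so that $\hat K\times S^1$ is the orbit space of the Reeb vector field. (4) The two-form $$\hat\Omega=-(\widehat{\alpha_K}\wedge\widehat{\beta_K}+\hat\omega\wedge\widehat{\theta_K})$$ on $\hat K\times S^1$ is symplectic, and it is the unique two-form on $\hat K\times S^1$ with $\hat\pi^*\hat\Omega=d\hat\eta$. -/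

import Mathlib

open scoped Manifold ContDiff Topology

noncomputable section

namespace RegularContact

/-! ## The Lie groups -/

/-- The Heisenberg group `H(1,1)` in its standard coordinates `(x, y, z)`. -/
def Heis : Type := Fin 3 → ℝ

namespace Heis

/-- The matrix with rows `(1, x, z)`, `(0, 1, y)`, `(0, 0, 1)`. -/
def mk (x y z : ℝ) : Heis := ![x, y, z]

/-- Matrix multiplication. -/
instance : Mul Heis := ⟨fun g h => mk (g 0 + h 0) (g 1 + h 1) (g 2 + h 2 + g 0 * h 1)⟩
instance : One Heis := ⟨mk 0 0 0⟩
instance : Inv Heis := ⟨fun g => mk (-g 0) (-g 1) (-g 2 + g 0 * g 1)⟩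

@[simp] theorem mk_0 (x y z : ℝ) : mk x y z 0 = x := rfl
@[simp] theorem mk_1 (x y z : ℝ) : mk x y z 1 = y := rfl
@[simp] theorem mk_2 (x y z : ℝ) : mk x y z 2 = z := rfl

theorem ext' {g h : Heis} (h0 : g 0 = h 0) (h1 : g 1 = h 1) (h2 : g 2 = h 2) : g = h := by
  funext i; fin_cases i <;> assumption

@[simp] theorem mul_0 (g h : Heis) : (g * h) 0 = g 0 + h 0 := rfl
@[simp] theorem mul_1 (g h : Heis) : (g * h) 1 = g 1 + h 1 := rfl
@[simp] theorem mul_2 (g h : Heis) : (g * h) 2 = g 2 + h 2 + g 0 * h 1 := rfl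
@[simp] theorem one_0 : (1 : Heis) 0 = 0 := rfl
@[simp] theorem one_1 : (1 : Heis) 1 = 0 := rfl
@[simp] theorem one_2 : (1 : Heis) 2 = 0 := rfl
@[simp] theorem inv_0 (g : Heis) : (g⁻¹) 0 = -g 0 := rfl
@[simp] theorem inv_1 (g : Heis) : (g⁻¹) 1 = -g 1 := rfl
@[simp] theorem inv_2 (g : Heis) : (g⁻¹) 2 = -g 2 + g 0 * g 1 := rfl

instance : Group Heis :=
  Group.ofLeftAxioms
    (fun a b c => ext' (by simp; ring) (by simp; ring) (by simp; ring))
    (fun a => ext' (by simp) (by simp) (by simp))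
    (fun a => ext' (by simp) (by simp) (by simp))

/-- The automorphism `ψ(u)(x, y, z) = (e^{pu} x, e^{-pu} y, z)` of the Heisenberg group. -/
def psi (p u : ℝ) (h : Heis) : Heis :=
  mk (Real.exp (p * u) * h 0) (Real.exp (-(p * u)) * h 1) (h 2)

end Heis

/-- The five-dimensional Lie group `G(p) = (H(1,1) ⋊_ψ ℝ) ⋊_φ ℝ`, with underlying manifold `ℝ⁵` and
global coordinates `(x, y, z, u, t)`. -/
def G (_p : ℝ) : Type := Fin 5 → ℝ

namespace G

variable {p : ℝ}

instance : TopologicalSpace (G p) := inferInstanceAs (TopologicalSpace (Fin 5 → ℝ))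
instance : T2Space (G p) := inferInstanceAs (T2Space (Fin 5 → ℝ))
instance : LocallyCompactSpace (G p) := inferInstanceAs (LocallyCompactSpace (Fin 5 → ℝ))
instance : ChartedSpace (Fin 5 → ℝ) (G p) := chartedSpaceSelf (Fin 5 → ℝ)
instance : IsManifold 𝓘(ℝ, Fin 5 → ℝ) ∞ (G p) := instIsManifoldModelSpace (E := Fin 5 → ℝ)

/-- The element with coordinates `(x, y, z, u, t)`. -/
def mk (x y z u t : ℝ) : G p := ![x, y, z, u, t]

/-- The product of `G(p)`: `(x,y,z,u,t)(x',y',z',u',t')` is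
`(x + e^{pu}x', y + e^{-pu}y', z + z' + x e^{-pu}y' + t u', u + u', t + t')`. -/
instance : Mul (G p) := ⟨fun g h =>
  mk (g 0 + Real.exp (p * g 3) * h 0)
    (g 1 + Real.exp (-(p * g 3)) * h 1)
    (g 2 + h 2 + g 0 * (Real.exp (-(p * g 3)) * h 1) + g 4 * h 3)
    (g 3 + h 3)
    (g 4 + h 4)⟩
instance : One (G p) := ⟨mk 0 0 0 0 0⟩
instance : Inv (G p) := ⟨fun g =>
  mk (-(Real.exp (-(p * g 3)) * g 0)) (-(Real.exp (p * g 3) * g 1))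
    (-g 2 + g 0 * g 1 + g 4 * g 3) (-g 3) (-g 4)⟩

theorem ext' {g h : G p} (h0 : g 0 = h 0) (h1 : g 1 = h 1) (h2 : g 2 = h 2) (h3 : g 3 = h 3)
    (h4 : g 4 = h 4) : g = h := by
  funext i; fin_cases i <;> assumption

@[simp] theorem mul_0 (g h : G p) : (g * h) 0 = g 0 + Real.exp (p * g 3) * h 0 := rfl
@[simp] theorem mul_1 (g h : G p) : (g * h) 1 = g 1 + Real.exp (-(p * g 3)) * h 1 := rfl
@[simp] theorem mul_2 (g h : G p) :
    (g * h) 2 = g 2 + h 2 + g 0 * (Real.exp (-(p * g 3)) * h 1) + g 4 * h 3 := rfl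
@[simp] theorem mul_3 (g h : G p) : (g * h) 3 = g 3 + h 3 := rfl
@[simp] theorem mul_4 (g h : G p) : (g * h) 4 = g 4 + h 4 := rfl
@[simp] theorem one_0 : (1 : G p) 0 = 0 := rfl
@[simp] theorem one_1 : (1 : G p) 1 = 0 := rfl
@[simp] theorem one_2 : (1 : G p) 2 = 0 := rfl
@[simp] theorem one_3 : (1 : G p) 3 = 0 := rfl
@[simp] theorem one_4 : (1 : G p) 4 = 0 := rfl
@[simp] theorem inv_0 (g : G p) : (g⁻¹) 0 = -(Real.exp (-(p * g 3)) * g 0) := rfl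
@[simp] theorem inv_1 (g : G p) : (g⁻¹) 1 = -(Real.exp (p * g 3) * g 1) := rfl
@[simp] theorem inv_2 (g : G p) : (g⁻¹) 2 = -g 2 + g 0 * g 1 + g 4 * g 3 := rfl
@[simp] theorem inv_3 (g : G p) : (g⁻¹) 3 = -g 3 := rfl
@[simp] theorem inv_4 (g : G p) : (g⁻¹) 4 = -g 4 := rfl

instance : Group (G p) :=
  Group.ofLeftAxioms
    (fun a b c => ext'
      (by simp [mul_add, Real.exp_add]; ring) (by simp [mul_add, Real.exp_add]; ring)
      (by
        have e : Real.exp (-(p * a 3)) * Real.exp (p * a 3) = 1 := by rw [← Real.exp_add]; simp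
        simp [mul_add, Real.exp_add]
        linear_combination (b 0 * Real.exp (-(p * b 3)) * c 1) * e)
      (by simp; ring) (by simp; ring))
    (fun a => ext' (by simp) (by simp) (by simp) (by simp) (by simp))
    (fun a => by
      have e := Real.exp_ne_zero (p * a 3)
      refine ext' ?_ ?_ ?_ ?_ ?_ <;> simp [Real.exp_neg]; field_simp; ring)

theorem contDiff_mul :
    ContDiff (E := (Fin 5 → ℝ) × (Fin 5 → ℝ)) (F := Fin 5 → ℝ) ℝ ∞
      (fun q => @HMul.hMul (G p) (G p) (G p) _ q.1 q.2) := by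
  refine contDiff_pi.2 fun i => ?_
  fin_cases i
  · change ContDiff ℝ ∞ (fun q : (Fin 5 → ℝ) × (Fin 5 → ℝ) =>
      q.1 0 + Real.exp (p * q.1 3) * q.2 0)
    fun_prop
  · change ContDiff ℝ ∞ (fun q : (Fin 5 → ℝ) × (Fin 5 → ℝ) =>
      q.1 1 + Real.exp (-(p * q.1 3)) * q.2 1)
    fun_prop
  · change ContDiff ℝ ∞ (fun q : (Fin 5 → ℝ) × (Fin 5 → ℝ) =>
      q.1 2 + q.2 2 + q.1 0 * (Real.exp (-(p * q.1 3)) * q.2 1) + q.1 4 * q.2 3)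
    fun_prop
  · change ContDiff ℝ ∞ (fun q : (Fin 5 → ℝ) × (Fin 5 → ℝ) => q.1 3 + q.2 3)
    fun_prop
  · change ContDiff ℝ ∞ (fun q : (Fin 5 → ℝ) × (Fin 5 → ℝ) => q.1 4 + q.2 4)
    fun_prop

theorem contDiff_inv :
    ContDiff (E := Fin 5 → ℝ) (F := Fin 5 → ℝ) ℝ ∞ (fun q => @Inv.inv (G p) _ q) := by
  refine contDiff_pi.2 fun i => ?_
  fin_cases i
  · change ContDiff ℝ ∞ (fun q : Fin 5 → ℝ => -(Real.exp (-(p * q 3)) * q 0))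
    fun_prop
  · change ContDiff ℝ ∞ (fun q : Fin 5 → ℝ => -(Real.exp (p * q 3) * q 1))
    fun_prop
  · change ContDiff ℝ ∞ (fun q : Fin 5 → ℝ => -q 2 + q 0 * q 1 + q 4 * q 3)
    fun_prop
  · change ContDiff ℝ ∞ (fun q : Fin 5 → ℝ => -q 3)
    fun_prop
  · change ContDiff ℝ ∞ (fun q : Fin 5 → ℝ => -q 4)
    fun_prop

instance : LieGroup 𝓘(ℝ, Fin 5 → ℝ) ∞ (G p) where
  contMDiff_mul := by
    have h := (contDiff_mul (p := p)).contMDiff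
    rw [modelWithCornersSelf_prod, ← chartedSpaceSelf_prod] at h
    exact h
  contMDiff_inv := (contDiff_inv (p := p)).contMDiff

instance : IsTopologicalGroup (G p) := topologicalGroup_of_lieGroup 𝓘(ℝ, Fin 5 → ℝ) ∞

end G

/-- The three-dimensional Lie group `K = ℝ² ⋊_ζ ℝ`, `ζ(u)(x, y) = (e^{pu}x, e^{-pu}y)`, with
underlying manifold `ℝ³` and global coordinates `(x, y, u)`. -/
def K (_p : ℝ) : Type := Fin 3 → ℝ

namespace K

variable {p : ℝ}

instance : TopologicalSpace (K p) := inferInstanceAs (TopologicalSpace (Fin 3 → ℝ))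
instance : T2Space (K p) := inferInstanceAs (T2Space (Fin 3 → ℝ))
instance : LocallyCompactSpace (K p) := inferInstanceAs (LocallyCompactSpace (Fin 3 → ℝ))
instance : ChartedSpace (Fin 3 → ℝ) (K p) := chartedSpaceSelf (Fin 3 → ℝ)
instance : IsManifold 𝓘(ℝ, Fin 3 → ℝ) ∞ (K p) := instIsManifoldModelSpace (E := Fin 3 → ℝ)

/-- The element with coordinates `(x, y, u)`. -/
def mk (x y u : ℝ) : K p := ![x, y, u]

@[simp] theorem mk_0 (x y u : ℝ) : (mk x y u : K p) 0 = x := rfl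
@[simp] theorem mk_1 (x y u : ℝ) : (mk x y u : K p) 1 = y := rfl
@[simp] theorem mk_2 (x y u : ℝ) : (mk x y u : K p) 2 = u := rfl

/-- The product of `K`: `(x,y,u)(x',y',u') = (x + e^{pu}x', y + e^{-pu}y', u + u')`. -/
instance : Mul (K p) := ⟨fun g h =>
  mk (g 0 + Real.exp (p * g 2) * h 0) (g 1 + Real.exp (-(p * g 2)) * h 1) (g 2 + h 2)⟩
instance : One (K p) := ⟨mk 0 0 0⟩
instance : Inv (K p) := ⟨fun g =>
  mk (-(Real.exp (-(p * g 2)) * g 0)) (-(Real.exp (p * g 2) * g 1)) (-g 2)⟩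

theorem ext' {g h : K p} (h0 : g 0 = h 0) (h1 : g 1 = h 1) (h2 : g 2 = h 2) : g = h := by
  funext i; fin_cases i <;> assumption

@[simp] theorem mul_0 (g h : K p) : (g * h) 0 = g 0 + Real.exp (p * g 2) * h 0 := rfl
@[simp] theorem mul_1 (g h : K p) : (g * h) 1 = g 1 + Real.exp (-(p * g 2)) * h 1 := rfl
@[simp] theorem mul_2 (g h : K p) : (g * h) 2 = g 2 + h 2 := rfl
@[simp] theorem one_0 : (1 : K p) 0 = 0 := rfl
@[simp] theorem one_1 : (1 : K p) 1 = 0 := rfl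
@[simp] theorem one_2 : (1 : K p) 2 = 0 := rfl
@[simp] theorem inv_0 (g : K p) : (g⁻¹) 0 = -(Real.exp (-(p * g 2)) * g 0) := rfl
@[simp] theorem inv_1 (g : K p) : (g⁻¹) 1 = -(Real.exp (p * g 2) * g 1) := rfl
@[simp] theorem inv_2 (g : K p) : (g⁻¹) 2 = -g 2 := rfl

instance : Group (K p) :=
  Group.ofLeftAxioms
    (fun a b c => ext'
      (by simp [mul_add, Real.exp_add]; ring) (by simp [mul_add, Real.exp_add]; ring)
      (by simp; ring))
    (fun a => ext' (by simp) (by simp) (by simp))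
    (fun a => by
      refine ext' ?_ ?_ ?_ <;> simp)

theorem contDiff_mul :
    ContDiff (E := (Fin 3 → ℝ) × (Fin 3 → ℝ)) (F := Fin 3 → ℝ) ℝ ∞
      (fun q => @HMul.hMul (K p) (K p) (K p) _ q.1 q.2) := by
  refine contDiff_pi.2 fun i => ?_
  fin_cases i
  · change ContDiff ℝ ∞ (fun q : (Fin 3 → ℝ) × (Fin 3 → ℝ) =>
      q.1 0 + Real.exp (p * q.1 2) * q.2 0)
    fun_prop
  · change ContDiff ℝ ∞ (fun q : (Fin 3 → ℝ) × (Fin 3 → ℝ) =>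
      q.1 1 + Real.exp (-(p * q.1 2)) * q.2 1)
    fun_prop
  · change ContDiff ℝ ∞ (fun q : (Fin 3 → ℝ) × (Fin 3 → ℝ) => q.1 2 + q.2 2)
    fun_prop

theorem contDiff_inv :
    ContDiff (E := Fin 3 → ℝ) (F := Fin 3 → ℝ) ℝ ∞ (fun q => @Inv.inv (K p) _ q) := by
  refine contDiff_pi.2 fun i => ?_
  fin_cases i
  · change ContDiff ℝ ∞ (fun q : Fin 3 → ℝ => -(Real.exp (-(p * q 2)) * q 0))
    fun_prop
  · change ContDiff ℝ ∞ (fun q : Fin 3 → ℝ => -(Real.exp (p * q 2) * q 1))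
    fun_prop
  · change ContDiff ℝ ∞ (fun q : Fin 3 → ℝ => -q 2)
    fun_prop

instance : LieGroup 𝓘(ℝ, Fin 3 → ℝ) ∞ (K p) where
  contMDiff_mul := by
    have h := (contDiff_mul (p := p)).contMDiff
    rw [modelWithCornersSelf_prod, ← chartedSpaceSelf_prod] at h
    exact h
  contMDiff_inv := (contDiff_inv (p := p)).contMDiff

instance : IsTopologicalGroup (K p) := topologicalGroup_of_lieGroup 𝓘(ℝ, Fin 3 → ℝ) ∞

end K

/-! ## The lattices -/

namespace Heis

theorem zpow_0 (h : Heis) (n : ℤ) : (h ^ n) 0 = n * h 0 := by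
  induction n using Int.induction_on with
  | zero => simp
  | succ k ih => rw [zpow_add_one, mul_0, ih]; push_cast; ring
  | pred k ih => rw [zpow_sub_one, mul_0, ih]; push_cast; simp; ring

theorem zpow_1 (h : Heis) (n : ℤ) : (h ^ n) 1 = n * h 1 := by
  induction n using Int.induction_on with
  | zero => simp
  | succ k ih => rw [zpow_add_one, mul_1, ih]; push_cast; ring
  | pred k ih => rw [zpow_sub_one, mul_1, ih]; push_cast; simp; ring

theorem zpow_2 (h : Heis) (n : ℤ) : (h ^ n) 2 = n * h 2 + (n * (n - 1) / 2) * (h 0 * h 1) := by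
  induction n using Int.induction_on with
  | zero => simp
  | succ k ih => rw [zpow_add_one, mul_2, ih, zpow_0]; push_cast; ring
  | pred k ih => rw [zpow_sub_one, mul_2, ih, zpow_0]; push_cast; simp; ring

@[simp] theorem psi_0 (p u : ℝ) (h : Heis) : psi p u h 0 = Real.exp (p * u) * h 0 := rfl
@[simp] theorem psi_1 (p u : ℝ) (h : Heis) : psi p u h 1 = Real.exp (-(p * u)) * h 1 := rfl
@[simp] theorem psi_2 (p u : ℝ) (h : Heis) : psi p u h 2 = h 2 := rfl

theorem psi_mul (p u : ℝ) (g h : Heis) : psi p u (g * h) = psi p u g * psi p u h := by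
  have e : Real.exp (p * u) * Real.exp (-(p * u)) = 1 := by rw [← Real.exp_add]; simp
  refine ext' ?_ ?_ ?_ <;> simp
  · ring
  · ring
  · linear_combination (-(g 0 * h 1)) * e

theorem psi_add (p u v : ℝ) (h : Heis) : psi p (u + v) h = psi p u (psi p v h) := by
  refine ext' ?_ ?_ ?_ <;> simp [mul_add, Real.exp_add] <;> ring

theorem psi_zero (p : ℝ) (h : Heis) : psi p 0 h = h := by
  refine ext' ?_ ?_ ?_ <;> simp

end Heis

/-- The data on which the lattices of `K` and of `K × ℝ` depend: a number `p ≠ 0`, a unimodular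
integer matrix `N` with eigenvalues `e^p`, `e^{-p}`, and eigenvectors `x = (x₀, x₁)` for `e^p`,
`y = (y₀, y₁)` for `e^{-p}`. -/
structure EigenData where
  p : ℝ
  p_ne_zero : p ≠ 0
  N : Matrix.SpecialLinearGroup (Fin 2) ℤ
  x : Fin 2 → ℝ
  y : Fin 2 → ℝ
  x_ne_zero : x ≠ 0
  y_ne_zero : y ≠ 0
  eigen_x : (N.1.map (Int.cast : ℤ → ℝ)).mulVec x = Real.exp p • x
  eigen_y : (N.1.map (Int.cast : ℤ → ℝ)).mulVec y = Real.exp (-p) • y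

namespace EigenData

variable (D : EigenData)

/-- The number `z₂ = x₁ y₀ - x₀ y₁`. -/
def z₂ : ℝ := D.x 1 * D.y 0 - D.x 0 * D.y 1

theorem eigen_x' (i : Fin 2) :
    D.N.1 i 0 * D.x 0 + D.N.1 i 1 * D.x 1 = Real.exp D.p * D.x i := by
  have h := congrFun D.eigen_x i
  simpa [Matrix.mulVec, dotProduct, Fin.sum_univ_two] using h

theorem eigen_y' (i : Fin 2) :
    D.N.1 i 0 * D.y 0 + D.N.1 i 1 * D.y 1 = Real.exp (-D.p) * D.y i := by
  have h := congrFun D.eigen_y i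
  simpa [Matrix.mulVec, dotProduct, Fin.sum_univ_two] using h

theorem det_eq : (D.N.1 0 0 : ℝ) * D.N.1 1 1 - D.N.1 0 1 * D.N.1 1 0 = 1 := by
  have h := D.N.2
  rw [Matrix.det_fin_two] at h
  exact_mod_cast h

theorem z₂_ne_zero : D.z₂ ≠ 0 := by
  intro h
  unfold z₂ at h
  have hne : Real.exp D.p - Real.exp (-D.p) ≠ 0 := by
    intro h'
    have h2 := Real.exp_injective (sub_eq_zero.1 h')
    exact D.p_ne_zero (by linarith)
  have a0 : D.x 0 * D.y 0 = 0 := by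
    have : (Real.exp D.p - Real.exp (-D.p)) * (D.x 0 * D.y 0) = 0 := by
      linear_combination (-D.y 0) * D.eigen_x' 0 + D.x 0 * D.eigen_y' 0 + D.N.1 0 1 * h
    exact (mul_eq_zero.1 this).resolve_left hne
  have a1 : D.x 1 * D.y 1 = 0 := by
    have : (Real.exp D.p - Real.exp (-D.p)) * (D.x 1 * D.y 1) = 0 := by
      linear_combination (-D.y 1) * D.eigen_x' 1 + D.x 1 * D.eigen_y' 1 - D.N.1 1 0 * h
    exact (mul_eq_zero.1 this).resolve_left hne
  have hx : ¬ (D.x 0 = 0 ∧ D.x 1 = 0) := fun hh => D.x_ne_zero (by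
    funext i; fin_cases i
    · exact hh.1
    · exact hh.2)
  have hy : ¬ (D.y 0 = 0 ∧ D.y 1 = 0) := fun hh => D.y_ne_zero (by
    funext i; fin_cases i
    · exact hh.1
    · exact hh.2)
  rcases mul_eq_zero.1 a0 with h0 | h0 <;> rcases mul_eq_zero.1 a1 with h1 | h1 <;>
    simp_all

/-- Membership in the lattice `Γ_{ℝ²}` of `ℝ²` generated by `(x₀, y₀)` and `(x₁, y₁)`. -/
def InPlaneLattice (a b : ℝ) : Prop :=
  ∃ m₀ m₁ : ℤ, a = m₀ * D.x 0 + m₁ * D.x 1 ∧ b = m₀ * D.y 0 + m₁ * D.y 1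

variable {D}

theorem InPlaneLattice.add {a b a' b' : ℝ} (h : D.InPlaneLattice a b)
    (h' : D.InPlaneLattice a' b') : D.InPlaneLattice (a + a') (b + b') := by
  obtain ⟨m₀, m₁, rfl, rfl⟩ := h
  obtain ⟨n₀, n₁, rfl, rfl⟩ := h'
  exact ⟨m₀ + n₀, m₁ + n₁, by push_cast; ring, by push_cast; ring⟩

theorem InPlaneLattice.neg {a b : ℝ} (h : D.InPlaneLattice a b) :
    D.InPlaneLattice (-a) (-b) := by
  obtain ⟨m₀, m₁, rfl, rfl⟩ := h
  exact ⟨-m₀, -m₁, by push_cast; ring, by push_cast; ring⟩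

theorem InPlaneLattice.step {a b : ℝ} (h : D.InPlaneLattice a b) :
    D.InPlaneLattice (Real.exp D.p * a) (Real.exp (-D.p) * b) := by
  obtain ⟨m₀, m₁, rfl, rfl⟩ := h
  refine ⟨m₀ * D.N.1 0 0 + m₁ * D.N.1 1 0, m₀ * D.N.1 0 1 + m₁ * D.N.1 1 1, ?_, ?_⟩ <;> push_cast
  · linear_combination -(m₀ : ℝ) * D.eigen_x' 0 - m₁ * D.eigen_x' 1
  · linear_combination -(m₀ : ℝ) * D.eigen_y' 0 - m₁ * D.eigen_y' 1

theorem InPlaneLattice.step_symm {a b : ℝ} (h : D.InPlaneLattice a b) :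
    D.InPlaneLattice (Real.exp (-D.p) * a) (Real.exp D.p * b) := by
  have e : Real.exp (-D.p) * Real.exp D.p = 1 := by rw [← Real.exp_add]; simp
  obtain ⟨m₀, m₁, rfl, rfl⟩ := h
  have hd := D.det_eq
  have hx0 := D.eigen_x' 0
  have hx1 := D.eigen_x' 1
  have hy0 := D.eigen_y' 0
  have hy1 := D.eigen_y' 1
  have kx0 : Real.exp (-D.p) * D.x 0 = D.N.1 1 1 * D.x 0 - D.N.1 0 1 * D.x 1 := by
    linear_combination (-Real.exp (-D.p) * D.x 0) * hd + Real.exp (-D.p) * D.N.1 1 1 * hx0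
      - Real.exp (-D.p) * D.N.1 0 1 * hx1 + (D.N.1 1 1 * D.x 0 - D.N.1 0 1 * D.x 1) * e
  have kx1 : Real.exp (-D.p) * D.x 1 = -D.N.1 1 0 * D.x 0 + D.N.1 0 0 * D.x 1 := by
    linear_combination (-Real.exp (-D.p) * D.x 1) * hd - Real.exp (-D.p) * D.N.1 1 0 * hx0
      + Real.exp (-D.p) * D.N.1 0 0 * hx1 + (-D.N.1 1 0 * D.x 0 + D.N.1 0 0 * D.x 1) * e
  have ky0 : Real.exp D.p * D.y 0 = D.N.1 1 1 * D.y 0 - D.N.1 0 1 * D.y 1 := by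
    linear_combination (-Real.exp D.p * D.y 0) * hd + Real.exp D.p * D.N.1 1 1 * hy0
      - Real.exp D.p * D.N.1 0 1 * hy1 + (D.N.1 1 1 * D.y 0 - D.N.1 0 1 * D.y 1) * e
  have ky1 : Real.exp D.p * D.y 1 = -D.N.1 1 0 * D.y 0 + D.N.1 0 0 * D.y 1 := by
    linear_combination (-Real.exp D.p * D.y 1) * hd - Real.exp D.p * D.N.1 1 0 * hy0
      + Real.exp D.p * D.N.1 0 0 * hy1 + (-D.N.1 1 0 * D.y 0 + D.N.1 0 0 * D.y 1) * e
  refine ⟨m₀ * D.N.1 1 1 - m₁ * D.N.1 1 0, -m₀ * D.N.1 0 1 + m₁ * D.N.1 0 0, ?_, ?_⟩ <;>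
    push_cast
  · linear_combination (m₀ : ℝ) * kx0 + m₁ * kx1
  · linear_combination (m₀ : ℝ) * ky0 + m₁ * ky1

theorem InPlaneLattice.flow {a b : ℝ} (h : D.InPlaneLattice a b) (n : ℤ) :
    D.InPlaneLattice (Real.exp (D.p * n) * a) (Real.exp (-(D.p * n)) * b) := by
  induction n using Int.induction_on with
  | zero => simpa using h
  | succ k ih =>
    have := ih.step
    rw [← mul_assoc, ← mul_assoc, ← Real.exp_add, ← Real.exp_add] at this
    convert this using 3 <;> push_cast <;> ring
  | pred k ih =>
    have := ih.step_symm
    rw [← mul_assoc, ← mul_assoc, ← Real.exp_add, ← Real.exp_add] at this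
    convert this using 3 <;> push_cast <;> ring

variable (D)

/-- The subgroup `Γ_K = Γ_{ℝ²} ⋊_ζ ℤ` of `K`. -/
def ΓK : Subgroup (K D.p) where
  carrier := {g | D.InPlaneLattice (g 0) (g 1) ∧ ∃ n : ℤ, g 2 = n}
  one_mem' := ⟨⟨0, 0, by simp, by simp⟩, 0, by simp⟩
  mul_mem' := by
    rintro g h ⟨hg, n, hn⟩ ⟨hh, m, hm⟩
    refine ⟨?_, n + m, by simp [hn, hm]⟩
    simpa [hn] using hg.add (hh.flow n)
  inv_mem' := by
    rintro g ⟨hg, n, hn⟩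
    refine ⟨?_, -n, by simp [hn]⟩
    simpa [hn] using (hg.flow (-n)).neg

theorem abs_int_mul_lt {m : ℤ} {c : ℝ} (h : |m * c| < |c|) : m = 0 := by
  by_contra hm
  have h1 : (1 : ℝ) ≤ |(m : ℝ)| := by exact_mod_cast Int.one_le_abs hm
  rw [abs_mul] at h
  nlinarith [abs_nonneg c]

theorem lattice_eq_zero {a b : ℝ} {m₀ m₁ : ℤ} (ha : a = m₀ * D.x 0 + m₁ * D.x 1)
    (hb : b = m₀ * D.y 0 + m₁ * D.y 1) (h0 : |D.x 1 * b - D.y 1 * a| < |D.z₂|)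
    (h1 : |D.y 0 * a - D.x 0 * b| < |D.z₂|) : m₀ = 0 ∧ m₁ = 0 := by
  have e0 : D.x 1 * b - D.y 1 * a = m₀ * D.z₂ := by rw [ha, hb, z₂]; ring
  have e1 : D.y 0 * a - D.x 0 * b = m₁ * D.z₂ := by rw [ha, hb, z₂]; ring
  rw [e0] at h0
  rw [e1] at h1
  exact ⟨abs_int_mul_lt h0, abs_int_mul_lt h1⟩

instance discreteTopology_ΓK : DiscreteTopology D.ΓK := by
  refine discreteTopology_of_isOpen_singleton_one ?_
  let U : Set (Fin 3 → ℝ) := {g | |D.x 1 * g 1 - D.y 1 * g 0| < |D.z₂| ∧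
    |D.y 0 * g 0 - D.x 0 * g 1| < |D.z₂| ∧ |g 2| < 1}
  have hU : IsOpen U := by
    simp only [U, Set.ofPred_and]
    refine IsOpen.inter ?_ <| IsOpen.inter ?_ ?_ <;>
      exact isOpen_lt (by fun_prop) (by fun_prop)
  have hU' : IsOpen (X := K D.p) U := hU
  have hz := abs_pos.2 D.z₂_ne_zero
  convert hU'.preimage (continuous_subtype_val (p := fun g => g ∈ D.ΓK)) using 1
  ext ⟨g, hg⟩
  simp only [Set.mem_singleton_iff]
  constructor
  · intro h
    have h' : g = 1 := congrArg Subtype.val h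
    subst h'
    refine ⟨?_, ?_, ?_⟩ <;> simp [hz]
  · rintro ⟨h0, h1, h2⟩
    obtain ⟨⟨m₀, m₁, ha, hb⟩, n, hn⟩ := hg
    obtain ⟨rfl, rfl⟩ := D.lattice_eq_zero ha hb h0 h1
    have hn0 : n = 0 := abs_int_mul_lt (c := 1) (by simpa [hn] using h2)
    subst hn0
    exact Subtype.ext (K.ext' (by simp [ha]) (by simp [hb]) (by simp [hn]))

end EigenData

/-- In addition to `EigenData`, a choice of the numbers `z₀, z₁`: with
`h₀ = (x₀, y₀, z₀)`, `h₁ = (x₁, y₁, z₁)` and `h₂ = (0, 0, z₂)` in the Heisenberg group one requires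
`ψ(1)(hᵢ) = h₀^{n_{i0}} h₁^{n_{i1}} h₂^r` for some integer `r` depending on `i`. Such `z₀, z₁` always
exist, see `EigenData.exists_latticeData`. -/
structure LatticeData extends EigenData where
  z : Fin 2 → ℝ
  psi_one : ∀ i : Fin 2, ∃ r : ℤ, Heis.psi p 1 (Heis.mk (x i) (y i) (z i)) =
    Heis.mk (x 0) (y 0) (z 0) ^ N.1 i 0 * Heis.mk (x 1) (y 1) (z 1) ^ N.1 i 1 *
      Heis.mk 0 0 toEigenData.z₂ ^ r

theorem EigenData.exists_latticeData (D : EigenData) : ∃ L : LatticeData, L.toEigenData = D := by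
  set a : ℝ := ((D.N.1 0 0 : ℤ) : ℝ) with ha
  set b : ℝ := ((D.N.1 0 1 : ℤ) : ℝ) with hb
  set c : ℝ := ((D.N.1 1 0 : ℤ) : ℝ) with hc
  set d : ℝ := ((D.N.1 1 1 : ℤ) : ℝ) with hd
  have hdet : a * d - b * c = 1 := D.det_eq
  have e : Real.exp (-D.p) * Real.exp D.p = 1 := by rw [← Real.exp_add]; simp
  have htr : (1 - a) * (1 - d) - b * c ≠ 0 := by
    intro h
    -- the number 1 would be an eigenvalue, hence a root of the characteristic polynomial
    have hchar : ∀ i, (Real.exp D.p ^ 2 - (a + d) * Real.exp D.p + 1) * D.x i = 0 := by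
      have h0 : a * D.x 0 + b * D.x 1 = Real.exp D.p * D.x 0 := D.eigen_x' 0
      have h1 : c * D.x 0 + d * D.x 1 = Real.exp D.p * D.x 1 := D.eigen_x' 1
      intro i
      fin_cases i
      · change (Real.exp D.p ^ 2 - (a + d) * Real.exp D.p + 1) * D.x 0 = 0
        linear_combination (d - Real.exp D.p) * h0 - b * h1 - D.x 0 * hdet
      · change (Real.exp D.p ^ 2 - (a + d) * Real.exp D.p + 1) * D.x 1 = 0
        linear_combination (a - Real.exp D.p) * h1 - c * h0 - D.x 1 * hdet
    have hquad : Real.exp D.p ^ 2 - (a + d) * Real.exp D.p + 1 = 0 := by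
      by_contra hne
      exact D.x_ne_zero (funext fun i => (mul_eq_zero.1 (hchar i)).resolve_left hne)
    have hsq : (Real.exp D.p - 1) ^ 2 = 0 := by
      linear_combination hquad + Real.exp D.p * (hdet - h)
    have h1 : Real.exp D.p = 1 := by
      have := pow_eq_zero_iff (two_ne_zero) |>.1 hsq
      linarith
    exact D.p_ne_zero (Real.exp_eq_one_iff _ |>.1 h1)
  let f : Fin 2 → ℝ := fun i => (D.N.1 i 0 * (D.N.1 i 0 - 1) / 2) * (D.x 0 * D.y 0) +
    (D.N.1 i 1 * (D.N.1 i 1 - 1) / 2) * (D.x 1 * D.y 1) +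
    (D.N.1 i 0 * D.x 0) * (D.N.1 i 1 * D.y 1)
  set δ : ℝ := (1 - a) * (1 - d) - b * c with hδ
  let w : Fin 2 → ℝ := ![((1 - d) * f 0 + b * f 1) / δ, (c * f 0 + (1 - a) * f 1) / δ]
  have hw : ∀ i, w i = D.N.1 i 0 * w 0 + D.N.1 i 1 * w 1 + f i := by
    intro i
    fin_cases i
    · change w 0 = a * w 0 + b * w 1 + f 0
      simp only [w, Matrix.cons_val_zero, Matrix.cons_val_one]
      field_simp
      rw [hδ]
      ring
    · change w 1 = c * w 0 + d * w 1 + f 1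
      simp only [w, Matrix.cons_val_zero, Matrix.cons_val_one]
      field_simp
      rw [hδ]
      ring
  refine ⟨⟨D, w, fun i => ⟨0, Heis.ext' ?_ ?_ ?_⟩⟩, rfl⟩
  · have := D.eigen_x' i
    simp [Heis.zpow_0, this]
  · have := D.eigen_y' i
    simp [Heis.zpow_1, this]
  · have := hw i
    simp [Heis.zpow_0, Heis.zpow_1, Heis.zpow_2]
    rw [this]
    simp only [f]
    ring

namespace LatticeData

variable (L : LatticeData)

def h₀ : Heis := .mk (L.x 0) (L.y 0) (L.z 0)
def h₁ : Heis := .mk (L.x 1) (L.y 1) (L.z 1)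
def h₂ : Heis := .mk 0 0 L.z₂

/-- The subgroup `Γ_N` of the Heisenberg group generated by `h₀` and `h₁`. -/
def ΓN : Subgroup Heis := Subgroup.closure {L.h₀, L.h₁}

theorem h₂_mem : L.h₂ ∈ L.ΓN := by
  have h0 : L.h₀ ∈ L.ΓN := Subgroup.subset_closure (by simp)
  have h1 : L.h₁ ∈ L.ΓN := Subgroup.subset_closure (by simp)
  have : L.h₂ = L.h₁ * L.h₀ * L.h₁⁻¹ * L.h₀⁻¹ := by
    refine Heis.ext' ?_ ?_ ?_ <;> simp [h₀, h₁, h₂, EigenData.z₂]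
    ring
  rw [this]
  exact mul_mem (mul_mem (mul_mem h1 h0) (inv_mem h1)) (inv_mem h0)

theorem mem_ΓN_iff (h : Heis) :
    h ∈ L.ΓN ↔ ∃ m₀ m₁ m₂ : ℤ, h = L.h₀ ^ m₀ * L.h₁ ^ m₁ * L.h₂ ^ m₂ := by
  constructor
  · intro hh
    induction hh using Subgroup.closure_induction with
    | mem g hg =>
      rcases hg with rfl | rfl
      · exact ⟨1, 0, 0, by simp⟩
      · exact ⟨0, 1, 0, by simp⟩
    | one => exact ⟨0, 0, 0, by simp⟩
    | mul g g' _ _ ih ih' =>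
      obtain ⟨m₀, m₁, m₂, rfl⟩ := ih
      obtain ⟨n₀, n₁, n₂, rfl⟩ := ih'
      refine ⟨m₀ + n₀, m₁ + n₁, m₂ + n₂ + m₁ * n₀, Heis.ext' ?_ ?_ ?_⟩ <;>
        simp [Heis.zpow_0, Heis.zpow_1, Heis.zpow_2, h₀, h₁, h₂, EigenData.z₂] <;> ring
    | inv g _ ih =>
      obtain ⟨m₀, m₁, m₂, rfl⟩ := ih
      refine ⟨-m₀, -m₁, -m₂ + m₀ * m₁, Heis.ext' ?_ ?_ ?_⟩ <;>
        simp [Heis.zpow_0, Heis.zpow_1, Heis.zpow_2, h₀, h₁, h₂, EigenData.z₂] <;> ring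
  · rintro ⟨m₀, m₁, m₂, rfl⟩
    exact mul_mem (mul_mem (zpow_mem (Subgroup.subset_closure (by simp)) _)
      (zpow_mem (Subgroup.subset_closure (by simp)) _)) (zpow_mem L.h₂_mem _)

theorem mem_plane {h : Heis} (hh : h ∈ L.ΓN) : L.InPlaneLattice (h 0) (h 1) := by
  obtain ⟨m₀, m₁, m₂, rfl⟩ := (L.mem_ΓN_iff h).1 hh
  exact ⟨m₀, m₁, by simp [Heis.zpow_0, h₀, h₁, h₂], by simp [Heis.zpow_1, h₀, h₁, h₂]⟩

theorem psi_h₂ (u : ℝ) (k : ℤ) : Heis.psi L.p u (L.h₂ ^ k) = L.h₂ ^ k := by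
  refine Heis.ext' ?_ ?_ ?_ <;> simp [Heis.zpow_0, Heis.zpow_1, h₂]

theorem psi_step {h : Heis} (hh : h ∈ L.ΓN) : Heis.psi L.p 1 h ∈ L.ΓN := by
  have key : ∀ i : Fin 2, Heis.psi L.p 1 (Heis.mk (L.x i) (L.y i) (L.z i)) ∈ L.ΓN := by
    intro i
    obtain ⟨r, hr⟩ := L.psi_one i
    exact (L.mem_ΓN_iff _).2 ⟨_, _, r, hr⟩
  let φ : Heis →* Heis := MonoidHom.mk' (Heis.psi L.p 1) (Heis.psi_mul L.p 1)
  have : L.ΓN ≤ L.ΓN.comap φ := by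
    refine (Subgroup.closure_le _).2 ?_
    rintro g (rfl | rfl)
    · exact key 0
    · exact key 1
  exact this hh

/-- Two elements of `Γ_N` with the same `(x, y)` differ by a power of `h₂`. -/
theorem eq_mul_h₂ {g h : Heis} (hg : g ∈ L.ΓN) (hh : h ∈ L.ΓN) (e0 : g 0 = h 0)
    (e1 : g 1 = h 1) : ∃ k : ℤ, g = h * L.h₂ ^ k := by
  obtain ⟨m₀, m₁, m₂, hk⟩ := (L.mem_ΓN_iff _).1 (mul_mem (inv_mem hh) hg)
  have a0 : (h⁻¹ * g) 0 = m₀ * L.x 0 + m₁ * L.x 1 := by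
    rw [hk]; simp [Heis.zpow_0, h₀, h₁, h₂]
  have a1 : (h⁻¹ * g) 1 = m₀ * L.y 0 + m₁ * L.y 1 := by
    rw [hk]; simp [Heis.zpow_1, h₀, h₁, h₂]
  have z0 : (h⁻¹ * g) 0 = 0 := by simp [e0]
  have z1 : (h⁻¹ * g) 1 = 0 := by simp [e1]
  have hz := abs_pos.2 L.z₂_ne_zero
  obtain ⟨rfl, rfl⟩ := L.lattice_eq_zero a0 a1 (by rw [z0, z1]; simpa using hz)
    (by rw [z0, z1]; simpa using hz)
  refine ⟨m₂, ?_⟩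
  have : h⁻¹ * g = L.h₂ ^ m₂ := by simpa using hk
  rw [← this]; group

theorem psi_step_symm {h : Heis} (hh : h ∈ L.ΓN) : Heis.psi L.p (-1) h ∈ L.ΓN := by
  obtain ⟨m₀, m₁, h0, h1⟩ := (L.mem_plane hh).step_symm
  let g : Heis := L.h₀ ^ m₀ * L.h₁ ^ m₁
  have hg : g ∈ L.ΓN := (L.mem_ΓN_iff _).2 ⟨m₀, m₁, 0, by simp [g]⟩
  have e : Real.exp L.p * Real.exp (-L.p) = 1 := by rw [← Real.exp_add]; simp
  have g0 : g 0 = Real.exp (-L.p) * h 0 := by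
    rw [h0]; simp [g, Heis.zpow_0, h₀, h₁]
  have g1 : g 1 = Real.exp L.p * h 1 := by
    rw [h1]; simp [g, Heis.zpow_1, h₀, h₁]
  obtain ⟨k, hk⟩ := L.eq_mul_h₂ hh (L.psi_step hg)
    (by simp [g0, ← mul_assoc, e])
    (by rw [Heis.psi_1, g1, mul_one, ← mul_assoc, mul_comm (Real.exp _), e, one_mul])
  have : Heis.psi L.p (-1) h = g * L.h₂ ^ k := by
    rw [hk, Heis.psi_mul, psi_h₂, ← Heis.psi_add]
    simp [Heis.psi_zero]
  rw [this]
  exact mul_mem hg (zpow_mem L.h₂_mem _)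

theorem psi_int {h : Heis} (hh : h ∈ L.ΓN) (n : ℤ) : Heis.psi L.p n h ∈ L.ΓN := by
  induction n using Int.induction_on with
  | zero => simpa [Heis.psi_zero] using hh
  | succ k ih =>
    have := L.psi_step ih
    rw [← Heis.psi_add] at this
    convert this using 2; push_cast; ring
  | pred k ih =>
    have := L.psi_step_symm ih
    rw [← Heis.psi_add] at this
    convert this using 2; push_cast; ring

/-- The subgroup `Γ(p) = (Γ_N ⋊_ψ ℤ) ⋊_φ z₂ℤ` of `G(p)`. -/
def Γ : Subgroup (G L.p) where
  carrier := {g | Heis.mk (g 0) (g 1) (g 2) ∈ L.ΓN ∧ (∃ n : ℤ, g 3 = n) ∧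
    ∃ k : ℤ, g 4 = k * L.z₂}
  one_mem' := by
    refine ⟨?_, ⟨0, by simp⟩, 0, by simp⟩
    exact one_mem L.ΓN
  mul_mem' := by
    rintro g h ⟨hg, ⟨n, hn⟩, k, hk⟩ ⟨hh, ⟨m, hm⟩, l, hl⟩
    refine ⟨?_, ⟨n + m, by simp [hn, hm]⟩, k + l, by simp [hk, hl]; ring⟩
    have : Heis.mk ((g * h) 0) ((g * h) 1) ((g * h) 2) =
        Heis.mk (g 0) (g 1) (g 2) * Heis.psi L.p n (Heis.mk (h 0) (h 1) (h 2)) *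
          L.h₂ ^ (k * m) := by
      refine Heis.ext' ?_ ?_ ?_ <;>
        simp [Heis.zpow_0, Heis.zpow_1, Heis.zpow_2, h₂, hn, hm, hk]
      ring
    rw [this]
    exact mul_mem (mul_mem hg (L.psi_int hh n)) (zpow_mem L.h₂_mem _)
  inv_mem' := by
    rintro g ⟨hg, ⟨n, hn⟩, k, hk⟩
    refine ⟨?_, ⟨-n, by simp [hn]⟩, -k, by simp [hk]⟩
    have : Heis.mk (g⁻¹ 0) (g⁻¹ 1) (g⁻¹ 2) =
        Heis.psi L.p (-n : ℤ) (Heis.mk (g 0) (g 1) (g 2))⁻¹ * L.h₂ ^ (k * n) := by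
      refine Heis.ext' ?_ ?_ ?_ <;>
        simp [Heis.zpow_0, Heis.zpow_1, Heis.zpow_2, h₂, hn, hk]
      ring
    rw [this]
    exact mul_mem (L.psi_int (inv_mem hg) _) (zpow_mem L.h₂_mem _)

instance discreteTopology_Γ : DiscreteTopology L.Γ := by
  refine discreteTopology_of_isOpen_singleton_one ?_
  let U : Set (Fin 5 → ℝ) := {g | |L.x 1 * g 1 - L.y 1 * g 0| < |L.z₂| ∧
    |L.y 0 * g 0 - L.x 0 * g 1| < |L.z₂| ∧ |g 2| < |L.z₂| ∧ |g 3| < 1 ∧ |g 4| < |L.z₂|}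
  have hU : IsOpen U := by
    simp only [U, Set.ofPred_and]
    refine IsOpen.inter ?_ <| IsOpen.inter ?_ <| IsOpen.inter ?_ <| IsOpen.inter ?_ ?_ <;>
      exact isOpen_lt (by fun_prop) (by fun_prop)
  have hU' : IsOpen (X := G L.p) U := hU
  have hz := abs_pos.2 L.z₂_ne_zero
  convert hU'.preimage (continuous_subtype_val (p := fun g => g ∈ L.Γ)) using 1
  ext ⟨g, hg⟩
  simp only [Set.mem_singleton_iff]
  constructor
  · intro h
    have h' : g = 1 := congrArg Subtype.val h
    subst h'
    refine ⟨?_, ?_, ?_, ?_, ?_⟩ <;> simp [hz]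
  · rintro ⟨h0, h1, h2, h3, h4⟩
    obtain ⟨hN, ⟨n, hn⟩, k, hk⟩ := hg
    obtain ⟨m₀, m₁, m₂, hm⟩ := (L.mem_ΓN_iff _).1 hN
    have ha : g 0 = m₀ * L.x 0 + m₁ * L.x 1 := by
      have := congrFun hm 0
      simpa [Heis.zpow_0, LatticeData.h₀, LatticeData.h₁, LatticeData.h₂] using this
    have hb : g 1 = m₀ * L.y 0 + m₁ * L.y 1 := by
      have := congrFun hm 1
      simpa [Heis.zpow_1, LatticeData.h₀, LatticeData.h₁, LatticeData.h₂] using this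
    obtain ⟨rfl, rfl⟩ := L.lattice_eq_zero ha hb h0 h1
    have hc : g 2 = m₂ * L.z₂ := by
      have := congrFun hm 2
      simpa [Heis.zpow_2, LatticeData.h₂] using this
    have hm0 : m₂ = 0 := EigenData.abs_int_mul_lt (by simpa [hc] using h2)
    have hn0 : n = 0 := EigenData.abs_int_mul_lt (c := 1) (by simpa [hn] using h3)
    have hk0 : k = 0 := EigenData.abs_int_mul_lt (by simpa [hk] using h4)
    subst hm0 hn0 hk0
    exact Subtype.ext (G.ext' (by simp [ha]) (by simp [hb]) (by simp [hc]) (by simp [hn])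
      (by simp [hk]))

end LatticeData

/-! ## Quotient manifolds -/

section Quotient

variable {E X Y : Type*} [NormedAddCommGroup E] [NormedSpace ℝ E] [TopologicalSpace X]
  [ChartedSpace E X] [TopologicalSpace Y]

/-- The charts of the image of a local homeomorphism are compatible as soon as any two points of
a fibre are related by a smooth map over the base. -/
theorem isManifold_of_isLocalHomeomorph [IsManifold 𝓘(ℝ, E) ∞ X] {f : X → Y} (hf : IsLocalHomeomorph f)
    (hs : Function.Surjective f)
    (deck : ∀ a b, f a = f b → ∃ ψ : X → X, ContMDiff 𝓘(ℝ, E) 𝓘(ℝ, E) ∞ ψ ∧ ψ a = b ∧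
      ∀ c, f (ψ c) = f c) :
    @IsManifold ℝ _ E _ _ E _ 𝓘(ℝ, E) ∞ Y _ (hf.chartedSpace hs) := by
  let _ : ChartedSpace E Y := hf.chartedSpace hs
  refine isManifold_of_contDiffOn 𝓘(ℝ, E) ∞ Y ?_
  rintro _ _ ⟨q, rfl⟩ ⟨q', rfl⟩
  set g := hs.hasRightInverse.choose q
  set g' := hs.hasRightInverse.choose q'
  set s := hf.localInverseAt g with hsdef
  set s' := hf.localInverseAt g' with hsdef'
  have hsym : ∀ a, s.symm a = f a := fun a => congrFun (hf.localInverseAt_symm _) a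
  have hsym' : ∀ a, s'.symm a = f a := fun a => congrFun (hf.localInverseAt_symm _) a
  intro y hy
  simp only [modelWithCornersSelf_coe, modelWithCornersSelf_coe_symm, Set.range_id,
    Set.inter_univ, Set.preimage_id, Function.comp_id, Function.id_comp] at hy ⊢
  apply ContDiffAt.contDiffWithinAt
  simp only [OpenPartialHomeomorph.trans_source, OpenPartialHomeomorph.symm_source,
    OpenPartialHomeomorph.trans_target, Set.mem_inter_iff, Set.mem_preimage,
    OpenPartialHomeomorph.coe_trans_symm, Function.comp_apply, hsym] at hy
  obtain ⟨⟨hy1, hy2⟩, hy3, hy4⟩ := hy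
  set a := (chartAt E g).symm y
  set b := s' (f a) with hb
  have hfb : f b = f a := by rw [hb, ← hsym', s'.left_inv hy3]
  obtain ⟨ψ, hψ, hψa, hψf⟩ := deck a b hfb.symm
  have hbt : b ∈ s'.target := s'.map_source hy3
  have hca : ContinuousAt (chartAt E g).symm y := (chartAt E g).continuousAt_symm hy1
  have hev : ∀ᶠ w in 𝓝 y, ψ ((chartAt E g).symm w) ∈ s'.target := by
    refine (hψ.continuous.continuousAt.comp hca).preimage_mem_nhds ?_
    change _ ∈ 𝓝 (ψ a)
    rw [hψa]
    exact s'.open_target.mem_nhds hbt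
  have hsm : ContMDiffAt 𝓘(ℝ, E) 𝓘(ℝ, E) ∞ (fun w => chartAt E g' (ψ ((chartAt E g).symm w))) y := by
    have h1 : ContMDiffAt 𝓘(ℝ, E) 𝓘(ℝ, E) ∞ (chartAt E g).symm y :=
      (contMDiffOn_chart_symm (I := 𝓘(ℝ, E)) (n := ∞) (x := g)).contMDiffAt
        ((chartAt E g).open_target.mem_nhds hy1)
    have h2 : ContMDiffAt 𝓘(ℝ, E) 𝓘(ℝ, E) ∞ (chartAt E g') (ψ a) := by
      rw [hψa]
      exact (contMDiffOn_chart (I := 𝓘(ℝ, E)) (n := ∞) (x := g')).contMDiffAt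
        ((chartAt E g').open_source.mem_nhds hy4)
    exact ContMDiffAt.comp y h2 ((hψ a).comp y h1)
  refine (contMDiffAt_iff_contDiffAt.1 hsm).congr_of_eventuallyEq ?_
  filter_upwards [hev] with w hw
  simp only [OpenPartialHomeomorph.coe_trans, OpenPartialHomeomorph.coe_trans_symm,
    Function.comp_apply, hsym]
  rw [← hψf, ← hsym', s'.right_inv hw]

/-- The projection onto such a quotient is smooth. -/
theorem contMDiff_of_isLocalHomeomorph [IsManifold 𝓘(ℝ, E) ∞ X] {f : X → Y} (hf : IsLocalHomeomorph f)
    (hs : Function.Surjective f)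
    (deck : ∀ a b, f a = f b → ∃ ψ : X → X, ContMDiff 𝓘(ℝ, E) 𝓘(ℝ, E) ∞ ψ ∧ ψ a = b ∧
      ∀ c, f (ψ c) = f c) :
    @ContMDiff ℝ _ E _ _ E _ 𝓘(ℝ, E) X _ _ E _ _ E _ 𝓘(ℝ, E) Y _ (hf.chartedSpace hs) ∞ f := by
  let _ : ChartedSpace E Y := hf.chartedSpace hs
  intro a
  refine contMDiffAt_iff_target.2 ⟨hf.continuous.continuousAt, ?_⟩
  set g := hs.hasRightInverse.choose (f a)
  have hg : f g = f a := hs.hasRightInverse.choose_spec (f a)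
  obtain ⟨ψ, hψ, hψa, hψf⟩ := deck a g hg.symm
  set s := hf.localInverseAt g with hsdef
  have hsym : ∀ a, s.symm a = f a := fun a => congrFun (hf.localInverseAt_symm _) a
  have hgs : g ∈ s.target := hf.self_mem_localInverseAt_target
  have hev : ∀ᶠ w in 𝓝 a, ψ w ∈ s.target := by
    refine hψ.continuous.continuousAt.preimage_mem_nhds ?_
    rw [hψa]
    exact s.open_target.mem_nhds hgs
  have hc : ContMDiffAt 𝓘(ℝ, E) 𝓘(ℝ, E) ∞ (chartAt E g) (ψ a) := by
    rw [hψa]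
    exact (contMDiffOn_chart (I := 𝓘(ℝ, E)) (n := ∞) (x := g)).contMDiffAt
      ((chartAt E g).open_source.mem_nhds (mem_chart_source E g))
  refine (ContMDiffAt.comp a hc (hψ a)).congr_of_eventuallyEq ?_
  filter_upwards [hev] with w hw
  have e : extChartAt 𝓘(ℝ, E) (f a) (f w) = chartAt E g (s (f w)) := rfl
  rw [Function.comp_apply, e, ← hψf, ← hsym, s.right_inv hw, Function.comp_apply]

/-- The quotient of a Lie group by the left translations of a discrete subgroup is a smooth
manifold. -/
theorem isManifold_orbitRel [Group X] [LieGroup 𝓘(ℝ, E) ∞ X] [IsTopologicalGroup X] [T2Space X]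
    [LocallyCompactSpace X] (S : Subgroup X) [ProperlyDiscontinuousSMul S X] :
    IsManifold 𝓘(ℝ, E) ∞ (MulAction.orbitRel.Quotient S X) := by
  refine isManifold_of_isLocalHomeomorph _ _ ?_
  intro a b hab
  obtain ⟨γ, hγ⟩ := Quotient.exact hab.symm
  refine ⟨fun c => (γ : X) * c, contMDiff_mul_left, hγ, fun c => ?_⟩
  exact Quotient.sound ⟨γ, rfl⟩

end Quotient

instance LatticeData.properlyDiscontinuous (L : LatticeData) :
    ProperlyDiscontinuousSMul L.Γ (G L.p) :=
  Subgroup.properlyDiscontinuousSMul_of_tendsto_cofinite L.Γ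
    (L.Γ.tendsto_coe_cofinite_of_discrete
      (isDiscrete_iff_discreteTopology.2 L.discreteTopology_Γ))

instance EigenData.properlyDiscontinuous (D : EigenData) :
    ProperlyDiscontinuousSMul D.ΓK (K D.p) :=
  Subgroup.properlyDiscontinuousSMul_of_tendsto_cofinite D.ΓK
    (D.ΓK.tendsto_coe_cofinite_of_discrete
      (isDiscrete_iff_discreteTopology.2 D.discreteTopology_ΓK))

/-- The manifold `Ĝ(p)`: the quotient of `G(p)` by the left translations of `Γ(p)`, so that
left-invariant forms and vector fields on `G(p)` induce forms and vector fields on it. Its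
topology is the quotient topology and its charts (from `MulAction.instChartedSpaceQuotient`) are
local inverses of the projection. -/
abbrev LatticeData.GHat (L : LatticeData) : Type := MulAction.orbitRel.Quotient L.Γ (G L.p)

instance (L : LatticeData) : IsManifold 𝓘(ℝ, Fin 5 → ℝ) ∞ L.GHat := isManifold_orbitRel L.Γ

/-- The manifold `K̂`: the quotient of `K` by the left translations of `Γ_K`. -/
abbrev EigenData.KHat (D : EigenData) : Type := MulAction.orbitRel.Quotient D.ΓK (K D.p)

instance (D : EigenData) : IsManifold 𝓘(ℝ, Fin 3 → ℝ) ∞ D.KHat := isManifold_orbitRel D.ΓK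

/-- The circle `S¹ = ℝ / z₂ℤ`. -/
abbrev EigenData.S1 (D : EigenData) : Type := AddCircle D.z₂

/-- The circle has local inverses of the projection from `ℝ` as charts. -/
instance (D : EigenData) : ChartedSpace ℝ D.S1 :=
  (AddCircle.isLocalHomeomorph_coe D.z₂).chartedSpace QuotientAddGroup.mk_surjective

theorem EigenData.deck_S1 (D : EigenData) (a b : ℝ) (h : (a : D.S1) = b) :
    ∃ ψ : ℝ → ℝ, ContMDiff 𝓘(ℝ, ℝ) 𝓘(ℝ, ℝ) ∞ ψ ∧ ψ a = b ∧ ∀ c, (ψ c : D.S1) = c := by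
  refine ⟨fun c => (b - a) + c, ContDiff.contMDiff (by fun_prop), by ring, fun c => ?_⟩
  rw [AddCircle.coe_add, AddCircle.coe_sub, h, sub_self, zero_add]

instance (D : EigenData) : IsManifold 𝓘(ℝ, ℝ) ∞ D.S1 :=
  isManifold_of_isLocalHomeomorph _ _ D.deck_S1

theorem EigenData.contMDiff_coe (D : EigenData) :
    ContMDiff 𝓘(ℝ, ℝ) 𝓘(ℝ, ℝ) ∞ (fun s : ℝ => (s : D.S1)) :=
  contMDiff_of_isLocalHomeomorph _ _ D.deck_S1

/-- The charts of the circle are local sections of the projection. -/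
theorem EigenData.coe_chartAt (D : EigenData) (a b : D.S1) (hb : b ∈ (chartAt ℝ a).source) :
    ((chartAt ℝ a b : ℝ) : D.S1) = b := by
  have h1 := (chartAt ℝ a).left_inv hb
  rw [← h1]
  have : ∀ w : ℝ, (chartAt ℝ a).symm w = (w : D.S1) := fun w =>
    congrFun ((AddCircle.isLocalHomeomorph_coe D.z₂).localInverseAt_symm _) w
  rw [this]
  congr 1
  rw [← this, (chartAt ℝ a).left_inv hb]

instance (D : EigenData) : LieAddGroup 𝓘(ℝ, ℝ) ∞ D.S1 where
  contMDiff_add := by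
    rintro ⟨a, b⟩
    have ca : ContMDiffAt 𝓘(ℝ, ℝ) 𝓘(ℝ, ℝ) ∞ (chartAt ℝ a) a :=
      (contMDiffOn_chart (I := 𝓘(ℝ, ℝ)) (n := ∞) (x := a)).contMDiffAt
        ((chartAt ℝ a).open_source.mem_nhds (mem_chart_source ℝ a))
    have cb : ContMDiffAt 𝓘(ℝ, ℝ) 𝓘(ℝ, ℝ) ∞ (chartAt ℝ b) b :=
      (contMDiffOn_chart (I := 𝓘(ℝ, ℝ)) (n := ∞) (x := b)).contMDiffAt
        ((chartAt ℝ b).open_source.mem_nhds (mem_chart_source ℝ b))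
    have h1 : ContMDiffAt (𝓘(ℝ, ℝ).prod 𝓘(ℝ, ℝ)) 𝓘(ℝ, ℝ) ∞
        (fun q : D.S1 × D.S1 => (chartAt ℝ a q.1 + chartAt ℝ b q.2 : ℝ)) (a, b) :=
      (ContMDiffAt.comp (a, b) ca contMDiffAt_fst).add (ContMDiffAt.comp (a, b) cb contMDiffAt_snd)
    refine (ContMDiffAt.comp (a, b) (D.contMDiff_coe _) h1).congr_of_eventuallyEq ?_
    have e1 : ∀ᶠ q : D.S1 × D.S1 in 𝓝 (a, b), q.1 ∈ (chartAt ℝ a).source :=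
      continuousAt_fst.preimage_mem_nhds
        ((chartAt ℝ a).open_source.mem_nhds (mem_chart_source ℝ a))
    have e2 : ∀ᶠ q : D.S1 × D.S1 in 𝓝 (a, b), q.2 ∈ (chartAt ℝ b).source :=
      continuousAt_snd.preimage_mem_nhds
        ((chartAt ℝ b).open_source.mem_nhds (mem_chart_source ℝ b))
    filter_upwards [e1, e2] with q h1 h2
    rw [Function.comp_apply, AddCircle.coe_add, D.coe_chartAt _ _ h1, D.coe_chartAt _ _ h2]
  contMDiff_neg := by
    intro a
    have ca : ContMDiffAt 𝓘(ℝ, ℝ) 𝓘(ℝ, ℝ) ∞ (chartAt ℝ a) a :=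
      (contMDiffOn_chart (I := 𝓘(ℝ, ℝ)) (n := ∞) (x := a)).contMDiffAt
        ((chartAt ℝ a).open_source.mem_nhds (mem_chart_source ℝ a))
    refine (ContMDiffAt.comp a (D.contMDiff_coe _) ca.neg).congr_of_eventuallyEq ?_
    filter_upwards [(chartAt ℝ a).open_source.mem_nhds (mem_chart_source ℝ a)] with q h1
    rw [Function.comp_apply, AddCircle.coe_neg, D.coe_chartAt _ _ h1]

/-! ## Differential forms on manifolds -/

section Forms

variable {E H M : Type*} [NormedAddCommGroup E] [NormedSpace ℝ E] [TopologicalSpace H]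
  [TopologicalSpace M] [ChartedSpace H M]
  {E' H' M' : Type*} [NormedAddCommGroup E'] [NormedSpace ℝ E'] [TopologicalSpace H']
  [TopologicalSpace M'] [ChartedSpace H' M']

/-- (Not necessarily smooth) differential `k`-forms on a manifold. -/
abbrev DForm (I : ModelWithCorners ℝ E H) (M : Type*) [TopologicalSpace M] [ChartedSpace H M]
    (k : ℕ) : Type _ :=
  (x : M) → TangentSpace I x [⋀^Fin k]→L[ℝ] ℝ

/-- (Not necessarily smooth) vector fields on a manifold. -/
abbrev VField (I : ModelWithCorners ℝ E H) (M : Type*) [TopologicalSpace M] [ChartedSpace H M] :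
    Type _ :=
  (x : M) → TangentSpace I x

/-- The pullback `f^* σ`. -/
def pullback (I : ModelWithCorners ℝ E H) (I' : ModelWithCorners ℝ E' H') {k : ℕ} (f : M → M')
    (σ : DForm I' M' k) : DForm I M k :=
  fun x => (σ (f x)).compContinuousLinearMap (mfderiv I I' f x)

/-- The form `σ` in the preferred chart at `x`, a form on (an open subset of) the model space. -/
def localForm (I : ModelWithCorners ℝ E H) {k : ℕ} (σ : DForm I M k) (x : M) :
    E → E [⋀^Fin k]→L[ℝ] ℝ :=
  pullback 𝓘(ℝ, E) I (extChartAt I x).symm σ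

/-- Smoothness of a form on a manifold without boundary: it is smooth in charts. -/
def IsSmoothForm (I : ModelWithCorners ℝ E H) {k : ℕ} (σ : DForm I M k) : Prop :=
  ∀ x : M, ContDiffOn ℝ ∞ (localForm I σ x) (extChartAt I x).target

/-- The exterior derivative on a manifold without boundary, computed at `x` in the preferred chart
at `x`. -/
def dExt (I : ModelWithCorners ℝ E H) {k : ℕ} (σ : DForm I M k) : DForm I M (k + 1) :=
  fun x => ContinuousAlternatingMap.compContinuousLinearMap
    (extDeriv (localForm I σ x) (extChartAt I x x)) (mfderiv I 𝓘(ℝ, E) (extChartAt I x) x)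

/-- The exterior product of two linear forms, `(a ∧ b)(v, w) = a(v) b(w) - a(w) b(v)`; see
`wedgeAlt_apply`. -/
def wedgeAlt (a b : E [⋀^Fin 1]→L[ℝ] ℝ) : E [⋀^Fin 2]→L[ℝ] ℝ :=
  ContinuousAlternatingMap.alternatizeUncurryFin
    (ContinuousLinearMap.smulRight
      ((ContinuousAlternatingMap.ofSubsingleton ℝ E ℝ (0 : Fin 1)).symm a) b)

theorem wedgeAlt_apply (a b : E [⋀^Fin 1]→L[ℝ] ℝ) (v w : E) :
    wedgeAlt a b ![v, w] = a ![v] * b ![w] - a ![w] * b ![v] := by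
  rw [wedgeAlt, ContinuousAlternatingMap.alternatizeUncurryFin_apply]
  have e0 : Fin.removeNth (0 : Fin 2) ![v, w] = ![w] := by
    funext i; fin_cases i; rfl
  have e1 : Fin.removeNth (1 : Fin 2) ![v, w] = ![v] := by
    funext i; fin_cases i; rfl
  have e : ∀ u : E,
      (ContinuousAlternatingMap.ofSubsingleton ℝ E ℝ (0 : Fin 1)).symm a u = a ![u] := by
    intro u
    change a (fun _ => u) = a ![u]
    congr 1
    funext i; fin_cases i; rfl
  simp [Fin.sum_univ_two, e0, e1, e, sub_eq_add_neg]

/-- The exterior product of two one-forms. -/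
def wedge (I : ModelWithCorners ℝ E H) (α β : DForm I M 1) : DForm I M 2 :=
  fun x => wedgeAlt (E := E) (α x) (β x)

/-- The one-form on a manifold modelled on `E` through the identity chart given by a field of linear
forms on `E`. -/
def oneForm (I : ModelWithCorners ℝ E H) (a : M → E →L[ℝ] ℝ) : DForm I M 1 :=
  fun x => ContinuousAlternatingMap.ofSubsingleton ℝ E ℝ (0 : Fin 1) (a x)

/-- The form induced on the base of a surjective local diffeomorphism `q` by a form `σ` upstairs that
is invariant under the deck transformations (so that the choice of preimages is irrelevant). -/
def descend (I : ModelWithCorners ℝ E H) (I' : ModelWithCorners ℝ E' H') {k : ℕ} {q : M → M'}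
    (hq : Function.Surjective q) (σ : DForm I M k) : DForm I' M' k :=
  fun y => (σ (Function.surjInv hq y)).compContinuousLinearMap
    (ContinuousLinearMap.inverse (mfderiv I I' q (Function.surjInv hq y)))

/-- The vector field induced in the same way by a vector field upstairs. -/
def descendField (I : ModelWithCorners ℝ E H) (I' : ModelWithCorners ℝ E' H') {q : M → M'}
    (hq : Function.Surjective q) (ξ : VField I M) : VField I' M' :=
  fun y => mfderiv I I' q (Function.surjInv hq y) (ξ (Function.surjInv hq y))

/-- A contact form: a smooth one-form `η`, nowhere zero, whose differential is nondegenerate on the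
hyperplanes `ker η` (equivalently, `η ∧ (dη)ⁿ` vanishes nowhere, where `dim M = 2n + 1`). -/
structure IsContactForm (I : ModelWithCorners ℝ E H) (η : DForm I M 1) : Prop where
  smooth : IsSmoothForm I η
  ne_zero : ∀ x, η x ≠ 0
  nondegenerate : ∀ (x : M) (v : TangentSpace I x), η x ![v] = 0 →
    (∀ w : TangentSpace I x, η x ![w] = 0 → dExt I η x ![v, w] = 0) → v = 0

/-- The Reeb vector field of a contact form: `η(ξ) = 1` and `dη(ξ, ·) = 0`. -/
structure IsReebField (I : ModelWithCorners ℝ E H) (η : DForm I M 1) (ξ : VField I M) : Prop where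
  apply_eq_one : ∀ x, η x ![ξ x] = 1
  contract_eq_zero : ∀ (x : M) (w : TangentSpace I x), dExt I η x ![ξ x, w] = 0

/-- A symplectic form: a smooth, closed, nondegenerate two-form. -/
structure IsSymplecticForm (I : ModelWithCorners ℝ E H) (Ω : DForm I M 2) : Prop where
  smooth : IsSmoothForm I Ω
  closed : dExt I Ω = 0
  nondegenerate : ∀ (x : M) (v : TangentSpace I x),
    (∀ w : TangentSpace I x, Ω x ![v, w] = 0) → v = 0

end Forms

section Regular

variable {n : ℕ} [NeZero n] {M : Type*} [TopologicalSpace M] [ChartedSpace (Fin n → ℝ) M]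

/-- A vector field `ξ` is regular if every point has a cubical coordinate neighbourhood in which
`ξ = ∂/∂x₀` and which every integral curve of `ξ` crosses at most once, that is: the points of the
neighbourhood on a given integral curve lie on a single coordinate line `xᵢ = cᵢ (i ≠ 0)`.
(Balls of `Fin n → ℝ`, which carries the sup norm, are cubes.) -/
def IsRegularField (ξ : VField 𝓘(ℝ, Fin n → ℝ) M) : Prop :=
  ∀ x : M, ∃ φ ∈ IsManifold.maximalAtlas 𝓘(ℝ, Fin n → ℝ) ∞ M,
    x ∈ φ.source ∧ (∃ r > 0, φ.target = Metric.ball (φ x) r) ∧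
    (∀ y ∈ φ.source, mfderiv 𝓘(ℝ, Fin n → ℝ) 𝓘(ℝ, Fin n → ℝ) φ y (ξ y) =
      (Pi.single 0 1 : Fin n → ℝ)) ∧
    ∀ γ : ℝ → M, IsMIntegralCurve γ ξ → ∀ s t : ℝ, γ s ∈ φ.source → γ t ∈ φ.source →
      ∀ i, i ≠ 0 → φ (γ s) i = φ (γ t) i

/-- A contact form is regular if its Reeb vector field is. -/
def IsRegularContactForm (η : DForm 𝓘(ℝ, Fin n → ℝ) M 1) : Prop :=
  IsContactForm 𝓘(ℝ, Fin n → ℝ) η ∧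
    ∃ ξ, IsReebField 𝓘(ℝ, Fin n → ℝ) η ξ ∧ IsRegularField ξ

end Regular

section PrincipalBundle

variable {ES HS S EP HP P EB HB B : Type*}
  [NormedAddCommGroup ES] [NormedSpace ℝ ES] [TopologicalSpace HS]
  [TopologicalSpace S] [ChartedSpace HS S]
  [NormedAddCommGroup EP] [NormedSpace ℝ EP] [TopologicalSpace HP]
  [TopologicalSpace P] [ChartedSpace HP P]
  [NormedAddCommGroup EB] [NormedSpace ℝ EB] [TopologicalSpace HB]
  [TopologicalSpace B] [ChartedSpace HB B]

/-- `π : P → B` is a smooth principal bundle for an action of the (additively written) Lie group `S`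
on `P`: action and projection are smooth, `π` is invariant, and near every point of the base there is
a smooth `S`-equivariant local trivialization. -/
structure IsPrincipalBundle (IS : ModelWithCorners ℝ ES HS) (IP : ModelWithCorners ℝ EP HP)
    (IB : ModelWithCorners ℝ EB HB) [AddGroup S] [LieAddGroup IS ∞ S] [AddAction S P]
    (π : P → B) : Prop where
  smooth_action : ContMDiffVAdd IS IP ∞ S P
  smooth_proj : ContMDiff IP IB ∞ π
  proj_vadd : ∀ (s : S) (x : P), π (s +ᵥ x) = π x
  trivialization : ∀ b : B, ∃ e : Bundle.Trivialization S π, b ∈ e.baseSet ∧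
    ContMDiffOn IP (IB.prod IS) ∞ e e.source ∧
    ContMDiffOn (IB.prod IS) IP ∞ e.toOpenPartialHomeomorph.symm e.target ∧
    ∀ (s : S), ∀ x ∈ e.source, (e (s +ᵥ x)).2 = s + (e x).2

end PrincipalBundle

/-! ## The contact manifold and its base -/

namespace EigenData

variable (D : EigenData)

/-- The projection `K → K̂`. -/
def projK : K D.p → D.KHat := Quotient.mk _

theorem projK_surjective : Function.Surjective D.projK := Quotient.mk_surjective

/-- The projection `ℝ → S¹ = ℝ / z₂ℤ`. -/
def projS1 : ℝ → D.S1 := fun t => (t : D.S1)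

theorem projS1_surjective : Function.Surjective D.projS1 := QuotientAddGroup.mk_surjective

/-- `α_K = e^{-pu} dx`. -/
def αK : DForm 𝓘(ℝ, Fin 3 → ℝ) (K D.p) 1 :=
  oneForm _ fun g => Real.exp (-(D.p * g 2)) • ContinuousLinearMap.proj 0

/-- `β_K = e^{pu} dy`. -/
def βK : DForm 𝓘(ℝ, Fin 3 → ℝ) (K D.p) 1 :=
  oneForm _ fun g => Real.exp (D.p * g 2) • ContinuousLinearMap.proj 1

/-- `θ_K = du`. -/
def θK : DForm 𝓘(ℝ, Fin 3 → ℝ) (K D.p) 1 :=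
  oneForm _ fun _ => ContinuousLinearMap.proj 2

/-- The one-form `dt` of `ℝ`. -/
def dt : DForm 𝓘(ℝ, ℝ) ℝ 1 := oneForm _ fun _ => ContinuousLinearMap.id ℝ ℝ

def αKHat : DForm 𝓘(ℝ, Fin 3 → ℝ) D.KHat 1 := descend 𝓘(ℝ, Fin 3 → ℝ) _ D.projK_surjective D.αK
def βKHat : DForm 𝓘(ℝ, Fin 3 → ℝ) D.KHat 1 := descend 𝓘(ℝ, Fin 3 → ℝ) _ D.projK_surjective D.βK
def θKHat : DForm 𝓘(ℝ, Fin 3 → ℝ) D.KHat 1 := descend 𝓘(ℝ, Fin 3 → ℝ) _ D.projK_surjective D.θK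

/-- The length element of `S¹ = ℝ / z₂ℤ`. -/
def ωHat : DForm 𝓘(ℝ, ℝ) D.S1 1 := descend 𝓘(ℝ, ℝ) _ D.projS1_surjective dt

/-- The manifold `K̂ × S¹`, a quotient of `K × ℝ` by `Γ_K × z₂ℤ`. -/
abbrev Base : Type := D.KHat × D.S1

/-- The model of `K̂ × S¹`. -/
abbrev IBase : ModelWithCorners ℝ ((Fin 3 → ℝ) × ℝ) (ModelProd (Fin 3 → ℝ) ℝ) :=
  𝓘(ℝ, Fin 3 → ℝ).prod 𝓘(ℝ, ℝ)

/-- A one-form on `K̂`, as a form on `K̂ × S¹`. -/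
def fromK (α : DForm 𝓘(ℝ, Fin 3 → ℝ) D.KHat 1) : DForm IBase D.Base 1 :=
  pullback IBase 𝓘(ℝ, Fin 3 → ℝ) Prod.fst α

/-- A one-form on `S¹`, as a form on `K̂ × S¹`. -/
def fromS1 (α : DForm 𝓘(ℝ, ℝ) D.S1 1) : DForm IBase D.Base 1 :=
  pullback IBase 𝓘(ℝ, ℝ) Prod.snd α

/-- `Ω̂ = -(α̂_K ∧ β̂_K + σ̂ ∧ θ̂_K)`. -/
def ΩHat : DForm IBase D.Base 2 :=
  -(wedge IBase (D.fromK D.αKHat) (D.fromK D.βKHat) +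
    wedge IBase (D.fromS1 D.ωHat) (D.fromK D.θKHat))

end EigenData

namespace LatticeData

variable (L : LatticeData)

/-- The projection `G(p) → Ĝ(p)`. -/
def projG : G L.p → L.GHat := Quotient.mk _

theorem projG_surjective : Function.Surjective L.projG := Quotient.mk_surjective

/-- `η = dz - x dy - t du`. -/
def η : DForm 𝓘(ℝ, Fin 5 → ℝ) (G L.p) 1 :=
  oneForm _ fun g => ContinuousLinearMap.proj 2 - g 0 • ContinuousLinearMap.proj 1 -
    g 4 • ContinuousLinearMap.proj 3

/-- `ξ = ∂/∂z`. -/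
def ξ : VField 𝓘(ℝ, Fin 5 → ℝ) (G L.p) := fun _ => (Pi.single 2 1 : Fin 5 → ℝ)

def ηHat : DForm 𝓘(ℝ, Fin 5 → ℝ) L.GHat 1 := descend 𝓘(ℝ, Fin 5 → ℝ) _ L.projG_surjective L.η

def ξHat : VField 𝓘(ℝ, Fin 5 → ℝ) L.GHat := descendField 𝓘(ℝ, Fin 5 → ℝ) _ L.projG_surjective L.ξ

/-- The map `π̂ : Ĝ(p) → K̂ × S¹` induced by `π(x, y, z, u, t) = (x, y, u, t)`. -/
def πHat : L.GHat → L.Base :=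
  Quotient.lift (fun g : G L.p => (L.projK (K.mk (g 0) (g 1) (g 3)), L.projS1 (g 4))) (by
    rintro _ h ⟨⟨γ, hN, ⟨n, hn⟩, k, hk⟩, rfl⟩
    refine Prod.ext (Quotient.sound ⟨⟨K.mk (γ 0) (γ 1) (γ 3), L.mem_plane (h := Heis.mk (γ 0) (γ 1) (γ 2)) hN, n, hn⟩, ?_⟩) ?_
    · exact K.ext' rfl rfl rfl
    · change ((γ 4 + h 4 : ℝ) : L.S1) = (h 4 : L.S1)
      rw [AddCircle.coe_add, add_eq_right, hk]
      exact (AddCircle.coe_eq_zero_iff _).2 ⟨k, by simp⟩)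

end LatticeData

end RegularContact

end

open RegularContact

/-! The charts of `GHat`, `KHat` and `S1` are local inverses of the projections from `G(p)`, `K` and
`ℝ`, so the inverse of a preferred chart is the projection itself (`extChartAt_symm`,
`extChartAt_base_symm`). Left-invariant objects descend (`pullback_descend`,
`mfderiv_descendField`), and the local form of a descended form is the original form on `ℝ⁵` or `ℝ³
× ℝ`. Contact, Reeb and symplectic conditions thus become linear algebra for `η = dz - x dy - t du`
and `dη = -(dx ∧ dy + dt ∧ du)`.

The form `dη` has constant coefficients and no `dz` term, so it is the pullback of a constant form
`Ω₀` under the linear map `π(x,y,z,u,t) = ((x,y,u),t)`. In `α_K ∧ β_K` the factors `e^{-pu}` and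
`e^{pu}` cancel, so `Ω̂` pulls back to the same `Ω₀` (`pullback_ΩHat`). This gives `π̂^*Ω̂ = dη̂`;
uniqueness holds because `π` has a linear section and the projection to the base inverts its charts.

The elements `(0,0,s,0,0)` are central, so left translation by them descends and is the flow of
`ξ̂`. Such an element lies in `Γ(p)` exactly when `s ∈ z₂ℤ` (`zElt_mem_iff`), so the flow is a free
action of `ℝ/z₂ℤ`. Every element of `Γ_K × z₂ℤ` lifts to `Γ(p)` (`exists_mem_Γ`), so two points with
the same image under `π̂` have representatives differing only in `z`: fibres lie in orbits.
Conversely `dπ̂(ξ̂) = 0`, so `π̂` is constant on integral curves. Regularity follows in a cube on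
which the base coordinates are determined by `π̂`. Local trivializations come from the section `z =
0`, with the class of `z` as fibre coordinate.

Compactness comes from reducing the coordinates modulo the lattice into a box, solvability from
towers of homomorphisms to abelian groups. -/

noncomputable section

namespace RegularContact

/-! ### Quotient projections as local diffeomorphisms -/

section Quotient

variable {E X Y : Type*} [NormedAddCommGroup E] [NormedSpace ℝ E] [TopologicalSpace X]
  [ChartedSpace E X] [TopologicalSpace Y]

/-- A surjective local homeomorphism, any two points of whose fibres are related by a smooth map
over the base, is a local diffeomorphism for the charts that it induces. -/
theorem isLocalDiffeomorph_of_isLocalHomeomorph [IsManifold 𝓘(ℝ, E) ∞ X] {f : X → Y}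
    (hf : IsLocalHomeomorph f) (hs : Function.Surjective f)
    (deck : ∀ a b, f a = f b → ∃ ψ : X → X, ContMDiff 𝓘(ℝ, E) 𝓘(ℝ, E) ∞ ψ ∧ ψ a = b ∧
      ∀ c, f (ψ c) = f c) :
    @IsLocalDiffeomorph ℝ _ E _ _ E _ _ E _ E _ 𝓘(ℝ, E) 𝓘(ℝ, E) X _ _ Y _ (hf.chartedSpace hs)
      ∞ f := by
  let _ : ChartedSpace E Y := hf.chartedSpace hs
  have hfs := contMDiff_of_isLocalHomeomorph hf hs deck
  have : IsManifold 𝓘(ℝ, E) ∞ Y := isManifold_of_isLocalHomeomorph hf hs deck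
  intro a
  set s := hf.localInverseAt a with hsdef
  have hsym : ∀ a, s.symm a = f a := fun a => congrFun (hf.localInverseAt_symm _) a
  refine ⟨⟨s.symm.toPartialEquiv, s.symm.open_source, s.symm.open_target, ?_, ?_⟩,
    hf.self_mem_localInverseAt_target, fun x _ => (hsym x).symm⟩
  · exact hfs.contMDiffOn.congr fun x _ => hsym x
  · intro y hy
    change y ∈ s.source at hy
    change ContMDiffWithinAt _ _ _ s s.source y
    refine ContMDiffAt.contMDiffWithinAt ?_
    -- The chart at `y` is built from the chosen preimage `g`, while `s` is the branch through `a`.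
    -- The deck map `ψ` carries `g` to `s y`, so near `y` the map `s` is `ψ ∘ (chartAt E g).symm ∘
    -- chartAt E y`, which is smooth.
    set g := hs.hasRightInverse.choose y with hgdef
    have hg : f g = y := hs.hasRightInverse.choose_spec y
    have hfy : f (s y) = y := by rw [← hsym, s.left_inv hy]
    obtain ⟨ψ, hψ, hψg, hψf⟩ := deck g (s y) (hg.trans hfy.symm)
    set s' := hf.localInverseAt g with hs'def
    have hsym' : ∀ a, s'.symm a = f a := fun a => congrFun (hf.localInverseAt_symm _) a
    have hgs : g ∈ s'.target := hf.self_mem_localInverseAt_target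
    have hys : y ∈ s'.source := by
      have := s'.map_target hgs
      rwa [hsym', hg] at this
    have hs'y : s' y = g := by rw [← hg, ← hsym', s'.right_inv hgs]
    have hchart : chartAt E y = s'.trans (chartAt E g) := rfl
    have h1 : ContMDiffAt 𝓘(ℝ, E) 𝓘(ℝ, E) ∞ (chartAt E y) y :=
      (contMDiffOn_chart (I := 𝓘(ℝ, E)) (n := ∞) (x := y)).contMDiffAt
        ((chartAt E y).open_source.mem_nhds (mem_chart_source E y))
    have hcy : chartAt E y y = chartAt E g g := by
      rw [hchart, OpenPartialHomeomorph.coe_trans, Function.comp_apply, hs'y]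
    have h2 : ContMDiffAt 𝓘(ℝ, E) 𝓘(ℝ, E) ∞ (chartAt E g).symm (chartAt E y y) := by
      rw [hcy]
      exact (contMDiffOn_chart_symm (I := 𝓘(ℝ, E)) (n := ∞) (x := g)).contMDiffAt
        ((chartAt E g).open_target.mem_nhds ((chartAt E g).map_source (mem_chart_source E g)))
    have h3 : ContMDiffAt 𝓘(ℝ, E) 𝓘(ℝ, E) ∞ (fun w => ψ ((chartAt E g).symm (chartAt E y w))) y :=
      (hψ _).comp y (ContMDiffAt.comp y h2 h1)
    refine h3.congr_of_eventuallyEq ?_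
    have e1 : ∀ᶠ w in 𝓝 y, w ∈ s'.source := s'.open_source.mem_nhds hys
    have e2 : ∀ᶠ w in 𝓝 y, s' w ∈ (chartAt E g).source := by
      refine (s'.continuousAt hys).preimage_mem_nhds ?_
      rw [hs'y]
      exact (chartAt E g).open_source.mem_nhds (mem_chart_source E g)
    have e3 : ∀ᶠ w in 𝓝 y, ψ (s' w) ∈ s.target := by
      refine (hψ.continuous.continuousAt.comp (s'.continuousAt hys)).preimage_mem_nhds ?_
      change _ ∈ 𝓝 (ψ (s' y))
      rw [hs'y, hψg]
      exact s.open_target.mem_nhds (s.map_source hy)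
    filter_upwards [e1, e2, e3] with w h1 h2 h3
    have : (chartAt E g).symm (chartAt E y w) = s' w := by
      rw [hchart, OpenPartialHomeomorph.coe_trans, Function.comp_apply,
        (chartAt E g).left_inv h2]
    rw [this, ← s.right_inv h3, hsym, hψf, ← hsym', s'.left_inv h1]

end Quotient

/-! ### Pullback and descent of forms and vector fields -/

section Forms

variable {E H M : Type*} [NormedAddCommGroup E] [NormedSpace ℝ E] [TopologicalSpace H]
  [TopologicalSpace M] [ChartedSpace H M]
  {E' H' M' : Type*} [NormedAddCommGroup E'] [NormedSpace ℝ E'] [TopologicalSpace H']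
  [TopologicalSpace M'] [ChartedSpace H' M']
  {E'' H'' M'' : Type*} [NormedAddCommGroup E''] [NormedSpace ℝ E''] [TopologicalSpace H'']
  [TopologicalSpace M''] [ChartedSpace H'' M'']
  {I : ModelWithCorners ℝ E H} {I' : ModelWithCorners ℝ E' H'} {I'' : ModelWithCorners ℝ E'' H''}

theorem pullback_apply {k : ℕ} (f : M → M') (σ : DForm I' M' k) (x : M)
    (v : Fin k → TangentSpace I x) :
    pullback I I' f σ x v = σ (f x) (fun i => mfderiv I I' f x (v i)) := rfl

theorem pullback_comp_apply {k : ℕ} {f : M → M'} {g : M' → M''} (σ : DForm I'' M'' k) {x : M}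
    (hg : MDifferentiableAt I' I'' g (f x)) (hf : MDifferentiableAt I I' f x) :
    pullback I I'' (g ∘ f) σ x = pullback I I' f (pullback I' I'' g σ) x := by
  ext v
  rw [pullback_apply, mfderiv_comp x hg hf]
  rfl

theorem inverse_apply_self (e : E ≃L[ℝ] E') (w : E) :
    ContinuousLinearMap.inverse (e : E →L[ℝ] E') ((e : E →L[ℝ] E') w) = w := by
  rw [ContinuousLinearMap.inverse_equiv]
  exact e.symm_apply_apply w

/-- A form that is invariant under deck transformations is the pullback of the induced form. -/
theorem pullback_descend {k : ℕ} {q : M → M'} (hs : Function.Surjective q)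
    (hq : IsLocalDiffeomorph I I' ∞ q) {σ : DForm I M k}
    (deck : ∀ a b, q a = q b → ∃ ψ : M → M, MDifferentiableAt I I ψ a ∧ ψ a = b ∧
      (∀ c, q (ψ c) = q c) ∧ pullback I I ψ σ a = σ a) :
    pullback I I' q (descend I I' hs σ) = σ := by
  funext a
  -- `descend` evaluates `σ` at the chosen preimage of `q a`; the deck map `ψ` moves `a` to that
  -- preimage.
  obtain ⟨ψ, hψ, hψb, hψq, hψσ⟩ := deck a _ (Function.surjInv_eq hs (q a)).symm
  ext v
  conv_rhs => rw [← hψσ]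
  rw [pullback_apply, pullback_apply]
  change σ (Function.surjInv hs (q a)) _ = _
  rw [← hψb]
  congr 1
  funext i
  -- Differentiating `q ∘ ψ = q`: undoing the differential of `q` at `ψ a` leaves the differential
  -- of `ψ`, and invariance of `σ` finishes.
  have hc : mfderiv I I' q a = (mfderiv I I' q (ψ a)).comp (mfderiv I I ψ a) := by
    rw [← mfderiv_comp a ((hq _).mdifferentiableAt (by simp)) hψ]
    congr 1
    funext c
    exact (hψq c).symm
  have key : ∀ w : E, ContinuousLinearMap.inverse (mfderiv I I' q (ψ a) : E →L[ℝ] E')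
      ((mfderiv I I' q (ψ a) : E →L[ℝ] E') w) = w := fun w =>
    inverse_apply_self (E := E) (E' := E') ((hq (ψ a)).mfderivToContinuousLinearEquiv (by simp)) w
  refine Eq.trans ?_ (key _)
  change ContinuousLinearMap.inverse (mfderiv I I' q (ψ a) : E →L[ℝ] E')
    ((mfderiv I I' q a : E →L[ℝ] E') (v i)) = _
  rw [hc]
  rfl

/-- A vector field that is invariant under deck transformations is related to the induced field. -/
theorem mfderiv_descendField {q : M → M'} (hs : Function.Surjective q)
    (hq : IsLocalDiffeomorph I I' ∞ q) {ξ : VField I M}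
    (deck : ∀ a b, q a = q b → ∃ ψ : M → M, MDifferentiableAt I I ψ a ∧ ψ a = b ∧
      (∀ c, q (ψ c) = q c) ∧ mfderiv I I ψ a (ξ a) = ξ (ψ a)) (a : M) :
    mfderiv I I' q a (ξ a) = descendField I I' hs ξ (q a) := by
  obtain ⟨ψ, hψ, hψb, hψq, hψσ⟩ := deck a _ (Function.surjInv_eq hs (q a)).symm
  have hc : mfderiv I I' q a = (mfderiv I I' q (ψ a)).comp (mfderiv I I ψ a) := by
    rw [← mfderiv_comp a ((hq _).mdifferentiableAt (by simp)) hψ]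
    congr 1
    funext c
    exact (hψq c).symm
  change _ = mfderiv I I' q (Function.surjInv hs (q a)) (ξ (Function.surjInv hs (q a)))
  rw [← hψb, hc, ← hψσ]
  rfl

end Forms

/-! ## Invariance under left translations -/

namespace G

variable {p : ℝ}

/-- The linear part of the left translation by `a`, which is an affine map. -/
def leftCLM (a : G p) : (Fin 5 → ℝ) →L[ℝ] (Fin 5 → ℝ) :=
  ContinuousLinearMap.pi ![Real.exp (p * a 3) • ContinuousLinearMap.proj 0,
    Real.exp (-(p * a 3)) • ContinuousLinearMap.proj 1,
    ContinuousLinearMap.proj 2 + (a 0 * Real.exp (-(p * a 3))) • ContinuousLinearMap.proj 1 +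
      a 4 • ContinuousLinearMap.proj 3,
    ContinuousLinearMap.proj 3, ContinuousLinearMap.proj 4]

@[simp] theorem leftCLM_0 (a : G p) (v : Fin 5 → ℝ) :
    leftCLM a v 0 = Real.exp (p * a 3) * v 0 := rfl
@[simp] theorem leftCLM_1 (a : G p) (v : Fin 5 → ℝ) :
    leftCLM a v 1 = Real.exp (-(p * a 3)) * v 1 := rfl
@[simp] theorem leftCLM_2 (a : G p) (v : Fin 5 → ℝ) :
    leftCLM a v 2 = v 2 + a 0 * Real.exp (-(p * a 3)) * v 1 + a 4 * v 3 := rfl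

@[simp] theorem leftCLM_3 (a : G p) (v : Fin 5 → ℝ) : leftCLM a v 3 = v 3 := rfl

theorem hasMFDerivAt_mul_left (a g : G p) :
    HasMFDerivAt 𝓘(ℝ, Fin 5 → ℝ) 𝓘(ℝ, Fin 5 → ℝ) (fun h : G p => a * h) g (leftCLM a) := by
  -- Retyping as a vector gives access to the addition of `ℝ⁵`, in which left translation is `a' +
  -- leftCLM a h`.
  let a' : Fin 5 → ℝ := a
  have h : HasFDerivAt (fun h : Fin 5 → ℝ => a' + leftCLM a h) (leftCLM a) g :=
    (leftCLM a).hasFDerivAt.const_add _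
  have e : (fun h : Fin 5 → ℝ => a' + leftCLM a h) = fun h : G p => a * h := by
    funext h
    refine ext' ?_ ?_ ?_ ?_ ?_
    · rfl
    · rfl
    · change a 2 + (h 2 + a 0 * Real.exp (-(p * a 3)) * h 1 + a 4 * h 3) =
        a 2 + h 2 + a 0 * (Real.exp (-(p * a 3)) * h 1) + a 4 * h 3
      ring
    · rfl
    · rfl
  rw [e] at h
  exact h.hasMFDerivAt

end G

namespace K

variable {p : ℝ}

/-- The linear part of the left translation by `a`, which is an affine map. -/
def leftCLM (a : K p) : (Fin 3 → ℝ) →L[ℝ] (Fin 3 → ℝ) :=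
  ContinuousLinearMap.pi ![Real.exp (p * a 2) • ContinuousLinearMap.proj 0,
    Real.exp (-(p * a 2)) • ContinuousLinearMap.proj 1, ContinuousLinearMap.proj 2]

@[simp] theorem leftCLM_0 (a : K p) (v : Fin 3 → ℝ) :
    leftCLM a v 0 = Real.exp (p * a 2) * v 0 := rfl
@[simp] theorem leftCLM_1 (a : K p) (v : Fin 3 → ℝ) :
    leftCLM a v 1 = Real.exp (-(p * a 2)) * v 1 := rfl
@[simp] theorem leftCLM_2 (a : K p) (v : Fin 3 → ℝ) : leftCLM a v 2 = v 2 := rfl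

theorem hasMFDerivAt_mul_left (a g : K p) :
    HasMFDerivAt 𝓘(ℝ, Fin 3 → ℝ) 𝓘(ℝ, Fin 3 → ℝ) (fun h : K p => a * h) g (leftCLM a) := by
  let a' : Fin 3 → ℝ := a
  have h : HasFDerivAt (fun h : Fin 3 → ℝ => a' + leftCLM a h) (leftCLM a) g :=
    (leftCLM a).hasFDerivAt.const_add _
  have e : (fun h : Fin 3 → ℝ => a' + leftCLM a h) = fun h : K p => a * h := by
    funext h
    refine ext' rfl rfl rfl
  rw [e] at h
  exact h.hasMFDerivAt

end K

section OneForm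

variable {E H M : Type*} [NormedAddCommGroup E] [NormedSpace ℝ E] [TopologicalSpace H]
  [TopologicalSpace M] [ChartedSpace H M] {I : ModelWithCorners ℝ E H}
  {E' H' M' : Type*} [NormedAddCommGroup E'] [NormedSpace ℝ E'] [TopologicalSpace H']
  [TopologicalSpace M'] [ChartedSpace H' M'] {I' : ModelWithCorners ℝ E' H'}

/-- Reduces invariance of a one-form under a translation to an identity between its coefficient
functionals. -/
theorem pullback_oneForm_eq {f : M → M'} {x : M} {A : E →L[ℝ] E'} (h : HasMFDerivAt I I' f x A)
    (a : M → E →L[ℝ] ℝ) (b : M' → E' →L[ℝ] ℝ) (hab : ∀ v : E, b (f x) (A v) = a x v) :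
    pullback I I' f (oneForm I' b) x = oneForm I a x := by
  ext v
  rw [pullback_apply, h.mfderiv]
  exact hab (v 0)

end OneForm

namespace LatticeData

variable (L : LatticeData)

theorem projG_eq_iff {g h : G L.p} : L.projG g = L.projG h ↔ ∃ γ ∈ L.Γ, γ * g = h := by
  constructor
  · intro hh
    obtain ⟨γ, hγ⟩ := Quotient.exact hh.symm
    exact ⟨γ, γ.2, hγ⟩
  · rintro ⟨γ, hγ, rfl⟩
    exact (Quotient.sound ⟨⟨γ, hγ⟩, rfl⟩ : L.projG (γ * g) = L.projG g).symm

theorem projG_mul {γ : G L.p} (hγ : γ ∈ L.Γ) (g : G L.p) : L.projG (γ * g) = L.projG g :=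
  (L.projG_eq_iff.2 ⟨γ, hγ, rfl⟩).symm

theorem isLocalHomeomorph_projG : IsLocalHomeomorph L.projG :=
  (isQuotientCoveringMap_quotientMk_of_properlyDiscontinuousSMul (G := L.Γ)
    (E := G L.p)).isCoveringMap.isLocalHomeomorph

theorem isLocalDiffeomorph_projG :
    IsLocalDiffeomorph 𝓘(ℝ, Fin 5 → ℝ) 𝓘(ℝ, Fin 5 → ℝ) ∞ L.projG := by
  refine isLocalDiffeomorph_of_isLocalHomeomorph L.isLocalHomeomorph_projG L.projG_surjective ?_
  intro a b hab
  obtain ⟨γ, hγ, h⟩ := L.projG_eq_iff.1 hab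
  exact ⟨fun c => γ * c, contMDiff_mul_left, h, fun c => L.projG_mul hγ c⟩

/-- A chart is a branch of the inverse of `projG` followed by the identity chart of `ℝ⁵`. The
equality holds on all of `ℝ⁵` and the right side does not depend on `x`, so all local expressions
are computed once, upstairs. -/
theorem extChartAt_symm (x : L.GHat) :
    ((extChartAt 𝓘(ℝ, Fin 5 → ℝ) x).symm : (Fin 5 → ℝ) → L.GHat) = L.projG :=
  funext fun w => congrFun (L.isLocalHomeomorph_projG.localInverseAt_symm _) w

/-- Left invariance of `η`: under translation by `γ`, the terms `γ₀ e^{-pγ₃} dy` and `γ₄ du` that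
`dz` acquires cancel the shifts of the coefficients `x` and `t`. -/
theorem pullback_ηHat :
    pullback 𝓘(ℝ, Fin 5 → ℝ) 𝓘(ℝ, Fin 5 → ℝ) L.projG L.ηHat = L.η := by
  refine pullback_descend L.projG_surjective L.isLocalDiffeomorph_projG ?_
  intro a b hab
  obtain ⟨γ, hγ, h⟩ := L.projG_eq_iff.1 hab
  have hd := G.hasMFDerivAt_mul_left γ a
  refine ⟨fun c => γ * c, hd.mdifferentiableAt, h, fun c => L.projG_mul hγ c, ?_⟩
  refine pullback_oneForm_eq hd _ _ fun v => ?_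
  have e : Real.exp (-(L.p * γ 3)) * Real.exp (L.p * γ 3) = 1 := by rw [← Real.exp_add]; simp
  simp
  linear_combination (-(a 0 * v 1)) * e

/-- In a product the second factor's `z` enters only the third coordinate, with coefficient one, so
every left translation preserves `∂/∂z`. -/
theorem mfderiv_projG_ξ (g : G L.p) :
    mfderiv 𝓘(ℝ, Fin 5 → ℝ) 𝓘(ℝ, Fin 5 → ℝ) L.projG g (L.ξ g) = L.ξHat (L.projG g) := by
  refine mfderiv_descendField L.projG_surjective L.isLocalDiffeomorph_projG ?_ g
  intro a b hab
  obtain ⟨γ, hγ, h⟩ := L.projG_eq_iff.1 hab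
  have hd := G.hasMFDerivAt_mul_left γ a
  refine ⟨fun c => γ * c, hd.mdifferentiableAt, h, fun c => L.projG_mul hγ c, ?_⟩
  rw [hd.mfderiv]
  change G.leftCLM γ (Pi.single 2 1 : Fin 5 → ℝ) = (Pi.single 2 1 : Fin 5 → ℝ)
  funext i
  fin_cases i
  · change G.leftCLM γ _ 0 = _
    simp
  · change G.leftCLM γ _ 1 = _
    simp
  · change G.leftCLM γ _ 2 = _
    simp
  · rfl
  · rfl

end LatticeData

namespace EigenData

variable (D : EigenData)

theorem projK_eq_iff {g h : K D.p} : D.projK g = D.projK h ↔ ∃ γ ∈ D.ΓK, γ * g = h := by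
  constructor
  · intro hh
    obtain ⟨γ, hγ⟩ := Quotient.exact hh.symm
    exact ⟨γ, γ.2, hγ⟩
  · rintro ⟨γ, hγ, rfl⟩
    exact (Quotient.sound ⟨⟨γ, hγ⟩, rfl⟩ : D.projK (γ * g) = D.projK g).symm

theorem projK_mul {γ : K D.p} (hγ : γ ∈ D.ΓK) (g : K D.p) : D.projK (γ * g) = D.projK g :=
  (D.projK_eq_iff.2 ⟨γ, hγ, rfl⟩).symm

theorem isLocalHomeomorph_projK : IsLocalHomeomorph D.projK :=
  (isQuotientCoveringMap_quotientMk_of_properlyDiscontinuousSMul (G := D.ΓK)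
    (E := K D.p)).isCoveringMap.isLocalHomeomorph

theorem isLocalDiffeomorph_projK :
    IsLocalDiffeomorph 𝓘(ℝ, Fin 3 → ℝ) 𝓘(ℝ, Fin 3 → ℝ) ∞ D.projK := by
  refine isLocalDiffeomorph_of_isLocalHomeomorph D.isLocalHomeomorph_projK D.projK_surjective ?_
  intro a b hab
  obtain ⟨γ, hγ, h⟩ := D.projK_eq_iff.1 hab
  exact ⟨fun c => γ * c, contMDiff_mul_left, h, fun c => D.projK_mul hγ c⟩

theorem isLocalDiffeomorph_projS1 : IsLocalDiffeomorph 𝓘(ℝ, ℝ) 𝓘(ℝ, ℝ) ∞ D.projS1 :=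
  isLocalDiffeomorph_of_isLocalHomeomorph (AddCircle.isLocalHomeomorph_coe D.z₂)
    D.projS1_surjective D.deck_S1

theorem pullback_descend_K {c : K D.p → (Fin 3 → ℝ) →L[ℝ] ℝ}
    (hc : ∀ (γ g : K D.p) (v : Fin 3 → ℝ), c (γ * g) (K.leftCLM γ v) = c g v) :
    pullback 𝓘(ℝ, Fin 3 → ℝ) 𝓘(ℝ, Fin 3 → ℝ) D.projK
      (descend 𝓘(ℝ, Fin 3 → ℝ) 𝓘(ℝ, Fin 3 → ℝ) D.projK_surjective (oneForm _ c)) =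
        oneForm _ c := by
  refine pullback_descend D.projK_surjective D.isLocalDiffeomorph_projK ?_
  intro a b hab
  obtain ⟨γ, hγ, h⟩ := D.projK_eq_iff.1 hab
  have hd := K.hasMFDerivAt_mul_left γ a
  exact ⟨fun c => γ * c, hd.mdifferentiableAt, h, fun c => D.projK_mul hγ c,
    pullback_oneForm_eq hd _ _ fun v => hc _ _ v⟩

/-- Translation by `γ` multiplies `dx` by `e^{pγ₂}` and the coefficient `e^{-pu}` by the reciprocal;
for `βK` the two factors are exchanged. -/
theorem pullback_αKHat :
    pullback 𝓘(ℝ, Fin 3 → ℝ) 𝓘(ℝ, Fin 3 → ℝ) D.projK D.αKHat = D.αK := by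
  refine D.pullback_descend_K fun γ g v => ?_
  have e : Real.exp (-(D.p * γ 2)) * Real.exp (D.p * γ 2) = 1 := by rw [← Real.exp_add]; simp
  simp [mul_add, Real.exp_add]
  linear_combination (Real.exp (-(D.p * g 2)) * v 0) * e

theorem pullback_βKHat :
    pullback 𝓘(ℝ, Fin 3 → ℝ) 𝓘(ℝ, Fin 3 → ℝ) D.projK D.βKHat = D.βK := by
  refine D.pullback_descend_K fun γ g v => ?_
  have e : Real.exp (-(D.p * γ 2)) * Real.exp (D.p * γ 2) = 1 := by rw [← Real.exp_add]; simp
  simp [mul_add, Real.exp_add]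
  linear_combination (Real.exp (D.p * g 2) * v 1) * e

theorem pullback_θKHat :
    pullback 𝓘(ℝ, Fin 3 → ℝ) 𝓘(ℝ, Fin 3 → ℝ) D.projK D.θKHat = D.θK :=
  D.pullback_descend_K fun _ _ _ => by simp

theorem pullback_ωHat : pullback 𝓘(ℝ, ℝ) 𝓘(ℝ, ℝ) D.projS1 D.ωHat = dt := by
  refine pullback_descend D.projS1_surjective D.isLocalDiffeomorph_projS1 ?_
  intro a b hab
  have hd : HasMFDerivAt 𝓘(ℝ, ℝ) 𝓘(ℝ, ℝ) (fun c : ℝ => (b - a) + c) a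
      (ContinuousLinearMap.id ℝ ℝ) := ((hasFDerivAt_id a).const_add (b - a)).hasMFDerivAt
  refine ⟨_, hd.mdifferentiableAt, by ring, fun c => ?_, pullback_oneForm_eq hd _ _ fun v => rfl⟩
  change ((b - a + c : ℝ) : D.S1) = c
  have : (a : D.S1) = b := hab
  rw [AddCircle.coe_add, AddCircle.coe_sub, this, sub_self, zero_add]

end EigenData

/-! ### Forms and differentials in the preferred charts -/

section Forms

variable {E H M : Type*} [NormedAddCommGroup E] [NormedSpace ℝ E] [TopologicalSpace H]
  [TopologicalSpace M] [ChartedSpace H M]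
  {E' H' M' : Type*} [NormedAddCommGroup E'] [NormedSpace ℝ E'] [TopologicalSpace H']
  [TopologicalSpace M'] [ChartedSpace H' M']
  {E'' H'' M'' : Type*} [NormedAddCommGroup E''] [NormedSpace ℝ E''] [TopologicalSpace H'']
  [TopologicalSpace M''] [ChartedSpace H'' M'']
  {I : ModelWithCorners ℝ E H} {I' : ModelWithCorners ℝ E' H'} {I'' : ModelWithCorners ℝ E'' H''}

/-- A map is smooth at the image of a point under a local diffeomorphism if its composition with
the local diffeomorphism is smooth at the point. -/
theorem contMDiffAt_of_comp_isLocalDiffeomorphAt {q : M → M'} {f : M' → M''} {a : M}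
    (hq : IsLocalDiffeomorphAt I I' ∞ q a) (h : ContMDiffAt I I'' ∞ (f ∘ q) a) :
    ContMDiffAt I' I'' ∞ f (q a) := by
  have h1 := hq.localInverse_contMDiffAt
  have ha : hq.localInverse (q a) = a := hq.localInverse_left_inv hq.localInverse_mem_target
  have h2 : ContMDiffAt I' I'' ∞ ((f ∘ q) ∘ hq.localInverse) (q a) :=
    ContMDiffAt.comp (q a) (by rw [ha]; exact h) h1
  refine h2.congr_of_eventuallyEq ?_
  filter_upwards [hq.localInverse_eventuallyEq_right] with y hy
  have hy' : q (hq.localInverse y) = y := hy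
  change f y = f (q (hq.localInverse y))
  rw [hy']

/-- The differentials of a chart and of its inverse, as a linear isomorphism. -/
theorem exists_chart_equiv [IsManifold I ∞ M] [I.Boundaryless] (x : M) :
    ∃ T : E ≃L[ℝ] E, (∀ v : E, mfderiv I 𝓘(ℝ, E) (extChartAt I x) x v = T v) ∧
      ∀ u : E, mfderiv 𝓘(ℝ, E) I (extChartAt I x).symm (extChartAt I x x) u = T.symm u := by
  have : IsManifold I 1 M := IsManifold.of_le (n := ∞) (by simp)
  have h1 := mfderiv_extChartAt_comp_mfderivWithin_extChartAt_symm' (I := I)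
    (mem_extChartAt_source (I := I) x)
  have h2 := mfderivWithin_extChartAt_symm_comp_mfderiv_extChartAt' (I := I)
    (mem_extChartAt_source (I := I) x)
  -- Without boundary the model has full range, so derivatives within the range are ordinary
  -- derivatives.
  rw [I.range_eq_univ, mfderivWithin_univ] at h1 h2
  let A : E →L[ℝ] E := mfderiv I 𝓘(ℝ, E) (extChartAt I x) x
  let B : E →L[ℝ] E := mfderiv 𝓘(ℝ, E) I (extChartAt I x).symm (extChartAt I x x)
  exact ⟨ContinuousLinearEquiv.equivOfInverse A B (fun v => DFunLike.congr_fun h2 v)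
    (fun v => DFunLike.congr_fun h1 v), fun v => rfl, fun u => rfl⟩

/-- The value of a form at a point, in terms of its expression in the preferred chart. -/
theorem apply_eq_localForm [IsManifold I ∞ M] [I.Boundaryless] {k : ℕ} (σ : DForm I M k) (x : M)
    (v : Fin k → E) :
    (σ x : E [⋀^Fin k]→L[ℝ] ℝ) v = localForm I σ x (extChartAt I x x)
      (fun i => mfderiv I 𝓘(ℝ, E) (extChartAt I x) x (v i)) := by
  obtain ⟨T, hT, hT'⟩ := exists_chart_equiv (I := I) x
  have hx : (extChartAt I x).symm (extChartAt I x x) = x := extChartAt_to_inv x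
  let F : M → E [⋀^Fin k]→L[ℝ] ℝ := σ
  change F x v = F ((extChartAt I x).symm (extChartAt I x x)) _
  rw [hx]
  congr 1
  funext i
  refine (?_ : v i = T.symm (T (v i))).trans ?_
  · exact (T.symm_apply_apply _).symm
  · rw [← hT', ← hT]
    rfl

theorem wedgeAlt_comp (a b : E' [⋀^Fin 1]→L[ℝ] ℝ) (A : E →L[ℝ] E') :
    (wedgeAlt a b).compContinuousLinearMap A =
      wedgeAlt (a.compContinuousLinearMap A) (b.compContinuousLinearMap A) := by
  ext v
  have hv : v = ![v 0, v 1] := by funext i; fin_cases i <;> rfl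
  have e1 : ∀ u : E, (A ∘ ![u] : Fin 1 → E') = ![A u] := fun u => by
    funext i; fin_cases i; rfl
  have e2 : ∀ u w : E, (A ∘ ![u, w] : Fin 2 → E') = ![A u, A w] := fun u w => by
    funext i; fin_cases i <;> rfl
  rw [hv, wedgeAlt_apply, ContinuousAlternatingMap.compContinuousLinearMap_apply, e2,
    wedgeAlt_apply]
  simp only [ContinuousAlternatingMap.compContinuousLinearMap_apply, e1]

theorem pullback_wedge (f : M → M') (α β : DForm I' M' 1) :
    pullback I I' f (wedge I' α β) = wedge I (pullback I I' f α) (pullback I I' f β) :=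
  funext fun x => wedgeAlt_comp (E := E) (E' := E') (α (f x)) (β (f x)) (mfderiv I I' f x)

theorem extDeriv_const {k : ℕ} (c : E [⋀^Fin k]→L[ℝ] ℝ) (x : E) :
    extDeriv (fun _ : E => c) x = 0 := by
  rw [extDeriv, fderiv_const_apply]
  exact map_zero (ContinuousAlternatingMap.alternatizeUncurryFinCLM ℝ E ℝ)

end Forms

/-! ## The contact form -/

/-- The form `η = dz - x dy - t du` on `ℝ⁵`. -/
def ηE (a : Fin 5 → ℝ) : (Fin 5 → ℝ) [⋀^Fin 1]→L[ℝ] ℝ :=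
  ContinuousAlternatingMap.ofSubsingletonLIE (𝕜 := ℝ) (E := Fin 5 → ℝ) (F := ℝ) (0 : Fin 1)
    (ContinuousLinearMap.proj 2 - a 0 • ContinuousLinearMap.proj 1 -
      a 4 • ContinuousLinearMap.proj 3)

theorem ηE_apply (a : Fin 5 → ℝ) (v : Fin 1 → Fin 5 → ℝ) :
    ηE a v = v 0 2 - a 0 * v 0 1 - a 4 * v 0 3 := rfl

theorem contDiff_ηE : ContDiff ℝ ∞ ηE := by
  -- The identification of linear functionals with one-forms is a linear isometry, so only the
  -- affine dependence of the functional on `a` remains.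
  refine (ContinuousAlternatingMap.ofSubsingletonLIE (𝕜 := ℝ) (E := Fin 5 → ℝ) (F := ℝ) (0 : Fin 1)).contDiff.comp ?_
  fun_prop

/-- Only the coefficients `x` and `t` vary, contributing `-dx ∧ dy` and `-dt ∧ du`. The result is
independent of `a`, which is why it can come from a constant form on the base. -/
theorem extDeriv_ηE (a v w : Fin 5 → ℝ) :
    extDeriv ηE a ![v, w] = -((v 0 * w 1 - w 0 * v 1) + (v 4 * w 3 - w 4 * v 3)) := by
  rw [extDeriv_apply (contDiff_ηE.differentiable (by simp) a)]
  have h : ∀ (v : Fin 1 → Fin 5 → ℝ) (w : Fin 5 → ℝ), fderiv ℝ (fun a => ηE a v) a w =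
      - w 0 * v 0 1 - w 4 * v 0 3 := by
    intro v w
    have h1 : HasFDerivAt (fun a : Fin 5 → ℝ => v 0 2 - a 0 * v 0 1 - a 4 * v 0 3) _ a :=
      (((hasFDerivAt_const (v 0 2) a).sub ((hasFDerivAt_apply (𝕜 := ℝ) 0 a).mul_const (v 0 1))).sub
        ((hasFDerivAt_apply (𝕜 := ℝ) 4 a).mul_const (v 0 3)))
    have h2 : (fun a => ηE a v) = fun a : Fin 5 → ℝ => v 0 2 - a 0 * v 0 1 - a 4 * v 0 3 := rfl
    rw [h2, h1.fderiv]
    simp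
    ring
  rw [Fin.sum_univ_two, h, h]
  simp [Fin.removeNth]
  ring

namespace LatticeData

variable (L : LatticeData)

theorem localForm_GHat {k : ℕ} (σ : DForm 𝓘(ℝ, Fin 5 → ℝ) L.GHat k) (x : L.GHat) :
    localForm 𝓘(ℝ, Fin 5 → ℝ) σ x =
      pullback 𝓘(ℝ, Fin 5 → ℝ) 𝓘(ℝ, Fin 5 → ℝ) L.projG σ := by
  rw [localForm, L.extChartAt_symm]
  rfl

theorem localForm_ηHat (x : L.GHat) : localForm 𝓘(ℝ, Fin 5 → ℝ) L.ηHat x = ηE := by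
  rw [L.localForm_GHat, L.pullback_ηHat]
  rfl

/-- Coordinates at a point of `Ĝ(p)` in which `η̂`, `dη̂` and `ξ̂` are `η`, `dη` and `ξ`. -/
theorem exists_frame (x : L.GHat) : ∃ (a : Fin 5 → ℝ) (T : (Fin 5 → ℝ) ≃L[ℝ] (Fin 5 → ℝ)),
    (∀ v : Fin 5 → ℝ, L.ηHat x ![v] = ηE a ![T v]) ∧
    (∀ v w : Fin 5 → ℝ, dExt 𝓘(ℝ, Fin 5 → ℝ) L.ηHat x ![v, w] = extDeriv ηE a ![T v, T w]) ∧
    T (L.ξHat x) = Pi.single 2 1 := by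
  obtain ⟨T, hT, hT'⟩ := exists_chart_equiv (I := 𝓘(ℝ, Fin 5 → ℝ)) x
  refine ⟨extChartAt 𝓘(ℝ, Fin 5 → ℝ) x x, T, fun v => ?_, fun v w => ?_, ?_⟩
  · refine (apply_eq_localForm L.ηHat x ![v]).trans ?_
    rw [L.localForm_ηHat]
    refine congrArg (ηE _) ?_
    funext i
    fin_cases i
    exact hT v
  · rw [dExt, L.localForm_ηHat]
    refine congrArg (extDeriv ηE (extChartAt 𝓘(ℝ, Fin 5 → ℝ) x x)) ?_
    funext i
    fin_cases i
    · exact hT v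
    · exact hT w
  · have hx : L.projG (extChartAt 𝓘(ℝ, Fin 5 → ℝ) x x) = x := by
      rw [← L.extChartAt_symm x, extChartAt_to_inv]
    have h := L.mfderiv_projG_ξ (extChartAt 𝓘(ℝ, Fin 5 → ℝ) x x)
    rw [L.extChartAt_symm x] at hT'
    have h2 : L.ξHat (L.projG (extChartAt 𝓘(ℝ, Fin 5 → ℝ) x x)) =
      T.symm (Pi.single 2 1 : Fin 5 → ℝ) := h.symm.trans (hT' _)
    -- `F` forgets that the value lies in a tangent space depending on the point, so that the base
    -- point can be rewritten.
    let F : L.GHat → (Fin 5 → ℝ) := L.ξHat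
    change F _ = _ at h2
    rw [hx] at h2
    change T (F x) = _
    rw [h2, T.apply_symm_apply]

theorem isContactForm_ηHat : IsContactForm 𝓘(ℝ, Fin 5 → ℝ) L.ηHat where
  smooth x := by
    rw [L.localForm_ηHat]
    exact contDiff_ηE.contDiffOn
  ne_zero x h := by
    obtain ⟨a, T, hη, -, -⟩ := L.exists_frame x
    have h1 : L.ηHat x ![T.symm (Pi.single 2 1)] = 0 := by rw [h]; rfl
    rw [hη, ηE_apply] at h1
    simp at h1
  nondegenerate x v hv hw := by
    obtain ⟨a, T, hη, hd, -⟩ := L.exists_frame x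
    replace hv := (hη v).symm.trans hv
    rw [ηE_apply] at hv
    have key : ∀ w : Fin 5 → ℝ, w 2 - a 0 * w 1 - a 4 * w 3 = 0 →
        extDeriv ηE a ![T v, w] = 0 := by
      intro w h
      have h1 := (hd v (T.symm w)).symm.trans (hw (T.symm w) (by
        refine (hη _).trans ?_
        rw [ηE_apply]
        simpa using h))
      rwa [T.apply_symm_apply] at h1
    -- These four vectors span `ker η` at `a`. Pairing `T v` with them in `dη` kills its `y`, `x`,
    -- `t` and `u` components in turn; `η(T v) = 0` then kills the `z` component.
    have k0 := key ![1, 0, 0, 0, 0] (by simp)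
    have k1 := key ![0, 1, a 0, 0, 0] (by simp)
    have k3 := key ![0, 0, a 4, 1, 0] (by simp)
    have k4 := key ![0, 0, 0, 0, 1] (by simp)
    rw [extDeriv_ηE] at k0 k1 k3 k4
    simp at k0 k1 k3 k4 hv
    have hz : T v = 0 := by
      funext i
      fin_cases i
      · exact k1
      · exact k0
      · change T v 2 = 0
        rw [k0, k4] at hv
        simpa using hv
      · exact k4
      · exact k3
    exact (map_eq_zero_iff T T.injective).1 hz

theorem isReebField_ξHat : IsReebField 𝓘(ℝ, Fin 5 → ℝ) L.ηHat L.ξHat where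
  apply_eq_one x := by
    obtain ⟨a, T, hη, -, hξ⟩ := L.exists_frame x
    refine (hη (L.ξHat x)).trans ?_
    rw [hξ, ηE_apply]
    simp
  contract_eq_zero x w := by
    obtain ⟨a, T, -, hd, hξ⟩ := L.exists_frame x
    refine (hd (L.ξHat x) w).trans ?_
    rw [hξ, extDeriv_ηE]
    simp

end LatticeData

/-! ## The base -/

/-- The coordinate form `dxᵢ` of `ℝ³`, on `ℝ³ × ℝ`. -/
def dx (i : Fin 3) : ((Fin 3 → ℝ) × ℝ) [⋀^Fin 1]→L[ℝ] ℝ :=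
  ContinuousAlternatingMap.ofSubsingleton ℝ ((Fin 3 → ℝ) × ℝ) ℝ (0 : Fin 1)
    ((ContinuousLinearMap.proj i).comp (ContinuousLinearMap.fst ℝ (Fin 3 → ℝ) ℝ))

/-- The form `-(dx ∧ dy + dt ∧ du)` on `ℝ³ × ℝ`. -/
def Ω₀ : ((Fin 3 → ℝ) × ℝ) [⋀^Fin 2]→L[ℝ] ℝ :=
  -(wedgeAlt (dx 0) (dx 1) +
    wedgeAlt (ContinuousAlternatingMap.ofSubsingleton ℝ ((Fin 3 → ℝ) × ℝ) ℝ (0 : Fin 1)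
      (ContinuousLinearMap.snd ℝ (Fin 3 → ℝ) ℝ)) (dx 2))

theorem Ω₀_apply (v w : (Fin 3 → ℝ) × ℝ) :
    Ω₀ ![v, w] = -((v.1 0 * w.1 1 - w.1 0 * v.1 1) + (v.2 * w.1 2 - w.2 * v.1 2)) := by
  change -(wedgeAlt (dx 0) (dx 1) ![v, w] + wedgeAlt _ (dx 2) ![v, w]) = _
  rw [wedgeAlt_apply, wedgeAlt_apply]
  rfl

namespace EigenData

variable (D : EigenData)

/-- The projection `K × ℝ → K̂ × S¹`. -/
def projBase : (Fin 3 → ℝ) × ℝ → D.Base := Prod.map D.projK D.projS1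

theorem contMDiff_projBase :
    ContMDiff 𝓘(ℝ, (Fin 3 → ℝ) × ℝ) IBase ∞ D.projBase := by
  have h1 : ContMDiff 𝓘(ℝ, (Fin 3 → ℝ) × ℝ) 𝓘(ℝ, Fin 3 → ℝ) ∞
      (fun w : (Fin 3 → ℝ) × ℝ => D.projK w.1) :=
    D.isLocalDiffeomorph_projK.contMDiff.comp (contDiff_fst.contMDiff)
  have h2 : ContMDiff 𝓘(ℝ, (Fin 3 → ℝ) × ℝ) 𝓘(ℝ, ℝ) ∞
      (fun w : (Fin 3 → ℝ) × ℝ => D.projS1 w.2) :=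
    D.isLocalDiffeomorph_projS1.contMDiff.comp (contDiff_snd.contMDiff)
  exact h1.prodMk h2

theorem mdifferentiable_projBase : MDifferentiable 𝓘(ℝ, (Fin 3 → ℝ) × ℝ) IBase D.projBase :=
  D.contMDiff_projBase.mdifferentiable (by simp)

/-- The charts of the base are products of local inverses, so here too local forms are pullbacks
along a single global projection. -/
theorem extChartAt_base_symm (b : D.Base) :
    ((extChartAt IBase b).symm : (Fin 3 → ℝ) × ℝ → D.Base) = D.projBase := by
  funext w
  refine Prod.ext ?_ ?_
  · exact congrFun (D.isLocalHomeomorph_projK.localInverseAt_symm _) w.1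
  · exact congrFun ((AddCircle.isLocalHomeomorph_coe D.z₂).localInverseAt_symm _) w.2

theorem localForm_base {k : ℕ} (σ : DForm IBase D.Base k) (b : D.Base) :
    localForm IBase σ b = pullback 𝓘(ℝ, (Fin 3 → ℝ) × ℝ) IBase D.projBase σ := by
  rw [localForm, D.extChartAt_base_symm]

/-- The projection `K × ℝ → K`. -/
def fstK (w : (Fin 3 → ℝ) × ℝ) : K D.p := w.1

/-- The square formed by the two first projections, `projBase` and `projK` commutes; the pullback is
therefore computed through `K`, where `α` is known. -/
theorem pullback_fromK (α : DForm 𝓘(ℝ, Fin 3 → ℝ) D.KHat 1) {c : K D.p → (Fin 3 → ℝ) →L[ℝ] ℝ}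
    (h : pullback 𝓘(ℝ, Fin 3 → ℝ) 𝓘(ℝ, Fin 3 → ℝ) D.projK α = oneForm _ c)
    (w : (Fin 3 → ℝ) × ℝ) :
    pullback 𝓘(ℝ, (Fin 3 → ℝ) × ℝ) IBase D.projBase (D.fromK α) w =
      ContinuousAlternatingMap.ofSubsingleton ℝ ((Fin 3 → ℝ) × ℝ) ℝ (0 : Fin 1)
        ((c w.1).comp (ContinuousLinearMap.fst ℝ (Fin 3 → ℝ) ℝ)) := by
  have e1 := pullback_comp_apply (I := 𝓘(ℝ, (Fin 3 → ℝ) × ℝ)) (I' := IBase)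
    (I'' := 𝓘(ℝ, Fin 3 → ℝ)) (f := D.projBase) (g := Prod.fst) α (x := w)
    mdifferentiableAt_fst (D.mdifferentiable_projBase w)
  have hfst : HasMFDerivAt 𝓘(ℝ, (Fin 3 → ℝ) × ℝ) 𝓘(ℝ, Fin 3 → ℝ)
      D.fstK w (ContinuousLinearMap.fst ℝ (Fin 3 → ℝ) ℝ) :=
    (hasFDerivAt_fst (𝕜 := ℝ) (p := w)).hasMFDerivAt
  have e2 := pullback_comp_apply (I := 𝓘(ℝ, (Fin 3 → ℝ) × ℝ)) (I' := 𝓘(ℝ, Fin 3 → ℝ))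
    (I'' := 𝓘(ℝ, Fin 3 → ℝ)) (f := D.fstK) (g := D.projK) α (x := w)
    (D.isLocalDiffeomorph_projK.mdifferentiable (by simp) _) hfst.mdifferentiableAt
  refine (e1.symm.trans e2).trans ?_
  rw [h]
  exact pullback_oneForm_eq hfst
    (fun w => (c w.1).comp (ContinuousLinearMap.fst ℝ (Fin 3 → ℝ) ℝ)) c fun v => rfl

theorem pullback_fromS1_ωHat (w : (Fin 3 → ℝ) × ℝ) :
    pullback 𝓘(ℝ, (Fin 3 → ℝ) × ℝ) IBase D.projBase (D.fromS1 D.ωHat) w =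
      ContinuousAlternatingMap.ofSubsingleton ℝ ((Fin 3 → ℝ) × ℝ) ℝ (0 : Fin 1)
        (ContinuousLinearMap.snd ℝ (Fin 3 → ℝ) ℝ) := by
  have e1 := pullback_comp_apply (I := 𝓘(ℝ, (Fin 3 → ℝ) × ℝ)) (I' := IBase)
    (I'' := 𝓘(ℝ, ℝ)) (f := D.projBase) (g := Prod.snd) D.ωHat (x := w)
    mdifferentiableAt_snd (D.mdifferentiable_projBase w)
  have hsnd : HasMFDerivAt 𝓘(ℝ, (Fin 3 → ℝ) × ℝ) 𝓘(ℝ, ℝ)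
      (Prod.snd : (Fin 3 → ℝ) × ℝ → ℝ) w (ContinuousLinearMap.snd ℝ (Fin 3 → ℝ) ℝ) :=
    (hasFDerivAt_snd (𝕜 := ℝ) (p := w)).hasMFDerivAt
  have e2 := pullback_comp_apply (I := 𝓘(ℝ, (Fin 3 → ℝ) × ℝ)) (I' := 𝓘(ℝ, ℝ))
    (I'' := 𝓘(ℝ, ℝ)) (f := (Prod.snd : (Fin 3 → ℝ) × ℝ → ℝ)) (g := D.projS1) D.ωHat (x := w)
    (D.isLocalDiffeomorph_projS1.mdifferentiable (by simp) _) hsnd.mdifferentiableAt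
  refine (e1.symm.trans e2).trans ?_
  rw [D.pullback_ωHat]
  exact pullback_oneForm_eq hsnd
    (fun w => ContinuousLinearMap.snd ℝ (Fin 3 → ℝ) ℝ) (fun _ => ContinuousLinearMap.id ℝ ℝ)
    fun v => rfl

/-- The factors `e^{-pu}` and `e^{pu}` cancel in the first wedge product and the second has none.
The pullback being constant, smoothness and closedness of `Ω̂` are immediate. -/
theorem pullback_ΩHat :
    pullback 𝓘(ℝ, (Fin 3 → ℝ) × ℝ) IBase D.projBase D.ΩHat = fun _ => Ω₀ := by
  have e : pullback 𝓘(ℝ, (Fin 3 → ℝ) × ℝ) IBase D.projBase D.ΩHat =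
      -(pullback 𝓘(ℝ, (Fin 3 → ℝ) × ℝ) IBase D.projBase
          (wedge IBase (D.fromK D.αKHat) (D.fromK D.βKHat)) +
        pullback 𝓘(ℝ, (Fin 3 → ℝ) × ℝ) IBase D.projBase
          (wedge IBase (D.fromS1 D.ωHat) (D.fromK D.θKHat))) := rfl
  rw [e, pullback_wedge, pullback_wedge]
  funext w
  have hα := D.pullback_fromK _ D.pullback_αKHat w
  have hβ := D.pullback_fromK _ D.pullback_βKHat w
  have hθ := D.pullback_fromK _ D.pullback_θKHat w
  have hω := D.pullback_fromS1_ωHat w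
  change -(wedgeAlt (E := (Fin 3 → ℝ) × ℝ) _ _ + wedgeAlt (E := (Fin 3 → ℝ) × ℝ) _ _) = _
  rw [hα, hβ, hθ, hω]
  refine ContinuousAlternatingMap.ext fun v => ?_
  have hv : v = ![v 0, v 1] := by funext i; fin_cases i <;> rfl
  rw [hv, Ω₀_apply]
  change -(wedgeAlt _ _ ![v 0, v 1] + wedgeAlt _ _ ![v 0, v 1]) = _
  rw [wedgeAlt_apply, wedgeAlt_apply]
  have h1 : Real.exp (-(D.p * w.1 2)) * Real.exp (D.p * w.1 2) = 1 := by
    rw [← Real.exp_add]; simp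
  change -((Real.exp (-(D.p * w.1 2)) * (v 0).1 0) * (Real.exp (D.p * w.1 2) * (v 1).1 1) -
    (Real.exp (-(D.p * w.1 2)) * (v 1).1 0) * (Real.exp (D.p * w.1 2) * (v 0).1 1) +
    ((v 0).2 * (v 1).1 2 - (v 1).2 * (v 0).1 2)) = _
  linear_combination (-((v 0).1 0 * (v 1).1 1 - (v 1).1 0 * (v 0).1 1)) * h1

theorem localForm_ΩHat (b : D.Base) : localForm IBase D.ΩHat b = fun _ => Ω₀ := by
  rw [D.localForm_base, D.pullback_ΩHat]

theorem isSymplecticForm_ΩHat : IsSymplecticForm IBase D.ΩHat where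
  smooth b := by
    rw [D.localForm_ΩHat]
    exact contDiffOn_const
  closed := by
    funext b
    rw [dExt, D.localForm_ΩHat, extDeriv_const]
    rfl
  nondegenerate b v hv := by
    obtain ⟨T, hT, -⟩ := exists_chart_equiv (I := IBase) b
    have key : ∀ w : (Fin 3 → ℝ) × ℝ, Ω₀ ![T v, w] = 0 := by
      intro w
      have h := (apply_eq_localForm D.ΩHat b ![v, T.symm w]).symm.trans (hv (T.symm w))
      rw [D.localForm_ΩHat] at h
      refine Eq.trans (congrArg Ω₀ ?_) h
      funext i
      fin_cases i
      · exact (hT v).symm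
      · exact (T.apply_symm_apply w).symm.trans (hT (T.symm w)).symm
    -- `Ω₀` pairs `x` with `y` and `t` with `u`, so each basis vector detects the coordinate of its
    -- partner.
    have k0 := key (![1, 0, 0], 0)
    have k1 := key (![0, 1, 0], 0)
    have k2 := key (![0, 0, 1], 0)
    have k3 := key (![0, 0, 0], 1)
    rw [Ω₀_apply] at k0 k1 k2 k3
    simp at k0 k1 k2 k3
    have hz : T v = 0 := by
      refine Prod.ext (funext fun i => ?_) k2
      fin_cases i
      · exact k1
      · exact k0
      · exact k3
    exact (map_eq_zero_iff T T.injective).1 hz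

end EigenData

/-! ### The projection `π̂` and the identity `π̂^*Ω̂ = dη̂` -/

namespace LatticeData

variable (L : LatticeData)

/-- The linear map `π(x, y, z, u, t) = ((x, y, u), t)`. -/
def πLin : (Fin 5 → ℝ) →L[ℝ] (Fin 3 → ℝ) × ℝ :=
  (ContinuousLinearMap.pi ![ContinuousLinearMap.proj 0, ContinuousLinearMap.proj 1,
    ContinuousLinearMap.proj 3]).prod (ContinuousLinearMap.proj 4)

/-- The section `((x, y, u), t) ↦ (x, y, 0, u, t)` of `π`. -/
def secLin : (Fin 3 → ℝ) × ℝ →L[ℝ] (Fin 5 → ℝ) :=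
  ContinuousLinearMap.pi ![(ContinuousLinearMap.proj 0).comp (ContinuousLinearMap.fst ℝ _ _),
    (ContinuousLinearMap.proj 1).comp (ContinuousLinearMap.fst ℝ _ _), 0,
    (ContinuousLinearMap.proj 2).comp (ContinuousLinearMap.fst ℝ _ _),
    ContinuousLinearMap.snd ℝ _ _]

theorem πLin_secLin (w : (Fin 3 → ℝ) × ℝ) : πLin (secLin w) = w := by
  refine Prod.ext (funext fun i => ?_) rfl
  fin_cases i <;> rfl

/-- `πLin` is onto: evaluating on the lifts of vectors by `secLin` recovers the form. -/
theorem comp_πLin_injective {k : ℕ} {σ τ : ((Fin 3 → ℝ) × ℝ) [⋀^Fin k]→L[ℝ] ℝ}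
    (h : σ.compContinuousLinearMap πLin = τ.compContinuousLinearMap πLin) : σ = τ := by
  ext v
  have h2 := DFunLike.congr_fun h (fun i => secLin (v i))
  have h3 : (πLin ∘ fun i => secLin (v i)) = v := funext fun i => πLin_secLin (v i)
  simpa only [ContinuousAlternatingMap.compContinuousLinearMap_apply, h3] using h2

theorem πHat_projG (g : G L.p) : L.πHat (L.projG g) = L.projBase (πLin g) := by
  have h : K.mk (p := L.p) (g 0) (g 1) (g 3) = (πLin g).1 := by
    funext i
    fin_cases i <;> rfl
  change (L.projK (K.mk (g 0) (g 1) (g 3)), L.projS1 (g 4)) = (L.projK (πLin g).1, L.projS1 (g 4))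
  rw [h]

theorem πHat_comp_projG : L.πHat ∘ L.projG = L.projBase ∘ πLin := funext L.πHat_projG

theorem contMDiff_πHat : ContMDiff 𝓘(ℝ, Fin 5 → ℝ) EigenData.IBase ∞ L.πHat := by
  intro x
  obtain ⟨g, rfl⟩ := L.projG_surjective x
  refine contMDiffAt_of_comp_isLocalDiffeomorphAt (L.isLocalDiffeomorph_projG g) ?_
  rw [L.πHat_comp_projG]
  exact (L.contMDiff_projBase.comp (πLin.contDiff.contMDiff)) g

theorem hasMFDerivAt_πLin (g : G L.p) :
    HasMFDerivAt 𝓘(ℝ, Fin 5 → ℝ) 𝓘(ℝ, (Fin 3 → ℝ) × ℝ) (fun g : G L.p => πLin g) g πLin :=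
  (πLin.hasFDerivAt (x := g)).hasMFDerivAt

/-- Chain rule for the two factorizations of one map from `G(p)` to the base. It turns statements
about `π̂` into statements about the linear map `πLin`. -/
theorem pullback_projG_πHat {k : ℕ} (σ : DForm EigenData.IBase L.Base k) (g : G L.p) :
    pullback 𝓘(ℝ, Fin 5 → ℝ) 𝓘(ℝ, Fin 5 → ℝ) L.projG
      (pullback 𝓘(ℝ, Fin 5 → ℝ) EigenData.IBase L.πHat σ) g =
    (pullback 𝓘(ℝ, (Fin 3 → ℝ) × ℝ) EigenData.IBase L.projBase σ
      (πLin g)).compContinuousLinearMap πLin := by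
  have e1 := pullback_comp_apply (I := 𝓘(ℝ, Fin 5 → ℝ)) (I' := 𝓘(ℝ, Fin 5 → ℝ))
    (I'' := EigenData.IBase) (f := L.projG) (g := L.πHat) σ (x := g)
    (L.contMDiff_πHat.mdifferentiable (by simp) _)
    (L.isLocalDiffeomorph_projG.mdifferentiable (by simp) _)
  have e2 := pullback_comp_apply (I := 𝓘(ℝ, Fin 5 → ℝ)) (I' := 𝓘(ℝ, (Fin 3 → ℝ) × ℝ))
    (I'' := EigenData.IBase) (f := fun g : G L.p => πLin g) (g := L.projBase) σ (x := g)
    (L.mdifferentiable_projBase _) (L.hasMFDerivAt_πLin g).mdifferentiableAt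
  have e3 : L.πHat ∘ L.projG = L.projBase ∘ fun g : G L.p => πLin g := L.πHat_comp_projG
  rw [← e1, e3, e2, pullback, (L.hasMFDerivAt_πLin g).mfderiv]
  rfl

theorem extDeriv_ηE_eq (a : Fin 5 → ℝ) : extDeriv ηE a = Ω₀.compContinuousLinearMap πLin := by
  ext v
  have hv : v = ![v 0, v 1] := by funext i; fin_cases i <;> rfl
  have e : (πLin ∘ ![v 0, v 1]) = ![πLin (v 0), πLin (v 1)] := by
    funext i; fin_cases i <;> rfl
  rw [hv, extDeriv_ηE, ContinuousAlternatingMap.compContinuousLinearMap_apply, e, Ω₀_apply]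
  rfl

/-- A form is determined at `x` by its local form at the chart point of `x`, and both sides have
local form `extDeriv ηE`. -/
theorem pullback_πHat_ΩHat :
    pullback 𝓘(ℝ, Fin 5 → ℝ) EigenData.IBase L.πHat L.ΩHat = dExt 𝓘(ℝ, Fin 5 → ℝ) L.ηHat := by
  funext x
  refine ContinuousAlternatingMap.ext fun v => ?_
  have hL : localForm 𝓘(ℝ, Fin 5 → ℝ)
      (pullback 𝓘(ℝ, Fin 5 → ℝ) EigenData.IBase L.πHat L.ΩHat) x = extDeriv ηE := by
    refine (L.localForm_GHat _ x).trans (funext fun g => (L.pullback_projG_πHat L.ΩHat g).trans ?_)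
    rw [L.pullback_ΩHat]
    exact (extDeriv_ηE_eq g).symm
  refine (apply_eq_localForm (E := Fin 5 → ℝ)
    (pullback 𝓘(ℝ, Fin 5 → ℝ) EigenData.IBase L.πHat L.ΩHat) x v).trans ?_
  rw [dExt, L.localForm_ηHat, hL]
  rfl

/-- Along the points `secLin w` the pullbacks to `G(p)` determine the pullbacks to `ℝ³ × ℝ`; these
are the local forms in every chart of the base, hence determine the forms. No smoothness is needed.
-/
theorem pullback_πHat_injective {k : ℕ} {σ τ : DForm EigenData.IBase L.Base k}
    (h : pullback 𝓘(ℝ, Fin 5 → ℝ) EigenData.IBase L.πHat σ =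
      pullback 𝓘(ℝ, Fin 5 → ℝ) EigenData.IBase L.πHat τ) : σ = τ := by
  have key : pullback 𝓘(ℝ, (Fin 3 → ℝ) × ℝ) EigenData.IBase L.projBase σ =
      pullback 𝓘(ℝ, (Fin 3 → ℝ) × ℝ) EigenData.IBase L.projBase τ := by
    funext w
    have h1 := L.pullback_projG_πHat σ (secLin w)
    rw [h, L.pullback_projG_πHat τ (secLin w), πLin_secLin] at h1
    exact (comp_πLin_injective h1).symm
  funext b
  refine ContinuousAlternatingMap.ext fun v => ?_
  refine (apply_eq_localForm σ b v).trans (Eq.trans ?_ (apply_eq_localForm τ b v).symm)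
  rw [L.localForm_base, L.localForm_base, key]

theorem pullback_πHat_eq_iff (σ : DForm EigenData.IBase L.Base 2) :
    pullback 𝓘(ℝ, Fin 5 → ℝ) EigenData.IBase L.πHat σ = dExt 𝓘(ℝ, Fin 5 → ℝ) L.ηHat ↔
      σ = L.ΩHat := by
  rw [← L.pullback_πHat_ΩHat]
  exact ⟨fun h => L.pullback_πHat_injective h, fun h => by rw [h]⟩

end LatticeData

@[simp] theorem G.mk_0 (x y z u t : ℝ) {p : ℝ} :
    (G.mk x y z u t : G p) 0 = x := rfl
@[simp] theorem G.mk_1 (x y z u t : ℝ) {p : ℝ} :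
    (G.mk x y z u t : G p) 1 = y := rfl
@[simp] theorem G.mk_2 (x y z u t : ℝ) {p : ℝ} :
    (G.mk x y z u t : G p) 2 = z := rfl
@[simp] theorem G.mk_3 (x y z u t : ℝ) {p : ℝ} :
    (G.mk x y z u t : G p) 3 = u := rfl
@[simp] theorem G.mk_4 (x y z u t : ℝ) {p : ℝ} :
    (G.mk x y z u t : G p) 4 = t := rfl

/-! ## Solvability -/

theorem isSolvable_of_ker {A B : Type*} [Group A] [CommGroup B] (φ : A →* B)
    (h : Group.IsSolvable φ.ker) : Group.IsSolvable A :=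
  Group.isSolvable_of_ker_le_range φ.ker.subtype φ (by simp)

/-- The kernel of `(u, t)` is a Heisenberg group; there the exponentials are `1`, so `(x, y)` is
additive, and its kernel is the abelian `z`-axis. -/
theorem G.isSolvable (p : ℝ) : Group.IsSolvable (G p) := by
  let φ : G p →* Multiplicative (ℝ × ℝ) :=
    MonoidHom.mk' (fun g => Multiplicative.ofAdd (g 3, g 4)) fun _ _ => rfl
  have hφ : ∀ g : φ.ker, g.1 3 = 0 ∧ g.1 4 = 0 := fun g => Prod.ext_iff.1 g.2
  let ψ : φ.ker →* Multiplicative (ℝ × ℝ) :=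
    MonoidHom.mk' (fun g => Multiplicative.ofAdd (g.1 0, g.1 1)) fun g h => by
      refine congrArg Multiplicative.ofAdd (Prod.ext ?_ ?_)
      · change g.1 0 + Real.exp (p * g.1 3) * h.1 0 = g.1 0 + h.1 0
        simp [(hφ g).1]
      · change g.1 1 + Real.exp (-(p * g.1 3)) * h.1 1 = g.1 1 + h.1 1
        simp [(hφ g).1]
  have hψ : ∀ g : ψ.ker, g.1.1 0 = 0 ∧ g.1.1 1 = 0 := fun g => Prod.ext_iff.1 g.2
  refine isSolvable_of_ker φ (isSolvable_of_ker ψ (Group.isSolvable_of_comm fun a b => ?_))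
  refine Subtype.ext (Subtype.ext (G.ext' ?_ ?_ ?_ ?_ ?_)) <;>
    simp [(hφ a.1).1, (hφ a.1).2, (hφ b.1).1, (hφ b.1).2, (hψ a).1, (hψ a).2, (hψ b).1, (hψ b).2,
      add_comm]

theorem K.isSolvable (p : ℝ) : Group.IsSolvable (K p) := by
  let φ : K p →* Multiplicative ℝ :=
    MonoidHom.mk' (fun g => Multiplicative.ofAdd (g 2)) fun _ _ => rfl
  have hφ : ∀ g : φ.ker, g.1 2 = 0 := fun g => g.2
  refine isSolvable_of_ker φ (Group.isSolvable_of_comm fun a b => ?_)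
  refine Subtype.ext (K.ext' ?_ ?_ ?_) <;> simp [hφ a, hφ b, add_comm]

/-! ## Compactness -/

theorem exists_abs_add_int_mul_le {c : ℝ} (hc : c ≠ 0) (z : ℝ) : ∃ m : ℤ, |z + m * c| ≤ |c| := by
  -- What remains is the fractional part of `z / c` times `c`; the bound by `|c|` does not depend on
  -- the sign of `c`.
  refine ⟨-⌊z / c⌋, ?_⟩
  have e : z + ((-⌊z / c⌋ : ℤ) : ℝ) * c = Int.fract (z / c) * c := by
    rw [Int.fract]
    push_cast
    field_simp
    ring
  rw [e, abs_mul, abs_of_nonneg (Int.fract_nonneg _)]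
  exact mul_le_of_le_one_left (abs_nonneg c) (Int.fract_lt_one _).le

theorem EigenData.exists_plane_le (D : EigenData) (a b : ℝ) : ∃ m₀ m₁ : ℤ,
    |m₀ * D.x 0 + m₁ * D.x 1 + a| ≤ |D.x 0| + |D.x 1| ∧
    |m₀ * D.y 0 + m₁ * D.y 1 + b| ≤ |D.y 0| + |D.y 1| := by
  have hz := D.z₂_ne_zero
  have hz' : D.x 1 * D.y 0 - D.x 0 * D.y 1 = D.z₂ := rfl
  -- Cramer's rule: `α`, `β` are the coordinates of `(a, b)` in the lattice basis, whose determinant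
  -- is `-z₂`. Subtracting their integer parts leaves coefficients in `[0, 1)`.
  set α := (D.x 1 * b - D.y 1 * a) / D.z₂ with hα
  set β := (D.y 0 * a - D.x 0 * b) / D.z₂ with hβ
  have ha : a = α * D.x 0 + β * D.x 1 := by
    rw [hα, hβ]
    field_simp
    rw [← hz']
    ring
  have hb : b = α * D.y 0 + β * D.y 1 := by
    rw [hα, hβ]
    field_simp
    rw [← hz']
    ring
  have key : ∀ s t : ℝ, |((-⌊α⌋ : ℤ) : ℝ) * s + ((-⌊β⌋ : ℤ) : ℝ) * t + (α * s + β * t)| ≤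
      |s| + |t| := by
    intro s t
    have e : ((-⌊α⌋ : ℤ) : ℝ) * s + ((-⌊β⌋ : ℤ) : ℝ) * t + (α * s + β * t) =
        Int.fract α * s + Int.fract β * t := by
      rw [Int.fract, Int.fract]
      push_cast
      ring
    rw [e]
    refine (abs_add_le _ _).trans (add_le_add ?_ ?_) <;>
    · rw [abs_mul, abs_of_nonneg (Int.fract_nonneg _)]
      exact mul_le_of_le_one_left (abs_nonneg _) (Int.fract_lt_one _).le
  refine ⟨-⌊α⌋, -⌊β⌋, ?_, ?_⟩
  · conv_lhs => rw [ha]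
    exact key _ _
  · conv_lhs => rw [hb]
    exact key _ _

theorem EigenData.compactSpace_KHat (D : EigenData) : CompactSpace D.KHat := by
  let c : Fin 3 → ℝ := ![|D.x 0| + |D.x 1|, |D.y 0| + |D.y 1|, 1]
  have hC : IsCompact (X := K D.p) (Set.univ.pi fun i => Set.Icc (-c i) (c i)) :=
    isCompact_univ_pi (X := fun _ : Fin 3 => ℝ) fun i => isCompact_Icc
  refine ⟨?_⟩
  convert hC.image D.isLocalHomeomorph_projK.continuous
  refine (Set.eq_univ_of_forall fun x => ?_).symm
  obtain ⟨g, rfl⟩ := D.projK_surjective x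
  obtain ⟨n, hn⟩ := exists_abs_add_int_mul_le one_ne_zero (g 2)
  -- Translating `u` by `n` rescales `x` and `y`, so the plane vector is chosen for the rescaled
  -- coordinates.
  obtain ⟨m₀, m₁, h0, h1⟩ := D.exists_plane_le (Real.exp (D.p * n) * g 0)
    (Real.exp (-(D.p * n)) * g 1)
  have hγ : K.mk (m₀ * D.x 0 + m₁ * D.x 1) (m₀ * D.y 0 + m₁ * D.y 1) n ∈ D.ΓK :=
    ⟨⟨m₀, m₁, rfl, rfl⟩, n, rfl⟩
  refine ⟨_, ?_, D.projK_mul hγ g⟩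
  intro i _
  refine abs_le.1 ?_
  fin_cases i
  · exact h0
  · exact h1
  · change |(n : ℝ) + g 2| ≤ 1
    rw [mul_one, abs_one] at hn
    rwa [add_comm]

namespace LatticeData

variable (L : LatticeData)

/-- The inclusion of the Heisenberg group in `G(p)`. -/
def ofHeis (h : Heis) : G L.p := G.mk (h 0) (h 1) (h 2) 0 0

theorem ofHeis_mem {h : Heis} (hh : h ∈ L.ΓN) : L.ofHeis h ∈ L.Γ := by
  refine ⟨?_, ⟨0, by simp [ofHeis]⟩, 0, by simp [ofHeis]⟩
  have e : Heis.mk (L.ofHeis h 0) (L.ofHeis h 1) (L.ofHeis h 2) = h := Heis.ext' rfl rfl rfl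
  rwa [e]

theorem ofHeis_mul (h : Heis) (g : G L.p) : L.ofHeis h * g =
    G.mk (h 0 + g 0) (h 1 + g 1) (h 2 + g 2 + h 0 * g 1) (g 3) (g 4) := by
  refine G.ext' ?_ ?_ ?_ ?_ ?_ <;> simp [ofHeis]

/-- Reduce `u` and `t`, then `x` and `y`, then `z`, so that every point has a representative in a
compact box. Later steps keep what is reduced: elements of `Γ_N` do not move `u` and `t`, and powers
of `h₂` move only `z`. -/
theorem compactSpace_GHat : CompactSpace L.GHat := by
  let c : Fin 5 → ℝ := ![|L.x 0| + |L.x 1|, |L.y 0| + |L.y 1|, |L.z₂|, 1, |L.z₂|]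
  have hC : IsCompact (X := G L.p) (Set.univ.pi fun i => Set.Icc (-c i) (c i)) :=
    isCompact_univ_pi (X := fun _ : Fin 5 => ℝ) fun i => isCompact_Icc
  refine ⟨?_⟩
  convert hC.image L.isLocalHomeomorph_projG.continuous
  refine (Set.eq_univ_of_forall fun x => ?_).symm
  obtain ⟨g, rfl⟩ := L.projG_surjective x
  obtain ⟨n, hn⟩ := exists_abs_add_int_mul_le one_ne_zero (g 3)
  obtain ⟨k, hk⟩ := exists_abs_add_int_mul_le L.z₂_ne_zero (g 4)
  have hγ : (G.mk 0 0 0 n (k * L.z₂) : G L.p) ∈ L.Γ := ⟨one_mem L.ΓN, ⟨n, rfl⟩, k, rfl⟩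
  set g' := (G.mk 0 0 0 n (k * L.z₂) : G L.p) * g with hg'
  have e3 : g' 3 = n + g 3 := rfl
  have e4 : g' 4 = k * L.z₂ + g 4 := rfl
  obtain ⟨m₀, m₁, h0, h1⟩ := L.exists_plane_le (g' 0) (g' 1)
  set h := L.h₀ ^ m₀ * L.h₁ ^ m₁ with hh
  -- The argument is the `z`-coordinate of `g'` after translation by `h`, which the power of `h₂`
  -- then reduces.
  obtain ⟨m₂, h2⟩ := exists_abs_add_int_mul_le L.z₂_ne_zero (h 2 + g' 2 + h 0 * g' 1)
  have hN : h * L.h₂ ^ m₂ ∈ L.ΓN := (L.mem_ΓN_iff _).2 ⟨m₀, m₁, m₂, rfl⟩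
  have a0 : (h * L.h₂ ^ m₂) 0 = m₀ * L.x 0 + m₁ * L.x 1 := by
    simp [hh, Heis.zpow_0, h₀, h₁, h₂]
  have a0' : h 0 = m₀ * L.x 0 + m₁ * L.x 1 := by
    simp [hh, Heis.zpow_0, h₀, h₁]
  have a1 : (h * L.h₂ ^ m₂) 1 = m₀ * L.y 0 + m₁ * L.y 1 := by
    simp [hh, Heis.zpow_1, h₀, h₁, h₂]
  have a2 : (h * L.h₂ ^ m₂) 2 = h 2 + m₂ * L.z₂ := by
    rw [Heis.mul_2, Heis.zpow_1, Heis.zpow_2]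
    simp [h₂]
  refine ⟨_, ?_, (L.projG_mul (L.ofHeis_mem hN) g').trans (L.projG_mul hγ g)⟩
  intro i _
  rw [L.ofHeis_mul, a0, a1, a2]
  refine abs_le.1 ?_
  fin_cases i
  · exact h0
  · exact h1
  · change |h 2 + m₂ * L.z₂ + g' 2 + (m₀ * L.x 0 + m₁ * L.x 1) * g' 1| ≤ |L.z₂|
    rw [← a0']
    convert h2 using 2
    ring
  · change |g' 3| ≤ 1
    rw [e3, add_comm]
    simpa using hn
  · change |g' 4| ≤ |L.z₂|
    rwa [e4, add_comm]

end LatticeData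

/-! ## The action of the circle -/

/-- In a chart around `β s` the curve has zero derivative on a ball, so it is locally constant, and
`ℝ` is connected. -/
theorem apply_eq_of_hasMFDerivAt_zero {E H M : Type*} [NormedAddCommGroup E] [NormedSpace ℝ E]
    [TopologicalSpace H] {I : ModelWithCorners ℝ E H} [TopologicalSpace M] [ChartedSpace H M]
    [IsManifold I 1 M] {β : ℝ → M} (h : ∀ s, HasMFDerivAt 𝓘(ℝ, ℝ) I β s 0) (s t : ℝ) :
    β s = β t := by
  refine ((IsLocallyConstant.iff_eventually_eq β).2 fun s => ?_).apply_eq_of_preconnectedSpace s t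
  have hsrc : ∀ᶠ r in 𝓝 s, β r ∈ (chartAt H (β s)).source :=
    (h s).continuousAt.preimage_mem_nhds
      ((chartAt H (β s)).open_source.mem_nhds (mem_chart_source H (β s)))
  obtain ⟨ε, hε, hball⟩ := Metric.eventually_nhds_iff_ball.1 hsrc
  have hd : ∀ r ∈ Metric.ball s ε, HasFDerivAt (extChartAt I (β s) ∘ β) (0 : ℝ →L[ℝ] E) r := by
    intro r hr
    have h1 := (mdifferentiableAt_extChartAt (I := I) (hball r hr)).hasMFDerivAt.comp r (h r)
    rw [ContinuousLinearMap.comp_zero] at h1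
    exact hasMFDerivAt_iff_hasFDerivAt.1 h1
  have hs := Metric.mem_ball_self (x := s) hε
  filter_upwards [Metric.ball_mem_nhds s hε] with r hr
  have e : (extChartAt I (β s) ∘ β) r = (extChartAt I (β s) ∘ β) s :=
    Metric.isOpen_ball.is_const_of_fderiv_eq_zero (𝕜 := ℝ) (convex_ball s ε).isPreconnected
      (fun r hr => (hd r hr).differentiableAt.differentiableWithinAt)
      (fun r hr => (hd r hr).fderiv) hr hs
  refine (extChartAt I (β s)).injOn ?_ ?_ e
  · rw [extChartAt_source]
    exact hball r hr
  · rw [extChartAt_source]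
    exact hball s hs

theorem comp_smulRight_eq {E E' : Type*} [NormedAddCommGroup E] [NormedSpace ℝ E]
    [NormedAddCommGroup E'] [NormedSpace ℝ E'] {A : E →L[ℝ] E'} {v : E} {w : E'} (h : A v = w) :
    A.comp ((1 : ℝ →L[ℝ] ℝ).smulRight v) = (1 : ℝ →L[ℝ] ℝ).smulRight w := by
  ext
  simp [h]

/-- The coordinates of an element of `G(p)`, as a vector. -/
def G.coords {p : ℝ} (g : G p) : Fin 5 → ℝ := g

namespace LatticeData

variable (L : LatticeData)

/-- The central element `(0, 0, s, 0, 0)`. -/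
def zElt (s : ℝ) : G L.p := G.mk 0 0 s 0 0

theorem zElt_mul (s : ℝ) (g : G L.p) :
    L.zElt s * g = G.mk (g 0) (g 1) (g 2 + s) (g 3) (g 4) := by
  refine G.ext' ?_ ?_ ?_ ?_ ?_ <;> simp [zElt, add_comm]

theorem zElt_mul_eq_add (s : ℝ) (g : G L.p) :
    (L.zElt s * g).coords = g.coords + s • (Pi.single 2 1 : Fin 5 → ℝ) := by
  rw [L.zElt_mul]
  funext i
  change (G.mk (g 0) (g 1) (g 2 + s) (g 3) (g 4) : G L.p) i =
    g i + s * (Pi.single 2 1 : Fin 5 → ℝ) i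
  fin_cases i <;> simp

theorem zElt_mul_zElt (s t : ℝ) : L.zElt s * L.zElt t = L.zElt (s + t) := by
  rw [L.zElt_mul]
  refine G.ext' ?_ ?_ ?_ ?_ ?_ <;> simp [zElt, add_comm]

theorem zElt_zero : L.zElt 0 = 1 := rfl

/-- Centrality is what lets a left translation descend to a quotient by left translations. -/
theorem zElt_comm (s : ℝ) (g : G L.p) : L.zElt s * g = g * L.zElt s := by
  rw [L.zElt_mul]
  refine G.ext' ?_ ?_ ?_ ?_ ?_ <;> simp [zElt]

/-- In the normal form `h₀^m₀ h₁^m₁ h₂^m₂`, independence of the plane vectors forces `m₀ = m₁ = 0`,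
so only powers of `h₂` lie on the `z`-axis. This fixes the period of the flow. -/
theorem zElt_mem_iff (s : ℝ) : L.zElt s ∈ L.Γ ↔ (s : L.S1) = 0 := by
  rw [AddCircle.coe_eq_zero_iff]
  have hz := abs_pos.2 L.z₂_ne_zero
  constructor
  · rintro ⟨hN, -, -⟩
    obtain ⟨m₀, m₁, m₂, hm⟩ := (L.mem_ΓN_iff _).1 hN
    have ha : (0 : ℝ) = m₀ * L.x 0 + m₁ * L.x 1 := by
      have := congrFun hm 0
      simpa [Heis.zpow_0, h₀, h₁, h₂, zElt] using this
    have hb : (0 : ℝ) = m₀ * L.y 0 + m₁ * L.y 1 := by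
      have := congrFun hm 1
      simpa [Heis.zpow_1, h₀, h₁, h₂, zElt] using this
    obtain ⟨rfl, rfl⟩ := L.lattice_eq_zero ha hb (by simpa using hz) (by simpa using hz)
    refine ⟨m₂, ?_⟩
    have := congrFun hm 2
    simpa [Heis.zpow_2, h₂, zElt] using this.symm
  · rintro ⟨m, hm⟩
    have e : L.zElt s = L.ofHeis (L.h₂ ^ m) := by
      refine G.ext' ?_ ?_ ?_ ?_ ?_ <;>
        simp [zElt, ofHeis, Heis.zpow_0, Heis.zpow_1, Heis.zpow_2, h₂, ← hm]
    rw [e]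
    exact L.ofHeis_mem (zpow_mem L.h₂_mem m)

/-- The flow of `ξ̂`. -/
def flow (s : ℝ) : L.GHat → L.GHat :=
  Quotient.lift (fun g => L.projG (L.zElt s * g)) (by
    rintro _ h ⟨γ, rfl⟩
    change L.projG (L.zElt s * (γ.1 * h)) = _
    rw [← mul_assoc, L.zElt_comm, mul_assoc, L.projG_mul γ.2])

theorem flow_projG (s : ℝ) (g : G L.p) : L.flow s (L.projG g) = L.projG (L.zElt s * g) := rfl

theorem flow_add (s t : ℝ) (x : L.GHat) : L.flow (s + t) x = L.flow s (L.flow t x) := by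
  obtain ⟨g, rfl⟩ := L.projG_surjective x
  rw [L.flow_projG, L.flow_projG, L.flow_projG, ← mul_assoc, L.zElt_mul_zElt]

theorem flow_zero (x : L.GHat) : L.flow 0 x = x := by
  obtain ⟨g, rfl⟩ := L.projG_surjective x
  rw [L.flow_projG, L.zElt_zero, one_mul]

/-- If `zElt s * g = γ * g` with `γ ∈ Γ`, cancelling `g` gives `zElt s = γ`: the stabilizer is the
same at every point, so the circle acts freely. -/
theorem flow_eq_self_iff (s : ℝ) (x : L.GHat) : L.flow s x = x ↔ (s : L.S1) = 0 := by
  obtain ⟨g, rfl⟩ := L.projG_surjective x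
  rw [L.flow_projG, ← L.zElt_mem_iff]
  constructor
  · intro h
    obtain ⟨γ, hγ, e⟩ := L.projG_eq_iff.1 h.symm
    rwa [← mul_right_cancel e]
  · intro h
    exact L.projG_mul h g

theorem flow_periodic : Function.Periodic L.flow L.z₂ := by
  intro s
  funext x
  rw [L.flow_add, (L.flow_eq_self_iff L.z₂ x).2 (AddCircle.coe_period _)]

/-- The action of the circle `ℝ / z₂ℤ` by the flow of `ξ̂`. -/
instance circleAction : AddAction L.S1 L.GHat where
  vadd s := L.flow_periodic.lift s
  zero_vadd x := L.flow_zero x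
  add_vadd s t x := by
    obtain ⟨s, rfl⟩ := L.projS1_surjective s
    obtain ⟨t, rfl⟩ := L.projS1_surjective t
    exact L.flow_add s t x

theorem coe_vadd (s : ℝ) (x : L.GHat) : (s : L.S1) +ᵥ x = L.flow s x := rfl

theorem coe_vadd_projG (s : ℝ) (g : G L.p) :
    (s : L.S1) +ᵥ L.projG g = L.projG (L.zElt s * g) := rfl

theorem vadd_left_cancel {s t : L.S1} {x : L.GHat} (h : s +ᵥ x = t +ᵥ x) : s = t := by
  have h1 : (-t + s) +ᵥ x = x := by rw [add_vadd, h, neg_vadd_vadd]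
  obtain ⟨r, hr⟩ := L.projS1_surjective (-t + s)
  have hr' : (r : L.S1) = -t + s := hr
  rw [← hr', L.coe_vadd, L.flow_eq_self_iff, hr'] at h1
  rw [neg_add_eq_zero] at h1
  exact h1.symm

/-- Local inverses of the two projections lift the action to `(s, v) ↦ v + s e₂` on `ℝ × ℝ⁵`, which
is smooth. -/
theorem contMDiffVAdd : ContMDiffVAdd 𝓘(ℝ, ℝ) 𝓘(ℝ, Fin 5 → ℝ) ∞ L.S1 L.GHat := by
  refine ⟨?_⟩
  rintro ⟨s, x⟩
  obtain ⟨r, rfl⟩ := L.projS1_surjective s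
  obtain ⟨g, rfl⟩ := L.projG_surjective x
  have hr := L.isLocalDiffeomorph_projS1 r
  have hg := L.isLocalDiffeomorph_projG g
  have cr : ContMDiffAt (𝓘(ℝ, ℝ).prod 𝓘(ℝ, Fin 5 → ℝ)) 𝓘(ℝ, ℝ) ∞
      (fun q : L.S1 × L.GHat => hr.localInverse q.1) (L.projS1 r, L.projG g) :=
    ContMDiffAt.comp (L.projS1 r, L.projG g) hr.localInverse_contMDiffAt contMDiffAt_fst
  have cg : ContMDiffAt (𝓘(ℝ, ℝ).prod 𝓘(ℝ, Fin 5 → ℝ)) 𝓘(ℝ, Fin 5 → ℝ) ∞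
      (fun q : L.S1 × L.GHat => (hg.localInverse q.2).coords) (L.projS1 r, L.projG g) :=
    ContMDiffAt.comp (L.projS1 r, L.projG g) hg.localInverse_contMDiffAt contMDiffAt_snd
  have c : ContMDiffAt (𝓘(ℝ, ℝ).prod 𝓘(ℝ, Fin 5 → ℝ)) 𝓘(ℝ, Fin 5 → ℝ) ∞
      (fun q : L.S1 × L.GHat => (hg.localInverse q.2).coords +
        hr.localInverse q.1 • (Pi.single 2 1 : Fin 5 → ℝ)) (L.projS1 r, L.projG g) :=
    cg.add (cr.smul contMDiffAt_const)
  have c' := ContMDiffAt.comp (L.projS1 r, L.projG g)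
    (L.isLocalDiffeomorph_projG.contMDiff _) c
  refine c'.congr_of_eventuallyEq ?_
  have e1 : ∀ᶠ q : L.S1 × L.GHat in 𝓝 (L.projS1 r, L.projG g),
      L.projS1 (hr.localInverse q.1) = q.1 :=
    (continuousAt_fst (p := (L.projS1 r, L.projG g))).eventually
      hr.localInverse_eventuallyEq_right
  have e2 : ∀ᶠ q : L.S1 × L.GHat in 𝓝 (L.projS1 r, L.projG g),
      L.projG (hg.localInverse q.2) = q.2 :=
    (continuousAt_snd (p := (L.projS1 r, L.projG g))).eventually
      hg.localInverse_eventuallyEq_right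
  filter_upwards [e1, e2] with q h1 h2
  conv_lhs => rw [← h1, ← h2]
  exact congrArg L.projG (L.zElt_mul_eq_add _ _)

/-- Upstairs the orbit is a straight line with velocity `∂/∂z`, and `projG` relates `ξ` to `ξ̂`. -/
theorem isMIntegralCurve_vadd (x : L.GHat) :
    IsMIntegralCurve (I := 𝓘(ℝ, Fin 5 → ℝ)) (fun s : ℝ => (s : L.S1) +ᵥ x) L.ξHat := by
  obtain ⟨g, rfl⟩ := L.projG_surjective x
  intro s
  have h1 : HasMFDerivAt 𝓘(ℝ, ℝ) 𝓘(ℝ, Fin 5 → ℝ) (fun s : ℝ => L.zElt s * g) s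
      ((1 : ℝ →L[ℝ] ℝ).smulRight (Pi.single 2 1 : Fin 5 → ℝ)) := by
    have h : HasFDerivAt (fun s : ℝ => g.coords + s • (Pi.single 2 1 : Fin 5 → ℝ))
        ((1 : ℝ →L[ℝ] ℝ).smulRight (Pi.single 2 1 : Fin 5 → ℝ)) s :=
      ((hasFDerivAt_id s).smul_const _).const_add _
    have e : (fun s : ℝ => g.coords + s • (Pi.single 2 1 : Fin 5 → ℝ)) =
        fun s : ℝ => L.zElt s * g := funext fun s => (L.zElt_mul_eq_add s g).symm
    rw [e] at h
    exact h.hasMFDerivAt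
  have h2 := (L.isLocalDiffeomorph_projG.mdifferentiable (by simp) (L.zElt s * g)).hasMFDerivAt
  refine (h2.comp s h1).congr_mfderiv ?_
  exact comp_smulRight_eq (E := Fin 5 → ℝ) (E' := Fin 5 → ℝ) (L.mfderiv_projG_ξ (L.zElt s * g))

/-! ## The fibres of `π̂` -/

theorem πLin_zElt_mul (s : ℝ) (g : G L.p) : πLin (L.zElt s * g : G L.p) = πLin g := by
  rw [L.zElt_mul]
  refine Prod.ext (funext fun i => ?_) rfl
  fin_cases i <;> rfl

theorem πHat_vadd (s : L.S1) (x : L.GHat) : L.πHat (s +ᵥ x) = L.πHat x := by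
  obtain ⟨s, rfl⟩ := L.projS1_surjective s
  obtain ⟨g, rfl⟩ := L.projG_surjective x
  change L.πHat (L.projG (L.zElt s * g)) = _
  rw [L.πHat_projG, L.πHat_projG, L.πLin_zElt_mul]

theorem eq_zElt_mul {g h : G L.p} (e : πLin g = πLin h) : g = L.zElt (g 2 - h 2) * h := by
  have e1 := congrArg Prod.fst e
  rw [L.zElt_mul]
  refine G.ext' ?_ ?_ ?_ ?_ ?_
  · exact congrFun e1 0
  · exact congrFun e1 1
  · simp
  · exact congrFun e1 2
  · exact congrArg Prod.snd e

/-- The lattice of the base lifts to `Γ(p)`: a plane vector with coordinates `m₀, m₁` is the shadow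
of `h₀^m₀ h₁^m₁ ∈ Γ_N`, and the `z`-coordinate of the lift is irrelevant to `πLin`. -/
theorem exists_mem_Γ {g h : G L.p} (e : L.projBase (πLin g) = L.projBase (πLin h)) :
    ∃ γ ∈ L.Γ, πLin (γ * g : G L.p) = πLin h := by
  obtain ⟨κ, ⟨⟨m₀, m₁, h0, h1⟩, n, hn⟩, hκ⟩ := L.projK_eq_iff.1 (congrArg Prod.fst e)
  have e2 : ((h 4 - g 4 : ℝ) : L.S1) = 0 := by
    have : ((g 4 : ℝ) : L.S1) = (h 4 : ℝ) := congrArg Prod.snd e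
    rw [AddCircle.coe_sub, this, sub_self]
  obtain ⟨k, hk⟩ := (AddCircle.coe_eq_zero_iff _).1 e2
  let η := L.h₀ ^ m₀ * L.h₁ ^ m₁
  have hη : η ∈ L.ΓN := (L.mem_ΓN_iff _).2 ⟨m₀, m₁, 0, by simp [η]⟩
  have η0 : η 0 = κ 0 := by rw [h0]; simp [η, Heis.zpow_0, h₀, h₁]
  have η1 : η 1 = κ 1 := by rw [h1]; simp [η, Heis.zpow_1, h₀, h₁]
  refine ⟨G.mk (η 0) (η 1) (η 2) n (k * L.z₂), ⟨?_, ⟨n, rfl⟩, k, rfl⟩, ?_⟩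
  · have e' : Heis.mk (η 0) (η 1) (η 2) = η := Heis.ext' rfl rfl rfl
    change Heis.mk (η 0) (η 1) (η 2) ∈ L.ΓN
    rwa [e']
  · have k0 : κ 0 + Real.exp (L.p * κ 2) * g 0 = h 0 := congrFun hκ 0
    have k1 : κ 1 + Real.exp (-(L.p * κ 2)) * g 1 = h 1 := congrFun hκ 1
    have k2 : κ 2 + g 3 = h 3 := congrFun hκ 2
    rw [hn] at k0 k1 k2
    refine Prod.ext (funext fun i => ?_) ?_
    · fin_cases i
      · change η 0 + Real.exp (L.p * n) * g 0 = h 0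
        rw [η0, k0]
      · change η 1 + Real.exp (-(L.p * n)) * g 1 = h 1
        rw [η1, k1]
      · exact k2
    · change k * L.z₂ + g 4 = h 4
      rw [zsmul_eq_mul] at hk
      linarith

/-- After one representative is moved by `Γ(p)`, the two differ only in `z`, that is by a central
element: the circle is transitive on fibres. -/
theorem exists_vadd_eq {x y : L.GHat} (e : L.πHat x = L.πHat y) : ∃ s : ℝ, (s : L.S1) +ᵥ x = y := by
  obtain ⟨g, rfl⟩ := L.projG_surjective x
  obtain ⟨h, rfl⟩ := L.projG_surjective y
  rw [L.πHat_projG, L.πHat_projG] at e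
  obtain ⟨γ, hγ, e'⟩ := L.exists_mem_Γ e
  refine ⟨h 2 - (γ * g) 2, ?_⟩
  rw [← L.projG_mul hγ g, L.coe_vadd_projG, ← L.eq_zElt_mul e'.symm]

theorem mfderiv_πHat_ξHat (x : L.GHat) :
    mfderiv 𝓘(ℝ, Fin 5 → ℝ) EigenData.IBase L.πHat x (L.ξHat x) = 0 := by
  obtain ⟨g, rfl⟩ := L.projG_surjective x
  have h1 := mfderiv_comp_apply (I := 𝓘(ℝ, Fin 5 → ℝ)) (I' := 𝓘(ℝ, Fin 5 → ℝ))
    (I'' := EigenData.IBase) g (L.contMDiff_πHat.mdifferentiable (by simp) (L.projG g))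
    (L.isLocalDiffeomorph_projG.mdifferentiable (by simp) g) (L.ξ g)
  have e3 : L.πHat ∘ L.projG = L.projBase ∘ fun g : G L.p => πLin g := L.πHat_comp_projG
  have h2 := mfderiv_comp_apply (I := 𝓘(ℝ, Fin 5 → ℝ)) (I' := 𝓘(ℝ, (Fin 3 → ℝ) × ℝ))
    (I'' := EigenData.IBase) (f := fun g : G L.p => πLin g) g
    (L.mdifferentiable_projBase (πLin g))
    (L.hasMFDerivAt_πLin g).mdifferentiableAt (L.ξ g)
  rw [L.mfderiv_projG_ξ, e3, h2, (L.hasMFDerivAt_πLin g).mfderiv] at h1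
  rw [← h1]
  have h3 : πLin (L.ξ g) = 0 := by
    have hs : ∀ i : Fin 5, i ≠ 2 → (Pi.single 2 1 : Fin 5 → ℝ) i = 0 :=
      fun i hi => Pi.single_eq_of_ne hi _
    refine Prod.ext (funext fun i => ?_) (hs 4 (by decide))
    fin_cases i
    · exact hs 0 (by decide)
    · exact hs 1 (by decide)
    · exact hs 3 (by decide)
  exact (congrArg _ h3).trans (map_zero _)

/-- The composite with `π̂` has zero derivative because `dπ̂(ξ̂) = 0`; uniqueness of integral curves
is not used. -/
theorem πHat_eq_of_isMIntegralCurve {γ : ℝ → L.GHat}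
    (hγ : IsMIntegralCurve (I := 𝓘(ℝ, Fin 5 → ℝ)) γ L.ξHat) (s t : ℝ) :
    L.πHat (γ s) = L.πHat (γ t) := by
  have : IsManifold EigenData.IBase 1 L.Base := IsManifold.of_le (n := ∞) (by simp)
  refine apply_eq_of_hasMFDerivAt_zero (I := EigenData.IBase) (β := fun s => L.πHat (γ s))
    (fun s => ?_) s t
  have h := (L.contMDiff_πHat.mdifferentiable (by simp) (γ s)).hasMFDerivAt.comp s (hγ s)
  refine h.congr_mfderiv ?_
  exact (comp_smulRight_eq (E := Fin 5 → ℝ) (E' := (Fin 3 → ℝ) × ℝ)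
    (L.mfderiv_πHat_ξHat (γ s))).trans (ContinuousLinearMap.smulRight_zero _)

theorem πHat_eq_iff (x y : L.GHat) : L.πHat x = L.πHat y ↔
    ∃ γ : ℝ → L.GHat, IsMIntegralCurve (I := 𝓘(ℝ, Fin 5 → ℝ)) γ L.ξHat ∧
      γ 0 = x ∧ ∃ s : ℝ, γ s = y := by
  constructor
  · intro e
    obtain ⟨s, hs⟩ := L.exists_vadd_eq e
    exact ⟨_, L.isMIntegralCurve_vadd x, L.flow_zero x, s, hs⟩
  · rintro ⟨γ, hγ, rfl, s, rfl⟩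
    exact L.πHat_eq_of_isMIntegralCurve hγ 0 s

end LatticeData

/-! ## Regularity -/

/-- The exchange of the coordinates `x` and `z`. -/
def swapXZ : (Fin 5 → ℝ) ≃L[ℝ] (Fin 5 → ℝ) :=
  (LinearEquiv.funCongrLeft ℝ ℝ (Equiv.swap (0 : Fin 5) 2)).toContinuousLinearEquiv

theorem swapXZ_apply (v : Fin 5 → ℝ) (i : Fin 5) : swapXZ v i = v (Equiv.swap 0 2 i) := rfl

theorem swapXZ_single : swapXZ (Pi.single 0 1) = Pi.single 2 1 := by
  funext i
  rw [swapXZ_apply]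
  fin_cases i <;> simp [Equiv.swap_apply_def]

theorem EigenData.exists_injOn_projBase (D : EigenData) (w : (Fin 3 → ℝ) × ℝ) :
    ∃ V ∈ 𝓝 w, V.InjOn D.projBase := by
  have h2 := AddCircle.isLocalHomeomorph_coe D.z₂
  refine ⟨(show Set (Fin 3 → ℝ) from (D.isLocalHomeomorph_projK.localInverseAt w.1).target) ×ˢ
    (h2.localInverseAt w.2).target, prod_mem_nhds ?_ ?_, ?_⟩
  · exact (D.isLocalHomeomorph_projK.localInverseAt w.1).open_target.mem_nhds
      D.isLocalHomeomorph_projK.self_mem_localInverseAt_target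
  · exact (h2.localInverseAt w.2).open_target.mem_nhds h2.self_mem_localInverseAt_target
  · intro a ha b hb hab
    exact Prod.ext
      (D.isLocalHomeomorph_projK.injOn_localInverseAt_target ha.1 hb.1 (congrArg Prod.fst hab))
      (h2.injOn_localInverseAt_target ha.2 hb.2 (congrArg Prod.snd hab))

namespace LatticeData

variable (L : LatticeData)

theorem chartAt_symm_apply (x : L.GHat) (w : Fin 5 → ℝ) :
    (chartAt (Fin 5 → ℝ) x).symm w = L.projG w :=
  congrFun (L.isLocalHomeomorph_projG.localInverseAt_symm _) w

/-- The chart at `x`, with the coordinate `z` first. -/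
def chartZ (x : L.GHat) : OpenPartialHomeomorph L.GHat (Fin 5 → ℝ) :=
  (chartAt (Fin 5 → ℝ) x).trans swapXZ.symm.toHomeomorph.toOpenPartialHomeomorph

theorem chartZ_symm_apply (x : L.GHat) (w : Fin 5 → ℝ) :
    (L.chartZ x).symm w = L.projG (swapXZ w) :=
  L.chartAt_symm_apply x (swapXZ w)

theorem mem_chartZ_source (x : L.GHat) : x ∈ (L.chartZ x).source := by
  rw [chartZ, OpenPartialHomeomorph.trans_source]
  exact ⟨mem_chart_source _ x, trivial⟩

theorem contMDiffOn_chartZ (x : L.GHat) : ContMDiffOn 𝓘(ℝ, Fin 5 → ℝ) 𝓘(ℝ, Fin 5 → ℝ) ∞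
    (L.chartZ x) (L.chartZ x).source := by
  have h1 : ContMDiffOn 𝓘(ℝ, Fin 5 → ℝ) 𝓘(ℝ, Fin 5 → ℝ) ∞ (chartAt (Fin 5 → ℝ) x)
      (chartAt (Fin 5 → ℝ) x).source := contMDiffOn_chart
  refine (swapXZ.symm.contDiff.contMDiff.comp_contMDiffOn h1).mono ?_
  intro y hy
  rw [chartZ, OpenPartialHomeomorph.trans_source] at hy
  exact hy.1

theorem contMDiff_chartZ_symm (x : L.GHat) : ContMDiff 𝓘(ℝ, Fin 5 → ℝ) 𝓘(ℝ, Fin 5 → ℝ) ∞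
    (L.chartZ x).symm := by
  have h : ContMDiff 𝓘(ℝ, Fin 5 → ℝ) 𝓘(ℝ, Fin 5 → ℝ) ∞ (L.projG ∘ swapXZ) :=
    L.isLocalDiffeomorph_projG.contMDiff.comp swapXZ.contDiff.contMDiff
  have e : ((L.chartZ x).symm : (Fin 5 → ℝ) → L.GHat) = L.projG ∘ swapXZ :=
    funext (L.chartZ_symm_apply x)
  rwa [e]

/-- Take a cube so small that `projBase` is injective on its image under `π`. An integral curve has
a single value of `π̂`, so its points in the cube share the coordinates `x, y, u, t`. The chart puts
`z` first because `IsRegularField` straightens along index `0`. -/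
theorem isRegularField_ξHat : IsRegularField L.ξHat := by
  intro x
  set a := L.chartZ x x with ha
  have hat : a ∈ (L.chartZ x).target := (L.chartZ x).map_source (L.mem_chartZ_source x)
  obtain ⟨V, hV, hinj⟩ := L.exists_injOn_projBase (πLin (swapXZ a))
  have hV' : ∀ᶠ w in 𝓝 a, πLin (swapXZ w) ∈ V :=
    (πLin.continuous.comp swapXZ.continuous).continuousAt.preimage_mem_nhds hV
  obtain ⟨r, hr, hball⟩ := Metric.eventually_nhds_iff_ball.1
    (hV'.and ((L.chartZ x).open_target.mem_nhds hat))
  -- Restricting the inverse chart and inverting again makes the target, rather than the source, the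
  -- prescribed cube.
  set φ := ((L.chartZ x).symm.restrOpen (Metric.ball a r) Metric.isOpen_ball).symm with hφ
  have htarget : φ.target = Metric.ball a r := by
    change (L.chartZ x).target ∩ Metric.ball a r = _
    exact Set.inter_eq_right.2 fun w hw => (hball w hw).2
  have hsource : ∀ y, y ∈ φ.source → y ∈ (L.chartZ x).source := fun y hy => hy.1
  have hφx : φ x = a := rfl
  have hxs : x ∈ φ.source := by
    have h := φ.map_target (x := a) (by rw [htarget]; exact Metric.mem_ball_self hr)
    have : φ.symm a = x := (L.chartZ x).left_inv (L.mem_chartZ_source x)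
    rwa [this] at h
  have hsm : ContMDiffOn 𝓘(ℝ, Fin 5 → ℝ) 𝓘(ℝ, Fin 5 → ℝ) ∞ φ φ.source :=
    (L.contMDiffOn_chartZ x).mono hsource
  have hproj : ∀ y ∈ φ.source, L.projG (swapXZ (φ y)) = y := fun y hy => by
    rw [← L.chartZ_symm_apply x]
    exact (L.chartZ x).left_inv (hsource y hy)
  refine ⟨φ, ?_, hxs, ⟨r, hr, htarget⟩, ?_, ?_⟩
  · exact φ.mem_maximalAtlas_of_contMDiffOn hsm (L.contMDiff_chartZ_symm x).contMDiffOn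
  · intro y hy
    have hpy := hproj y hy
    set w := φ y with hw
    have hwt : w ∈ φ.target := φ.map_source hy
    have hs : HasMFDerivAt 𝓘(ℝ, Fin 5 → ℝ) 𝓘(ℝ, Fin 5 → ℝ)
        (fun v : Fin 5 → ℝ => (swapXZ v : G L.p)) w (swapXZ : (Fin 5 → ℝ) →L[ℝ] (Fin 5 → ℝ)) :=
      (swapXZ : (Fin 5 → ℝ) →L[ℝ] (Fin 5 → ℝ)).hasFDerivAt.hasMFDerivAt
    have hg : MDifferentiableAt 𝓘(ℝ, Fin 5 → ℝ) 𝓘(ℝ, Fin 5 → ℝ) L.projG (swapXZ w : G L.p) :=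
      L.isLocalDiffeomorph_projG.mdifferentiable (by simp) _
    have hd : MDifferentiableAt 𝓘(ℝ, Fin 5 → ℝ) 𝓘(ℝ, Fin 5 → ℝ) φ
        (L.projG (swapXZ w)) := by
      rw [hpy]
      exact (hsm.contMDiffAt (φ.open_source.mem_nhds hy)).mdifferentiableAt (by simp)
    -- Near `w` the composite of `swapXZ`, `projG` and `φ` is the identity. Its differential at the
    -- first basis vector, which `swapXZ` sends to `∂/∂z`, gives `dφ(ξ̂)`.
    have hc := hd.hasMFDerivAt.comp w (hg.hasMFDerivAt.comp w hs)
    have hid : HasMFDerivAt 𝓘(ℝ, Fin 5 → ℝ) 𝓘(ℝ, Fin 5 → ℝ)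
        (φ ∘ L.projG ∘ fun v : Fin 5 → ℝ => (swapXZ v : G L.p)) w
        (ContinuousLinearMap.id ℝ (Fin 5 → ℝ)) := by
      refine (hasMFDerivAt_id w).congr_of_eventuallyEq ?_
      filter_upwards [φ.open_target.mem_nhds hwt] with v hv
      exact (congrArg φ (L.chartZ_symm_apply x v).symm).trans (φ.right_inv hv)
    have hu := DFunLike.congr_fun (hasMFDerivAt_unique hc hid) (Pi.single 0 1 : Fin 5 → ℝ)
    have hξ := L.mfderiv_projG_ξ (swapXZ w)
    have key : mfderiv 𝓘(ℝ, Fin 5 → ℝ) 𝓘(ℝ, Fin 5 → ℝ) φ (L.projG (swapXZ w))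
        (L.ξHat (L.projG (swapXZ w))) = (Pi.single 0 1 : Fin 5 → ℝ) := by
      rw [← hξ]
      refine Eq.trans ?_ hu
      refine congrArg (fun v : Fin 5 → ℝ =>
        mfderiv 𝓘(ℝ, Fin 5 → ℝ) 𝓘(ℝ, Fin 5 → ℝ) φ (L.projG (swapXZ w))
          (mfderiv 𝓘(ℝ, Fin 5 → ℝ) 𝓘(ℝ, Fin 5 → ℝ) L.projG (swapXZ w) v)) ?_
      exact swapXZ_single.symm
    rwa [hpy] at key
  · intro γ hγ s t hs ht i hi
    have hP : ∀ y ∈ φ.source, L.πHat y = L.projBase (πLin (swapXZ (φ y))) := fun y hy =>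
      (congrArg L.πHat (hproj y hy)).symm.trans (L.πHat_projG _)
    have hVy : ∀ y ∈ φ.source, πLin (swapXZ (φ y)) ∈ V := fun y hy => by
      refine (hball _ ?_).1
      rw [← htarget]
      exact φ.map_source hy
    have h1 : πLin (swapXZ (φ (γ s))) = πLin (swapXZ (φ (γ t))) := by
      refine hinj (hVy _ hs) (hVy _ ht) ?_
      rw [← hP _ hs, ← hP _ ht]
      exact L.πHat_eq_of_isMIntegralCurve hγ s t
    have h2 := congrArg Prod.fst h1
    -- The coordinates of `φ` are `(z, y, x, u, t)`, those of `πLin` are `((x, y, u), t)`.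
    fin_cases i
    · exact absurd rfl hi
    · exact congrFun h2 1
    · exact congrFun h2 0
    · exact congrFun h2 2
    · exact congrArg Prod.snd h1

theorem isRegularContactForm_ηHat : IsRegularContactForm L.ηHat :=
  ⟨L.isContactForm_ηHat, L.ξHat, L.isReebField_ξHat, L.isRegularField_ξHat⟩

end LatticeData

/-! ## The principal bundle -/

namespace LatticeData

variable (L : LatticeData)

/-- The local section of `π̂` over the domain of the chart at `b`. -/
def sec (b b' : L.Base) : L.GHat := L.projG (secLin (extChartAt EigenData.IBase b b'))

theorem projBase_extChartAt {b b' : L.Base} (hb : b' ∈ (extChartAt EigenData.IBase b).source) :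
    L.projBase (extChartAt EigenData.IBase b b') = b' := by
  rw [← L.extChartAt_base_symm b]
  exact (extChartAt EigenData.IBase b).left_inv hb

theorem πHat_sec {b b' : L.Base} (hb : b' ∈ (extChartAt EigenData.IBase b).source) :
    L.πHat (L.sec b b') = b' := by
  refine (L.πHat_projG _).trans ?_
  rw [πLin_secLin, L.projBase_extChartAt hb]

theorem contMDiffOn_sec (b : L.Base) : ContMDiffOn EigenData.IBase 𝓘(ℝ, Fin 5 → ℝ) ∞ (L.sec b)
    (extChartAt EigenData.IBase b).source := by
  have h1 : ContMDiffOn EigenData.IBase 𝓘(ℝ, (Fin 3 → ℝ) × ℝ) ∞ (extChartAt EigenData.IBase b)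
      (extChartAt EigenData.IBase b).source := by
    rw [extChartAt_source]
    exact contMDiffOn_extChartAt
  exact L.isLocalDiffeomorph_projG.contMDiff.comp_contMDiffOn
    (secLin.contDiff.contMDiff.comp_contMDiffOn h1)

/-- The fibre coordinate: the element of the circle that moves the point of the local section to
the given point. -/
def fibreCoord (b : L.Base) (x : L.GHat) : L.S1 :=
  -- Away from the chart domain such an `s` may fail to exist and the value is arbitrary; over the
  -- chart domain freeness makes it unique.
  Classical.epsilon fun s : L.S1 => s +ᵥ L.sec b (L.πHat x) = x

theorem fibreCoord_vadd {b : L.Base} {x : L.GHat}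
    (hx : L.πHat x ∈ (extChartAt EigenData.IBase b).source) :
    L.fibreCoord b x +ᵥ L.sec b (L.πHat x) = x := by
  obtain ⟨s, hs⟩ := L.exists_vadd_eq (L.πHat_sec hx)
  exact Classical.epsilon_spec (p := fun s : L.S1 => s +ᵥ L.sec b (L.πHat x) = x) ⟨s, hs⟩

theorem fibreCoord_eq {b : L.Base} {x : L.GHat}
    (hx : L.πHat x ∈ (extChartAt EigenData.IBase b).source) {s : L.S1}
    (hs : s +ᵥ L.sec b (L.πHat x) = x) : L.fibreCoord b x = s :=
  L.vadd_left_cancel ((L.fibreCoord_vadd hx).trans hs.symm)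

/-- Lift a neighbourhood of `x` to `G(p)` so that the base coordinates of the lift agree with the
chart at `b`. As the section has `z = 0`, the fibre coordinate is the class of the `z`-coordinate of
the lift, a smooth function. -/
theorem contMDiffAt_fibreCoord {b : L.Base} {x : L.GHat}
    (hx : L.πHat x ∈ (extChartAt EigenData.IBase b).source) :
    ContMDiffAt 𝓘(ℝ, Fin 5 → ℝ) 𝓘(ℝ, ℝ) ∞ (L.fibreCoord b) x := by
  set w := extChartAt EigenData.IBase b (L.πHat x) with hw
  obtain ⟨g, hgx, hgw⟩ : ∃ g : G L.p, L.projG g = x ∧ πLin g = w := by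
    obtain ⟨g, hg⟩ := L.projG_surjective x
    obtain ⟨γ, hγ, e⟩ := L.exists_mem_Γ (g := g) (h := secLin w) (by
      rw [πLin_secLin, hw, L.projBase_extChartAt hx, ← L.πHat_projG, hg])
    exact ⟨γ * g, (L.projG_mul hγ g).trans hg, e.trans (πLin_secLin w)⟩
  have hq := L.isLocalDiffeomorph_projG g
  -- On `V` equality in the base implies equality of coordinates, so the lift and the chart agree
  -- exactly near `x` and not only modulo the lattice.
  obtain ⟨V, hV, hinj⟩ := L.exists_injOn_projBase w
  have hτ := hq.localInverse_contMDiffAt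
  have hτg : hq.localInverse (L.projG g) = g :=
    hq.localInverse_left_inv hq.localInverse_mem_target
  have hinv := hq.localInverse_eventuallyEq_right
  rw [hgx] at hτ hτg hinv
  have hcoord : ContMDiffAt 𝓘(ℝ, Fin 5 → ℝ) 𝓘(ℝ, ℝ) ∞ (fun y => (hq.localInverse y) 2) x :=
    ContMDiffAt.comp x ((ContinuousLinearMap.proj (R := ℝ) (φ := fun _ : Fin 5 => ℝ)
      2).contDiff.contMDiff _) hτ
  refine (ContMDiffAt.comp x (L.isLocalDiffeomorph_projS1.contMDiff _)
    hcoord).congr_of_eventuallyEq ?_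
  have hopen : IsOpen (extChartAt EigenData.IBase b).source := isOpen_extChartAt_source b
  have hπ : ContinuousAt L.πHat x := L.contMDiff_πHat.continuous.continuousAt
  have e1 : ∀ᶠ y in 𝓝 x, L.πHat y ∈ (extChartAt EigenData.IBase b).source :=
    hπ.preimage_mem_nhds (hopen.mem_nhds hx)
  have e2 : ∀ᶠ y in 𝓝 x, extChartAt EigenData.IBase b (L.πHat y) ∈ V := by
    refine ContinuousAt.preimage_mem_nhds (f := fun y => extChartAt EigenData.IBase b (L.πHat y))
      ?_ hV
    exact ContinuousAt.comp (continuousAt_extChartAt' hx) hπ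
  have e3 : ∀ᶠ y in 𝓝 x, πLin (hq.localInverse y) ∈ V := by
    refine ContinuousAt.preimage_mem_nhds (f := fun y => πLin (hq.localInverse y)) ?_ ?_
    · exact πLin.continuous.continuousAt.comp hτ.continuousAt
    · rw [hτg, hgw]
      exact hV
  filter_upwards [e1, e2, e3, hinv] with y h1 h2 h3 h4
  have h4' : L.projG (hq.localInverse y) = y := h4
  refine L.fibreCoord_eq h1 ?_
  have h5 : πLin (hq.localInverse y) = extChartAt EigenData.IBase b (L.πHat y) := by
    refine hinj h3 h2 ?_
    rw [L.projBase_extChartAt h1, ← L.πHat_projG, h4']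
  have h6 := L.eq_zElt_mul (g := hq.localInverse y)
    (h := secLin (extChartAt EigenData.IBase b (L.πHat y))) (by rw [h5, πLin_secLin])
  have h7 : (secLin (extChartAt EigenData.IBase b (L.πHat y)) : Fin 5 → ℝ) 2 = 0 := rfl
  have h8 : hq.localInverse y 2 - (secLin (extChartAt EigenData.IBase b (L.πHat y)) : G L.p) 2 =
      hq.localInverse y 2 := sub_eq_self.2 h7
  rw [h8] at h6
  exact (congrArg L.projG h6.symm).trans h4'

/-- The local trivialization of `π̂` over the domain of the chart at `b`. -/
def triv (b : L.Base) : Bundle.Trivialization L.S1 L.πHat where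
  toFun x := (L.πHat x, L.fibreCoord b x)
  invFun q := q.2 +ᵥ L.sec b q.1
  source := L.πHat ⁻¹' (extChartAt EigenData.IBase b).source
  target := (extChartAt EigenData.IBase b).source ×ˢ Set.univ
  map_source' x hx := ⟨hx, trivial⟩
  map_target' q hq := by
    change L.πHat _ ∈ (extChartAt EigenData.IBase b).source
    rw [L.πHat_vadd, L.πHat_sec hq.1]
    exact hq.1
  left_inv' x hx := L.fibreCoord_vadd hx
  right_inv' q hq := by
    have e : L.πHat (q.2 +ᵥ L.sec b q.1) = q.1 := by rw [L.πHat_vadd, L.πHat_sec hq.1]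
    refine Prod.ext e (L.fibreCoord_eq ?_ ?_)
    · rw [e]
      exact hq.1
    · rw [e]
  open_source := (isOpen_extChartAt_source b).preimage L.contMDiff_πHat.continuous
  open_target := (isOpen_extChartAt_source b).prod isOpen_univ
  continuousOn_toFun x hx := (L.contMDiff_πHat.continuous.continuousAt.prodMk
    (L.contMDiffAt_fibreCoord hx).continuousAt).continuousWithinAt
  continuousOn_invFun :=
    L.contMDiffVAdd.contMDiff_vadd.continuous.comp_continuousOn
      (continuousOn_snd.prodMk ((L.contMDiffOn_sec b).continuousOn.comp continuousOn_fst
        fun q hq => hq.1))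
  baseSet := (extChartAt EigenData.IBase b).source
  open_baseSet := isOpen_extChartAt_source b
  source_eq := rfl
  target_eq := rfl
  proj_toFun _ _ := rfl

theorem isPrincipalBundle_πHat :
    IsPrincipalBundle (S := L.S1) 𝓘(ℝ, ℝ) 𝓘(ℝ, Fin 5 → ℝ) EigenData.IBase L.πHat where
  smooth_action := L.contMDiffVAdd
  smooth_proj := L.contMDiff_πHat
  proj_vadd := L.πHat_vadd
  trivialization b := by
    refine ⟨L.triv b, mem_extChartAt_source b, ?_, ?_, ?_⟩
    · intro x hx
      exact ((L.contMDiff_πHat x).prodMk (L.contMDiffAt_fibreCoord hx)).contMDiffWithinAt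
    · have h : ContMDiffOn (EigenData.IBase.prod 𝓘(ℝ, ℝ)) (𝓘(ℝ, ℝ).prod 𝓘(ℝ, Fin 5 → ℝ)) ∞
          (fun q : L.Base × L.S1 => (q.2, L.sec b q.1)) (L.triv b).target :=
        contMDiffOn_snd.prodMk ((L.contMDiffOn_sec b).comp contMDiffOn_fst fun q hq => hq.1)
      exact L.contMDiffVAdd.contMDiff_vadd.comp_contMDiffOn h
    · intro s x hx
      refine L.fibreCoord_eq ?_ ?_
      · rw [L.πHat_vadd]
        exact hx
      · rw [L.πHat_vadd, add_vadd]
        exact congrArg (s +ᵥ ·) (L.fibreCoord_vadd hx)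

end LatticeData

end RegularContact

end

theorem mainTheorem3 (L : LatticeData) :
    -- `Ĝ(p)` and `K̂` are compact Hausdorff quotients of solvable groups
    (Group.IsSolvable (G L.p) ∧ CompactSpace L.GHat ∧ T2Space L.GHat) ∧
    (Group.IsSolvable (K L.p) ∧ CompactSpace L.KHat ∧ T2Space L.KHat) ∧
    -- the forms with a hat are those induced by the left-invariant forms
    (pullback 𝓘(ℝ, Fin 5 → ℝ) 𝓘(ℝ, Fin 5 → ℝ) L.projG L.ηHat = L.η ∧
      pullback 𝓘(ℝ, Fin 3 → ℝ) 𝓘(ℝ, Fin 3 → ℝ) L.projK L.αKHat = L.αK ∧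
      pullback 𝓘(ℝ, Fin 3 → ℝ) 𝓘(ℝ, Fin 3 → ℝ) L.projK L.βKHat = L.βK ∧
      pullback 𝓘(ℝ, Fin 3 → ℝ) 𝓘(ℝ, Fin 3 → ℝ) L.projK L.θKHat = L.θK ∧
      pullback 𝓘(ℝ, ℝ) 𝓘(ℝ, ℝ) L.projS1 L.ωHat = EigenData.dt ∧
      ∀ g, mfderiv 𝓘(ℝ, Fin 5 → ℝ) 𝓘(ℝ, Fin 5 → ℝ) L.projG g (L.ξ g) = L.ξHat (L.projG g)) ∧
    -- `η̂` is a contact form with Reeb vector field `ξ̂`, and it is regular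
    IsContactForm 𝓘(ℝ, Fin 5 → ℝ) L.ηHat ∧
    IsReebField 𝓘(ℝ, Fin 5 → ℝ) L.ηHat L.ξHat ∧
    IsRegularContactForm L.ηHat ∧
    -- the flow of the Reeb vector field is an action of the circle `ℝ / z₂ℤ`, which makes
    -- `π̂ : Ĝ(p) → K̂ × S¹` a principal bundle
    (∃ _ : AddAction L.S1 L.GHat,
      (∀ x : L.GHat, IsMIntegralCurve (I := 𝓘(ℝ, Fin 5 → ℝ))
        (fun s : ℝ => (s : L.S1) +ᵥ x) L.ξHat) ∧
      IsPrincipalBundle (S := L.S1) 𝓘(ℝ, ℝ) 𝓘(ℝ, Fin 5 → ℝ) EigenData.IBase L.πHat) ∧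
    -- the fibres of `π̂` are the orbits of the Reeb vector field
    (∀ x y : L.GHat, L.πHat x = L.πHat y ↔
      ∃ γ : ℝ → L.GHat, IsMIntegralCurve (I := 𝓘(ℝ, Fin 5 → ℝ)) γ L.ξHat ∧
        γ 0 = x ∧ ∃ s : ℝ, γ s = y) ∧
    -- `Ω̂` is symplectic, and it is the only form on the base whose pullback is `dη̂`
    IsSymplecticForm EigenData.IBase L.ΩHat ∧
    (∀ σ : DForm EigenData.IBase L.Base 2,
      pullback 𝓘(ℝ, Fin 5 → ℝ) EigenData.IBase L.πHat σ = dExt 𝓘(ℝ, Fin 5 → ℝ) L.ηHat ↔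
        σ = L.ΩHat) :=
  -- The Hausdorff property comes from the proper discontinuity of the action of a discrete
  -- subgroup.
  ⟨⟨G.isSolvable _, L.compactSpace_GHat, inferInstance⟩,
    ⟨K.isSolvable _, L.compactSpace_KHat, inferInstance⟩,
    ⟨L.pullback_ηHat, L.pullback_αKHat, L.pullback_βKHat, L.pullback_θKHat, L.pullback_ωHat,
      L.mfderiv_projG_ξ⟩,
    L.isContactForm_ηHat, L.isReebField_ξHat, L.isRegularContactForm_ηHat,
    ⟨L.circleAction, L.isMIntegralCurve_vadd, L.isPrincipalBundle_πHat⟩,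
    L.πHat_eq_iff, L.isSymplecticForm_ΩHat, L.pullback_πHat_eq_iff⟩
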